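/- Let $M$ be a compact connected smooth manifold without boundary, endowed with a Riemannian metric, and let $H:T^*M\to\mathbb{R}$ be a Tonelli Hamiltonian: $H$ is of class $C^2$, $H_{pp}>0$ everywhere, and for every $K$ there is $C$ with $H(x,p)\ge K|p|_x-C$ for all $(x,p)\in T^*M$. Let $L(x,v)=\sup_{p\in T^*_xM}\{p(v)-H(x,p)\}$ be the Lagrangian, and for $t>0$ let $$A_t(x,y)=\inf\Big\{\int_0^tL(\xi,\dot\xi)\,ds:\ \xi:[0,t]\to M \text{ absolutely continuous},\ \xi(0)=x,\ \xi(t)=y\Big\},\qquad T^+_t\phi(x)=\sup_{y\in M}\{\phi(y)-A_t(x,y)\}.$$ Let $\phi:M\to\mathbb{R}$ be semiconcave with linear modulus, with superdifferential $D^+\phi(x)\subset T^*_xM$. Fix $T>0$ and $x_0\in M$. Let $\Delta_m$, $m\in\mathbb{N}$, be partitions $0=\tau_0<\tau_1<\cdots\to\infty$ of $[0,\infty)$ (the points $\tau_i$ depend on $m$) with width $|\Delta_m|=\sup_i(\tau_{i+1}-\tau_i)\to0$ as $m\to\infty$, and let $\tau_{\Delta_m}(t)$ be the first point of $\Delta_m$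 that is $>t$. For each $m$ let $\mathbf{x}_m:[0,T]\to M$ be a continuous, piecewise $C^1$ solution of $$\dot{\mathbf{x}}_m(t)=H_p(\mathbf{x}_m(t),\mathbf{p}_m(t)),\qquad \mathbf{p}_m(t)=D\,T^+_{\tau_{\Delta_m}(t)-t}\phi\,(\mathbf{x}_m(t)),\qquad \mathbf{x}_m(0)=x_0,$$ where the equation is required off the points of $\Delta_m$. Suppose that $\mathbf{x}_m$ converges to $\mathbf{x}$ uniformly on $[0,T]$. Then there is a family of Borel probability measures $\nu_t$ on $T^*_{\mathbf{x}(t)}M$, $t\in[0,T]$, such that, with $\overline{H}_p(t)=\int H_p(\mathbf{x}(t),p)\,d\nu_t(p)\in T_{\mathbf{x}(t)}M$: 1. $\operatorname{supp}\nu_t\subset D^+\phi(\mathbf{x}(t))$ for all $t\in[0,T]$, and there is a subsequence $(m_k)$ with $H_p(\mathbf{x}_{m_k},\mathbf{p}_{m_k})\overset{*}{\rightharpoonup}\overline{H}_p$ in $L^\infty([0,T])$; that is, for every $f\in C^1(M)$ the functions $t\mapsto df_{\mathbf{x}_{m_k}(t)}\big(H_p(\mathbf{x}_{m_k}(t),\mathbf{p}_{m_k}(t))\big)$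 converge to $t\mapsto df_{\mathbf{x}(t)}(\overline{H}_p(t))$ weakly-$*$ in $L^\infty([0,T])$. 2. $\dot{\mathbf{x}}(t)=\overline{H}_p(t)$ for a.e. $t\in[0,T]$. 3. $\mathbf{x}$ is a generalized characteristic from $x_0$ on $[0,T]$: it is Lipschitz, $\mathbf{x}(0)=x_0$, and $\dot{\mathbf{x}}(t)\in\operatorname{co}H_p(\mathbf{x}(t),D^+\phi(\mathbf{x}(t)))$ for a.e. $t\in[0,T]$. -/

import Mathlib

open Set Filter MeasureTheory Manifold Bundle
open scoped Topology ContDiff ENNReal NNReal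

namespace GHGF

noncomputable section

variable {n : ℕ} {M : Type*} [MetricSpace M] [ChartedSpace (EuclideanSpace ℝ (Fin n)) M]

/-- The cotangent space `T*_x M`. -/
abbrev CotangentSpace (n : ℕ) {M : Type*} [MetricSpace M]
    [ChartedSpace (EuclideanSpace ℝ (Fin n)) M] (x : M) : Type :=
  TangentSpace (𝓡 n) x →L[ℝ] ℝ

/-- The Borel `σ`-algebra of `T*_x M`. -/
instance (x : M) : MeasurableSpace (CotangentSpace n x) := borel _

instance (x : M) : BorelSpace (CotangentSpace n x) := ⟨rfl⟩

/-- `HasVelocityAt c t v`: the curve `c` in `M` is differentiable at time `t`, and its velocity is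
the tangent vector `v`. -/
def HasVelocityAt (c : ℝ → M) (t : ℝ) (v : TangentSpace (𝓡 n) (c t)) : Prop :=
  HasMFDerivAt 𝓘(ℝ, ℝ) (𝓡 n) c t
    (ContinuousLinearMap.toSpanSingleton ℝ v : ℝ →L[ℝ] TangentSpace (𝓡 n) (c t))

/-- The velocity `ċ(t)`, with the value `0` where `c` is not differentiable. -/
def velocity (n : ℕ) {M : Type*} [MetricSpace M] [ChartedSpace (EuclideanSpace ℝ (Fin n)) M]
    (c : ℝ → M) (t : ℝ) : TangentSpace (𝓡 n) (c t) :=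
  (mfderiv 𝓘(ℝ, ℝ) (𝓡 n) c t : ℝ →L[ℝ] TangentSpace (𝓡 n) (c t)) (1 : ℝ)

/-- `φ ∈ SCL(M)`: `φ` is continuous and, near every point, semiconcave with linear modulus in
local coordinates. -/
def IsSemiconcave (n : ℕ) {M : Type*} [MetricSpace M]
    [ChartedSpace (EuclideanSpace ℝ (Fin n)) M] (φ : M → ℝ) : Prop :=
  Continuous φ ∧ ∀ x₀ : M, ∃ C ≥ (0 : ℝ), ∃ r > (0 : ℝ),
    Metric.ball (extChartAt (𝓡 n) x₀ x₀) r ⊆ (extChartAt (𝓡 n) x₀).target ∧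
    ∀ z ∈ Metric.ball (extChartAt (𝓡 n) x₀ x₀) r,
    ∀ w ∈ Metric.ball (extChartAt (𝓡 n) x₀ x₀) r,
    ∀ l ∈ Icc (0 : ℝ) 1,
      l * φ ((extChartAt (𝓡 n) x₀).symm z) + (1 - l) * φ ((extChartAt (𝓡 n) x₀).symm w)
        - φ ((extChartAt (𝓡 n) x₀).symm (l • z + (1 - l) • w))
      ≤ C / 2 * l * (1 - l) * ‖z - w‖ ^ 2

/-- The superdifferential `D⁺φ(x) ⊆ T*_x M`: the covectors `p` with
`limsup_{y → x} (φ(y) - φ(x) - p(y - x)) / |y - x| ≤ 0`, read in the chart at `x` (the chart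
through which `T_x M` is identified with `ℝⁿ`). -/
def superdifferential (n : ℕ) {M : Type*} [MetricSpace M]
    [ChartedSpace (EuclideanSpace ℝ (Fin n)) M] (φ : M → ℝ) (x : M) :
    Set (CotangentSpace n x) :=
  {p | ∀ ε > (0 : ℝ), ∀ᶠ y in 𝓝 x,
    φ y ≤ φ x + (p : EuclideanSpace ℝ (Fin n) → ℝ) (extChartAt (𝓡 n) x y - extChartAt (𝓡 n) x x)
      + ε * ‖extChartAt (𝓡 n) x y - extChartAt (𝓡 n) x x‖}

/-- `H_p(x, p) ∈ T_x M`: the vector `v` that represents the differential of `H(x, ·)` at `p`,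
i.e. `d/ds H(x, p + s q) = q(v)` at `s = 0` for every covector `q`. -/
def Hp (H : ∀ x : M, CotangentSpace n x → ℝ) (x : M) (p : CotangentSpace n x) :
    TangentSpace (𝓡 n) x :=
  Classical.epsilon fun v : TangentSpace (𝓡 n) x =>
    ∀ q : CotangentSpace n x, HasDerivAt (fun s : ℝ => H x (p + s • q)) (q v) 0

/-- Tonelli Hamiltonians on a Riemannian manifold: `H` is of class `C²` on the cotangent bundle,
`H_pp > 0`, and `H` is superlinear in the fibres, uniformly on `M`. -/
structure IsTonelli [IsManifold (𝓡 n) ∞ M]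
    [RiemannianBundle (fun x : M => TangentSpace (𝓡 n) x)]
    (H : ∀ x : M, CotangentSpace n x → ℝ) : Prop where
  contMDiff : ContMDiff ((𝓡 n).prod 𝓘(ℝ, EuclideanSpace ℝ (Fin n) →L[ℝ] ℝ)) 𝓘(ℝ, ℝ) 2
    (fun P : TotalSpace (EuclideanSpace ℝ (Fin n) →L[ℝ] ℝ)
      (fun x : M => TangentSpace (𝓡 n) x →L[ℝ] Bundle.Trivial M ℝ x) => H P.1 P.2)
  hessian_pos : ∀ (x : M) (p q : CotangentSpace n x), q ≠ 0 →
    0 < iteratedDeriv 2 (fun s : ℝ => H x (p + s • q)) 0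
  superlinear : ∀ K : ℝ, ∃ C : ℝ, ∀ (x : M) (p : CotangentSpace n x), K * ‖p‖ - C ≤ H x p

/-- The Lagrangian `L(x, v) = sup_p (p(v) - H(x, p))`. -/
def lagrangian (H : ∀ x : M, CotangentSpace n x → ℝ) (x : M) (v : TangentSpace (𝓡 n) x) : ℝ :=
  ⨆ p : CotangentSpace n x, (p v - H x p)

/-- The fundamental solution `A_t(x, y)`, for `t > 0`: the infimum of the action over the
absolutely continuous curves from `x` to `y` in time `t`. (`L` is bounded below, so the curves
left out by the integrability requirement are those of action `+∞`.) -/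
def fundamentalSolution (H : ∀ x : M, CotangentSpace n x → ℝ) (t : ℝ) (x y : M) : ℝ :=
  sInf {a : ℝ | ∃ ξ : ℝ → M, AbsolutelyContinuousOnInterval ξ 0 t ∧ ξ 0 = x ∧ ξ t = y ∧
    IntervalIntegrable (fun s => lagrangian H (ξ s) (velocity n ξ s)) volume 0 t ∧
    a = ∫ s in (0 : ℝ)..t, lagrangian H (ξ s) (velocity n ξ s)}

/-- The positive Lax-Oleinik operator `T⁺_t φ(x) = sup_y (φ(y) - A_t(x, y))`, for `t > 0`. -/
def laxOleinikPos (H : ∀ x : M, CotangentSpace n x → ℝ) (t : ℝ) (φ : M → ℝ) (x : M) : ℝ :=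
  ⨆ y : M, (φ y - fundamentalSolution H t x y)

/-- Partitions `0 = τ₀ < τ₁ < ⋯ → ∞` of `[0, ∞)` of finite width. -/
structure HalfLinePartition where
  τ : ℕ → ℝ
  zero : τ 0 = 0
  strictMono : StrictMono τ
  tendsto : Tendsto τ atTop atTop
  bddAbove : BddAbove (range fun i => τ (i + 1) - τ i)

/-- The width `|Δ| = sup_i (τ_{i+1} - τ_i)`. -/
def HalfLinePartition.width (Δ : HalfLinePartition) : ℝ := ⨆ i, (Δ.τ (i + 1) - Δ.τ i)

/-- The first partition point after time `t`. -/
def HalfLinePartition.next (Δ : HalfLinePartition) (t : ℝ) : ℝ :=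
  sInf {s | s ∈ range Δ.τ ∧ t < s}

/-- The covector `D T⁺_{τ_Δ(t) - t} φ (x)`. -/
def momentum (H : ∀ x : M, CotangentSpace n x → ℝ) (φ : M → ℝ) (Δ : HalfLinePartition)
    (t : ℝ) (x : M) : CotangentSpace n x :=
  mfderiv (𝓡 n) 𝓘(ℝ, ℝ) (laxOleinikPos H (Δ.next t - t) φ) x

/-- `c` solves `ċ(t) = H_p(c(t), D T⁺_{τ_Δ(t) - t} φ(c(t)))` on `[0, T]` with `c(0) = x₀`: it is
continuous and satisfies the equation off the partition points. -/
structure IsSolution (H : ∀ x : M, CotangentSpace n x → ℝ) (φ : M → ℝ) (Δ : HalfLinePartition)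
    (T : ℝ) (x₀ : M) (c : ℝ → M) : Prop where
  continuousOn : ContinuousOn c (Icc 0 T)
  initial : c 0 = x₀
  ode : ∀ t ∈ Ioo 0 T, t ∉ range Δ.τ → HasVelocityAt c t (Hp H (c t) (momentum H φ Δ t (c t)))

/-- Weak-* convergence `g_k ⇀ g` in `L^∞([0, T])`. -/
def WeakStarLInfty (T : ℝ) (g : ℕ → ℝ → ℝ) (g₀ : ℝ → ℝ) : Prop :=
  (∀ k, MemLp (g k) ∞ (volume.restrict (Icc 0 T))) ∧
  MemLp g₀ ∞ (volume.restrict (Icc 0 T)) ∧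
  ∀ Ψ : ℝ → ℝ, IntegrableOn Ψ (Icc 0 T) →
    Tendsto (fun k => ∫ t in Icc 0 T, Ψ t * g k t) atTop (𝓝 (∫ t in Icc 0 T, Ψ t * g₀ t))

/-- Weak-* convergence in `L^∞([0, T])` of vector fields `V k` along curves `c k` to a vector field
`V₀` along a curve `c₀`. As the vectors live in different tangent spaces, they are compared through
the differentials of `C¹` functions `f` on `M`: with the components of an embedding of `M` into
`ℝᴺ` as `f`, this is weak-* convergence in `L^∞([0, T]; ℝᴺ)`. -/
def WeakStarAlong (T : ℝ) (c : ℕ → ℝ → M) (V : ∀ (k : ℕ) (t : ℝ), TangentSpace (𝓡 n) (c k t))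
    (c₀ : ℝ → M) (V₀ : ∀ t : ℝ, TangentSpace (𝓡 n) (c₀ t)) : Prop :=
  ∀ f : M → ℝ, ContMDiff (𝓡 n) 𝓘(ℝ, ℝ) 1 f →
    WeakStarLInfty T
      (fun k t => (mfderiv (𝓡 n) 𝓘(ℝ, ℝ) f (c k t) : CotangentSpace n (c k t)) (V k t))
      (fun t => (mfderiv (𝓡 n) 𝓘(ℝ, ℝ) f (c₀ t) : CotangentSpace n (c₀ t)) (V₀ t))

/-- `c` is a generalized characteristic of `(φ, H)` from `x₀` on `[0, T]`: a Lipschitz curve with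
`c(0) = x₀` and `ċ(t) ∈ co H_p(c(t), D⁺φ(c(t)))` for a.e. `t ∈ [0, T]`. -/
structure IsGeneralizedCharacteristic (H : ∀ x : M, CotangentSpace n x → ℝ) (φ : M → ℝ)
    (T : ℝ) (x₀ : M) (c : ℝ → M) : Prop where
  lipschitz : ∃ K : ℝ≥0, LipschitzOnWith K c (Icc 0 T)
  initial : c 0 = x₀
  inclusion : ∀ᵐ t ∂(volume.restrict (Icc 0 T)), ∃ v : TangentSpace (𝓡 n) (c t),
    HasVelocityAt c t v ∧ v ∈ convexHull ℝ (Hp H (c t) '' superdifferential n φ (c t))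

end

end GHGF

/-! The momenta are differentials of T⁺_s φ with 0 < s at most the width of the partition, so
everything depends on T⁺_s φ as s → 0. The key fact (`exists_laxOleinikPos_regularity`) is that near
every point and for all small s the function u = T⁺_s φ is differentiable, is within Cs of φ, has
differentials bounded by C in the chart, and satisfies u(y) ≤ u(z) + P(y - z) + C|y - z|², where P
is the differential at z and C does not depend on s. Replacing u by φ in this inequality costs only
2Cs. Hence limits of such P as s → 0 and z → c are quadratic supergradients of φ at c, and by
compactness the velocities H_p(y, D T⁺_s φ(y)) approach H_p(c, D) for a compact D contained in
D⁺φ(c) (`exists_velocityField_near`).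

Granted this, the limit is handled by averages. In a chart, a difference quotient of an
approximating curve is an average of its velocities, so it lies in any closed convex set that
contains them, and this survives uniform convergence. With a ball as convex set, the limit curve is
Lipschitz, hence differentiable almost everywhere; with closed ε-thickenings of the compact set co
H_p(x(t), D), its velocity at t lies in co H_p(x(t), D⁺φ(x(t)))
(`mem_convexHull_of_hasVelocityAt_limit`). A point of that hull is the mean of H_p for a finitely
supported probability measure on D⁺φ(x(t)). This measure is taken as ν_t, so the differential
equation holds by construction, and neither Young measures nor a measurable selection in t is
needed. For the weak-* convergence, the primitives of df(velocity) are increments of f along the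
curves: they converge, and the integrands are uniformly bounded once the width is small. A tail of
the sequence therefore serves as the subsequence (`exists_weakStarAlong_limit`).

The regularity of T⁺_s φ is obtained without existence or regularity of minimizers. In a chart, it
coincides for short times with the value function of a control problem with speeds at most K.
Averaging two controls gives an upper bound for second differences: the semiconcavity of φ and the
dependence of L on position lose a multiple of the squared distance between the trajectories, and
strong convexity of L in the velocity pays for its growth when s is small. Moving the initial point
while keeping the endpoint gives a lower bound with constant of order s + 1/s. Two-sided bounds give
differentiability (`exists_hasFDerivAt_of_second_difference_le`); only the upper one, uniform in s,
enters the quadratic inequality. The needed second-difference inequalities for L come from those for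
H by trial covectors in the Legendre transform, so L is never differentiated.

The value function is identified with T⁺_s φ by a verification argument for absolutely continuous
curves that stay in the chart (`IsLocalData.le_value_of_absolutelyContinuous`), while superlinearity
makes curves that leave the chart in a short time too expensive. -/

namespace GHGF

noncomputable section

set_option linter.unusedSectionVars false

/-! ### Second differences of C² functions -/

section SecondDifference

/-- A lower bound on the second derivative bounds the symmetric second difference from below. -/
theorem le_second_difference {g g' g'' : ℝ → ℝ} {m : ℝ}
    (h₁ : ∀ τ ∈ Icc (-1 : ℝ) 1, HasDerivAt g (g' τ) τ)
    (h₂ : ∀ τ ∈ Icc (-1 : ℝ) 1, HasDerivAt g' (g'' τ) τ)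
    (hm : ∀ τ ∈ Icc (-1 : ℝ) 1, m ≤ g'' τ) : m ≤ g 1 + g (-1) - 2 * g 0 := by
  have hneg : ∀ τ ∈ Icc (0 : ℝ) 1, -τ ∈ Icc (-1 : ℝ) 1 := fun τ hτ =>
    ⟨by linarith [hτ.2], by linarith [hτ.1]⟩
  have hpos : ∀ τ ∈ Icc (0 : ℝ) 1, τ ∈ Icc (-1 : ℝ) 1 := fun τ hτ =>
    ⟨by linarith [hτ.1], hτ.2⟩
  -- The function g(τ) + g(-τ) - mτ² has a derivative that vanishes at 0 and is nondecreasing on [0,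
  -- 1], so its value at 1 is at least its value at 0.
  have hj : ∀ τ ∈ Icc (0 : ℝ) 1, HasDerivAt (fun τ => g' τ - g' (-τ) - 2 * m * τ)
      (g'' τ + g'' (-τ) - 2 * m) τ := by
    intro τ hτ
    have a := (h₂ (-τ) (hneg τ hτ)).scomp τ (hasDerivAt_neg τ)
    have b := ((h₂ τ (hpos τ hτ)).sub a).sub ((hasDerivAt_id τ).const_mul (2 * m))
    refine b.congr_deriv ?_
    simp
  have hk : ∀ τ ∈ Icc (0 : ℝ) 1, HasDerivAt (fun τ => g τ + g (-τ) - m * τ ^ 2)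
      (g' τ - g' (-τ) - 2 * m * τ) τ := by
    intro τ hτ
    have a := (h₁ (-τ) (hneg τ hτ)).scomp τ (hasDerivAt_neg τ)
    have b := ((h₁ τ (hpos τ hτ)).add a).sub ((hasDerivAt_pow 2 τ).const_mul m)
    refine b.congr_deriv ?_
    simp; ring
  have mj : MonotoneOn (fun τ => g' τ - g' (-τ) - 2 * m * τ) (Icc (0 : ℝ) 1) := by
    apply monotoneOn_of_hasDerivWithinAt_nonneg (convex_Icc 0 1)
      (fun τ hτ => (hj τ hτ).continuousAt.continuousWithinAt)
      (fun τ hτ => (hj τ (interior_subset hτ)).hasDerivWithinAt)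
    intro τ hτ
    have := interior_subset hτ
    linarith [hm τ (hpos τ this), hm (-τ) (hneg τ this)]
  have mk : MonotoneOn (fun τ => g τ + g (-τ) - m * τ ^ 2) (Icc (0 : ℝ) 1) := by
    apply monotoneOn_of_hasDerivWithinAt_nonneg (convex_Icc 0 1)
      (fun τ hτ => (hk τ hτ).continuousAt.continuousWithinAt)
      (fun τ hτ => (hk τ (interior_subset hτ)).hasDerivWithinAt)
    intro τ hτ
    have := interior_subset hτ
    have := mj (left_mem_Icc.2 zero_le_one) this this.1
    simpa using this
  have := mk (left_mem_Icc.2 zero_le_one) (right_mem_Icc.2 zero_le_one) zero_le_one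
  simp at this
  linarith

variable {V : Type*} [NormedAddCommGroup V] [NormedSpace ℝ V]

theorem hasDerivAt_fderiv_line {F : V → ℝ} {U : Set V} (hU : IsOpen U)
    (hF : ContDiffOn ℝ 2 F U) {a b : V} {τ : ℝ} (h : a + τ • b ∈ U) :
    HasDerivAt (fun τ : ℝ => F (a + τ • b)) (fderiv ℝ F (a + τ • b) b) τ ∧
    HasDerivAt (fun τ : ℝ => fderiv ℝ F (a + τ • b) b)
      (fderiv ℝ (fderiv ℝ F) (a + τ • b) b b) τ := by
  have hl : HasDerivAt (fun τ : ℝ => a + τ • b) b τ := by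
    simpa using ((hasDerivAt_id τ).smul_const b).const_add a
  have hd : DifferentiableAt ℝ F (a + τ • b) :=
    (hF.contDiffAt (hU.mem_nhds h)).differentiableAt (by simp)
  have hd2 : DifferentiableAt ℝ (fderiv ℝ F) (a + τ • b) :=
    ((hF.contDiffAt (hU.mem_nhds h)).fderiv_right (m := 1) (by norm_num)).differentiableAt (by simp)
  refine ⟨hd.hasFDerivAt.comp_hasDerivAt τ hl, ?_⟩
  exact ((ContinuousLinearMap.apply ℝ ℝ b).hasFDerivAt.comp _
    hd2.hasFDerivAt).comp_hasDerivAt τ hl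

theorem le_second_difference_of_contDiffOn {F : V → ℝ} {U : Set V} (hU : IsOpen U)
    (hF : ContDiffOn ℝ 2 F U) {a b : V} (h : ∀ τ ∈ Icc (-1 : ℝ) 1, a + τ • b ∈ U) {m : ℝ}
    (hm : ∀ τ ∈ Icc (-1 : ℝ) 1, m ≤ fderiv ℝ (fderiv ℝ F) (a + τ • b) b b) :
    m ≤ F (a + b) + F (a - b) - 2 * F a := by
  have := le_second_difference (g := fun τ : ℝ => F (a + τ • b))
    (fun τ hτ => (hasDerivAt_fderiv_line hU hF (h τ hτ)).1)
    (fun τ hτ => (hasDerivAt_fderiv_line hU hF (h τ hτ)).2) hm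
  simpa [sub_eq_add_neg] using this

theorem second_difference_le_of_contDiffOn {F : V → ℝ} {U : Set V} (hU : IsOpen U)
    (hF : ContDiffOn ℝ 2 F U) {a b : V} (h : ∀ τ ∈ Icc (-1 : ℝ) 1, a + τ • b ∈ U) {m : ℝ}
    (hm : ∀ τ ∈ Icc (-1 : ℝ) 1, fderiv ℝ (fderiv ℝ F) (a + τ • b) b b ≤ m) :
    F (a + b) + F (a - b) - 2 * F a ≤ m := by
  have := le_second_difference (g := fun τ : ℝ => - F (a + τ • b)) (m := -m)
    (fun τ hτ => (hasDerivAt_fderiv_line hU hF (h τ hτ)).1.neg)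
    (fun τ hτ => (hasDerivAt_fderiv_line hU hF (h τ hτ)).2.neg)
    (fun τ hτ => neg_le_neg (hm τ hτ))
  simp [← sub_eq_add_neg] at this
  linarith

variable {X Y : Type*} [NormedAddCommGroup X] [NormedSpace ℝ X]
  [NormedAddCommGroup Y] [NormedSpace ℝ Y] [FiniteDimensional ℝ Y]

set_option synthInstance.maxHeartbeats 200000 in
/-- Two-sided second difference estimates, on compact sets, for a `C²` function that is uniformly
convex in its second variable. -/
theorem exists_second_difference_bounds {F : X × Y → ℝ} {U B : Set X} (hU : IsOpen U)
    (hF : ContDiffOn ℝ 2 F (U ×ˢ univ)) (hB : IsCompact B) (hBc : Convex ℝ B) (hBU : B ⊆ U)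
    (hpos : ∀ z ∈ U, ∀ p q : Y, q ≠ 0 → 0 < fderiv ℝ (fderiv ℝ F) (z, p) (0, q) (0, q))
    (R : ℝ) :
    ∃ θ > 0, ∃ C ≥ 0, ∀ z h : X, z + h ∈ B → z - h ∈ B → ∀ p δ : Y,
      ‖p + δ‖ ≤ R → ‖p - δ‖ ≤ R →
      θ * ‖δ‖ ^ 2 - C * ‖h‖ ^ 2 ≤ F (z + h, p + δ) + F (z - h, p - δ) - 2 * F (z, p) ∧
      F (z + h, p + δ) + F (z - h, p - δ) - 2 * F (z, p) ≤ C * (‖h‖ ^ 2 + ‖δ‖ ^ 2) := by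
  have hUo : IsOpen (U ×ˢ (univ : Set Y)) := hU.prod isOpen_univ
  have hD2 : ContinuousOn (fderiv ℝ (fderiv ℝ F)) (U ×ˢ univ) := by
    have h1 : ContDiffOn ℝ 1 (fderiv ℝ F) (U ×ˢ univ) := hF.fderiv_of_isOpen hUo (by norm_num)
    exact h1.continuousOn_fderiv_of_isOpen hUo (by norm_num)
  have hcomp : IsCompact (B ×ˢ Metric.closedBall (0 : Y) R) :=
    hB.prod (isCompact_closedBall _ _)
  have hsub : B ×ˢ Metric.closedBall (0 : Y) R ⊆ U ×ˢ univ := prod_mono hBU (subset_univ _)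
  obtain ⟨C₀, hC₀⟩ := hcomp.exists_bound_of_continuousOn (f := fderiv ℝ (fderiv ℝ F))
    (hD2.mono hsub)
  have hS : IsCompact ((B ×ˢ Metric.closedBall (0 : Y) R) ×ˢ Metric.sphere (0 : Y) 1) :=
    hcomp.prod (isCompact_sphere _ _)
  have hcont : ContinuousOn (fun w : (X × Y) × Y =>
      fderiv ℝ (fderiv ℝ F) w.1 (0, w.2) (0, w.2))
      ((B ×ˢ Metric.closedBall (0 : Y) R) ×ˢ Metric.sphere (0 : Y) 1) := by
    have h1 : ContinuousOn (fun w : (X × Y) × Y => fderiv ℝ (fderiv ℝ F) w.1)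
        ((B ×ˢ Metric.closedBall (0 : Y) R) ×ˢ Metric.sphere (0 : Y) 1) :=
      (hD2.mono hsub).comp continuousOn_fst (fun w hw => hw.1)
    have h2 : ContinuousOn (fun w : (X × Y) × Y => ((0 : X), w.2))
        ((B ×ˢ Metric.closedBall (0 : Y) R) ×ˢ Metric.sphere (0 : Y) 1) := by fun_prop
    exact (h1.clm_apply h2).clm_apply h2
  -- Positivity of the fibre Hessian becomes uniform by compactness of the unit sphere; homogeneity
  -- then gives all directions.
  obtain ⟨θ, hθ, hθ'⟩ := hS.exists_forall_le' hcont (a := 0) (by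
    rintro ⟨⟨z, p⟩, q⟩ ⟨⟨hz, -⟩, hq⟩
    exact hpos z (hBU hz) p q (by rintro rfl; simp at hq))
  have hθq : ∀ z ∈ B, ∀ p : Y, ‖p‖ ≤ R → ∀ q : Y,
      θ * ‖q‖ ^ 2 ≤ fderiv ℝ (fderiv ℝ F) (z, p) (0, q) (0, q) := by
    intro z hz p hp q
    rcases eq_or_ne q 0 with rfl | hq
    · have h0 : ((0 : X), (0 : Y)) = 0 := rfl
      simp [h0]
    have hq' : ‖q‖ ≠ 0 := norm_ne_zero_iff.2 hq
    have := hθ' ((z, p), ‖q‖⁻¹ • q) ⟨⟨hz, by simpa using hp⟩, by simp [norm_smul, hq']⟩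
    have h0 : ((0 : X), ‖q‖⁻¹ • q) = ‖q‖⁻¹ • ((0 : X), q) := by simp
    simp only [h0, map_smul, smul_apply, smul_eq_mul] at this
    have h3 := mul_le_mul_of_nonneg_left this (sq_nonneg ‖q‖)
    field_simp at h3
    linarith
  set C₁ := max C₀ 0
  have hC₁ : 0 ≤ C₁ := le_max_right _ _
  -- Half of the convexity θ‖δ‖² is spent, by Young's inequality, on the mixed terms 2C₁‖h‖‖δ‖; this
  -- costs 2C₁²/θ · ‖h‖². The pure h-term contributes the remaining C₁.
  refine ⟨θ / 2, by positivity, 2 * C₁ ^ 2 / θ + C₁, by positivity, ?_⟩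
  intro z h hzp hzm p δ hpp hpm
  have hseg : ∀ τ ∈ Icc (-1 : ℝ) 1, (z, p) + τ • (h, δ) ∈ B ×ˢ Metric.closedBall (0 : Y) R := by
    intro τ hτ
    have e1 : z + τ • h = ((1 + τ) / 2) • (z + h) + ((1 - τ) / 2) • (z - h) := by module
    have e2 : p + τ • δ = ((1 + τ) / 2) • (p + δ) + ((1 - τ) / 2) • (p - δ) := by module
    have n1 : 0 ≤ (1 + τ) / 2 := by linarith [hτ.1]
    have n2 : 0 ≤ (1 - τ) / 2 := by linarith [hτ.2]
    refine ⟨?_, ?_⟩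
    · change z + τ • h ∈ B
      rw [e1]; exact hBc hzp hzm n1 n2 (by ring)
    · change p + τ • δ ∈ _
      rw [e2]
      exact (convex_closedBall (0 : Y) R) (by simpa using hpp) (by simpa using hpm) n1 n2 (by ring)
  have hb : ∀ τ ∈ Icc (-1 : ℝ) 1, ∀ v w : X × Y,
      |fderiv ℝ (fderiv ℝ F) ((z, p) + τ • (h, δ)) v w| ≤ C₁ * ‖v‖ * ‖w‖ := by
    intro τ hτ v w
    refine (ContinuousLinearMap.le_opNorm₂ (fderiv ℝ (fderiv ℝ F) ((z, p) + τ • (h, δ)))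
      v w).trans ?_
    gcongr
    exact (hC₀ _ (hseg τ hτ)).trans (le_max_left _ _)
  constructor
  · refine le_second_difference_of_contDiffOn hUo hF (a := (z, p)) (b := (h, δ))
      (fun τ hτ => hsub (hseg τ hτ)) ?_
    intro τ hτ
    have hs := hseg τ hτ
    have e : (h, δ) = ((0 : X), δ) + (h, (0 : Y)) := by simp
    set D := fderiv ℝ (fderiv ℝ F) ((z, p) + τ • (h, δ)) with hD
    have b1 := hb τ hτ (0, δ) (h, 0)
    have b2 := hb τ hτ (h, 0) (0, δ)
    have b3 := hb τ hτ (h, 0) (h, 0)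
    have b4 : θ * ‖δ‖ ^ 2 ≤ D (0, δ) (0, δ) :=
      hθq (z + τ • h) hs.1 (p + τ • δ) (by simpa using hs.2) δ
    simp only [Prod.norm_mk, norm_zero, norm_nonneg, sup_of_le_right, sup_of_le_left,
      ← hD] at b1 b2 b3
    have expand : D (h, δ) (h, δ) = D (0, δ) (0, δ) + D (0, δ) (h, 0) + D (h, 0) (0, δ)
        + D (h, 0) (h, 0) := by
      rw [e]; simp only [map_add, add_apply]; ring
    rw [expand]
    have c1 := (abs_le.1 b1).1
    have c2 := (abs_le.1 b2).1
    have c3 := (abs_le.1 b3).1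
    have key : 2 * C₁ * ‖h‖ * ‖δ‖ ≤ θ / 2 * ‖δ‖ ^ 2 + 2 * C₁ ^ 2 / θ * ‖h‖ ^ 2 := by
      have := sq_nonneg (θ * ‖δ‖ - 2 * C₁ * ‖h‖)
      have h2 : θ / 2 * ‖δ‖ ^ 2 + 2 * C₁ ^ 2 / θ * ‖h‖ ^ 2 - 2 * C₁ * ‖h‖ * ‖δ‖
        = (θ * ‖δ‖ - 2 * C₁ * ‖h‖) ^ 2 / (2 * θ) := by field_simp; ring
      have : 0 ≤ (θ * ‖δ‖ - 2 * C₁ * ‖h‖) ^ 2 / (2 * θ) := by positivity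
      linarith
    nlinarith
  · refine second_difference_le_of_contDiffOn hUo hF (a := (z, p)) (b := (h, δ))
      (fun τ hτ => hsub (hseg τ hτ)) ?_
    intro τ hτ
    have b := (le_abs_self _).trans (hb τ hτ (h, δ) (h, δ))
    refine b.trans ?_
    have h1 : ‖(h, δ)‖ ^ 2 ≤ ‖h‖ ^ 2 + ‖δ‖ ^ 2 := by
      rw [Prod.norm_mk]
      rcases max_cases ‖h‖ ‖δ‖ with ⟨e, -⟩ | ⟨e, -⟩ <;> rw [e] <;> nlinarith [sq_nonneg ‖h‖, sq_nonneg ‖δ‖]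
    calc C₁ * ‖(h, δ)‖ * ‖(h, δ)‖ = C₁ * ‖(h, δ)‖ ^ 2 := by ring
      _ ≤ (2 * C₁ ^ 2 / θ + C₁) * (‖h‖ ^ 2 + ‖δ‖ ^ 2) := by
        gcongr
        have : 0 ≤ 2 * C₁ ^ 2 / θ := by positivity
        linarith

/-- A `C¹` function is Lipschitz on compact convex sets. -/
theorem exists_lipschitz_bound {F : V → ℝ} {U B : Set V} (hU : IsOpen U)
    (hF : ContDiffOn ℝ 1 F U) (hB : IsCompact B) (hBc : Convex ℝ B) (hBU : B ⊆ U) :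
    ∃ C ≥ 0, ∀ a ∈ B, ∀ b ∈ B, |F a - F b| ≤ C * ‖a - b‖ := by
  obtain ⟨C, hC⟩ := hB.exists_bound_of_continuousOn
    ((hF.continuousOn_fderiv_of_isOpen hU (by norm_num)).mono hBU)
  refine ⟨max C 0, le_max_right _ _, fun a ha b hb => ?_⟩
  refine hBc.norm_image_sub_le_of_norm_fderiv_le (𝕜 := ℝ) (f := F) (fun x hx => ?_)
    (fun x hx => (hC x hx).trans (le_max_left _ _)) hb ha
  exact (hF.contDiffAt (hU.mem_nhds (hBU hx))).differentiableAt (by simp)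

end SecondDifference

/-! ### Legendre transform: from Tonelli Hamiltonians to Lagrangians -/

section Legendre

variable {E : Type*} [NormedAddCommGroup E] [InnerProductSpace ℝ E] [FiniteDimensional ℝ E]

/-- The Legendre transform, in the fibres, of a Hamiltonian on (an open subset of) a vector
space. -/
def legendre {E : Type*} [NormedAddCommGroup E] [InnerProductSpace ℝ E]
    (H : E → (E →L[ℝ] ℝ) → ℝ) (z v : E) : ℝ := ⨆ p : E →L[ℝ] ℝ, (p v - H z p)

/-- Tonelli Hamiltonians on an open subset of a vector space. -/
structure IsLocalTonelli {E : Type*} [NormedAddCommGroup E] [InnerProductSpace ℝ E]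
    (H : E → (E →L[ℝ] ℝ) → ℝ) (U : Set E) : Prop where
  contDiffOn : ContDiffOn ℝ 2 (fun w : E × (E →L[ℝ] ℝ) => H w.1 w.2) (U ×ˢ univ)
  hessian_pos : ∀ z ∈ U, ∀ p q : E →L[ℝ] ℝ, q ≠ 0 →
    0 < iteratedDeriv 2 (fun s : ℝ => H z (p + s • q)) 0
  superlinear : ∀ K : ℝ, ∃ C : ℝ, ∀ z ∈ U, ∀ p : E →L[ℝ] ℝ, K * ‖p‖ - C ≤ H z p

/-- The properties of a Tonelli Lagrangian, on a compact convex set of positions, that are used in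
the analysis of the Lax-Oleinik operator. -/
structure IsLocalLagrangian {E : Type*} [NormedAddCommGroup E] [InnerProductSpace ℝ E]
    (L : E → E → ℝ) (B : Set E) : Prop where
  superlinear : ∀ Λ : ℝ, ∃ C ≥ 0, ∀ z ∈ B, ∀ v, Λ * ‖v‖ - C ≤ L z v
  rest_le : ∃ C ≥ 0, ∀ z ∈ B, L z 0 ≤ C
  lipschitz : ∀ K : ℝ, ∃ C ≥ 0, ∀ z ∈ B, ∀ z' ∈ B, ∀ v v' : E, ‖v‖ ≤ K → ‖v'‖ ≤ K →
    |L z v - L z' v'| ≤ C * (‖z - z'‖ + ‖v - v'‖)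
  second_difference_le : ∀ K : ℝ, ∃ C ≥ 0, ∀ z h v k : E, z + h ∈ B → z - h ∈ B →
    ‖v + k‖ ≤ K → ‖v - k‖ ≤ K →
    L (z + h) (v + k) + L (z - h) (v - k) - 2 * L z v ≤ C * (‖h‖ ^ 2 + ‖k‖ ^ 2)
  le_second_difference : ∀ K : ℝ, ∃ θ > 0, ∃ C ≥ 0, ∀ z h v k : E, z + h ∈ B → z - h ∈ B →
    ‖v + k‖ ≤ K → ‖v - k‖ ≤ K →
    θ * ‖k‖ ^ 2 - C * ‖h‖ ^ 2 ≤ L (z + h) (v + k) + L (z - h) (v - k) - 2 * L z v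

variable {H : E → (E →L[ℝ] ℝ) → ℝ} {U B : Set E}

/-- Translates the Hessian condition, stated along lines in the fibre, into the second Fréchet
derivative on position-momentum space that `exists_second_difference_bounds` uses. -/
theorem IsLocalTonelli.fderiv_fderiv_pos (hH : IsLocalTonelli H U) (hU : IsOpen U) :
    ∀ z ∈ U, ∀ p q : E →L[ℝ] ℝ, q ≠ 0 →
      0 < fderiv ℝ (fderiv ℝ (fun w : E × (E →L[ℝ] ℝ) => H w.1 w.2)) (z, p) (0, q) (0, q) := by
  intro z hz p q hq
  set F : E × (E →L[ℝ] ℝ) → ℝ := fun w => H w.1 w.2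
  have hmem : ∀ s : ℝ, (z, p) + s • ((0 : E), q) ∈ U ×ˢ (univ : Set (E →L[ℝ] ℝ)) := by
    intro s; simpa using hz
  have key := fun s => hasDerivAt_fderiv_line (hU.prod isOpen_univ) hH.contDiffOn (hmem s)
  have e1 : (fun s : ℝ => H z (p + s • q)) = fun s : ℝ => F ((z, p) + s • ((0 : E), q)) := by
    ext s; simp [F]
  have e2 : deriv (fun s : ℝ => H z (p + s • q)) =
      fun s : ℝ => fderiv ℝ F ((z, p) + s • ((0 : E), q)) (0, q) := by
    rw [e1]; ext s; exact (key s).1.deriv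
  have e3 : iteratedDeriv 2 (fun s : ℝ => H z (p + s • q)) 0
      = fderiv ℝ (fderiv ℝ F) (z, p) (0, q) (0, q) := by
    rw [iteratedDeriv_succ, iteratedDeriv_one, e2, (key 0).2.deriv]
    simp [F]
  rw [← e3]
  exact hH.hessian_pos z hz p q hq

theorem IsLocalTonelli.bddAbove (hH : IsLocalTonelli H U) {z : E} (hz : z ∈ U) (v : E) :
    BddAbove (range fun p : E →L[ℝ] ℝ => p v - H z p) := by
  obtain ⟨C, hC⟩ := hH.superlinear ‖v‖
  refine ⟨C, ?_⟩
  rintro _ ⟨p, rfl⟩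
  have h1 := hC z hz p
  have h2 := (le_abs_self _).trans (p.le_opNorm v)
  simp only
  nlinarith

theorem IsLocalTonelli.le_legendre (hH : IsLocalTonelli H U) {z : E} (hz : z ∈ U) (v : E)
    (p : E →L[ℝ] ℝ) : p v - H z p ≤ legendre H z v :=
  le_ciSup (hH.bddAbove hz v) p

theorem IsLocalTonelli.exists_bound (hH : IsLocalTonelli H U) (hB : IsCompact B) (hBU : B ⊆ U)
    (R : ℝ) : ∃ C ≥ 0, ∀ z ∈ B, ∀ p : E →L[ℝ] ℝ, ‖p‖ ≤ R → |H z p| ≤ C := by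
  obtain ⟨C, hC⟩ := (hB.prod (isCompact_closedBall (0 : E →L[ℝ] ℝ) R)).exists_bound_of_continuousOn
    (hH.contDiffOn.continuousOn.mono (prod_mono hBU (subset_univ _)))
  exact ⟨max C 0, le_max_right _ _, fun z hz p hp =>
    (hC (z, p) ⟨hz, by simpa using hp⟩).trans (le_max_left _ _)⟩

/-- With superlinear slope K + 1, the quantity p(v) - H(z, p) is at most C - ‖p‖, which falls below
its value at p = 0 as soon as ‖p‖ > C + C₀. The maximum is thus taken over a ball whose radius
depends only on K. -/
theorem IsLocalTonelli.exists_maximizer (hH : IsLocalTonelli H U) (hB : IsCompact B)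
    (hBU : B ⊆ U) (K : ℝ) : ∃ R ≥ 0, ∀ z ∈ B, ∀ v : E, ‖v‖ ≤ K →
      ∃ p : E →L[ℝ] ℝ, ‖p‖ ≤ R ∧ legendre H z v = p v - H z p := by
  obtain ⟨C, hC⟩ := hH.superlinear (K + 1)
  obtain ⟨C₀, hC₀, hC₀'⟩ := hH.exists_bound hB hBU 0
  refine ⟨max (C + C₀) 0, le_max_right _ _, fun z hz v hv => ?_⟩
  set R := max (C + C₀) 0
  have hcont : ContinuousOn (fun p : E →L[ℝ] ℝ => p v - H z p)
      (Metric.closedBall (0 : E →L[ℝ] ℝ) R) := by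
    apply ContinuousOn.sub (by fun_prop)
    exact hH.contDiffOn.continuousOn.comp (f := fun p : E →L[ℝ] ℝ => (z, p)) (by fun_prop)
      (fun p _ => ⟨hBU hz, mem_univ _⟩)
  obtain ⟨p, hp, hmax⟩ := (isCompact_closedBall (0 : E →L[ℝ] ℝ) R).exists_isMaxOn
    ⟨0, by simp [R]⟩ hcont
  refine ⟨p, by simpa using hp, le_antisymm (ciSup_le fun q => ?_) (hH.le_legendre (hBU hz) v p)⟩
  by_cases hq : ‖q‖ ≤ R
  · exact hmax (by simpa using hq)
  · have h0 : (0 : E →L[ℝ] ℝ) v - H z 0 ≤ p v - H z p := hmax (by simp [R])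
    refine le_trans ?_ h0
    have h1 := hC z (hBU hz) q
    have h2 := (le_abs_self _).trans (q.le_opNorm v)
    have h3 := (abs_le.1 (hC₀' z hz 0 (by simp))).2
    have h4 : C + C₀ < ‖q‖ := lt_of_le_of_lt (le_max_left _ _) (not_le.1 hq)
    have h5 : ‖q‖ * ‖v‖ ≤ ‖q‖ * K := by gcongr
    simp only [zero_apply]
    nlinarith

/-- Apart from the bound at rest, each field comes from inserting a well-chosen covector in the
supremum that defines L, as a competitor against maximizers at nearby points where needed. Convexity
and boundedness of the Hessian of H turn into upper and lower bounds, respectively, for second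
differences of L. -/
theorem IsLocalTonelli.isLocalLagrangian (hH : IsLocalTonelli H U) (hU : IsOpen U)
    (hB : IsCompact B) (hBc : Convex ℝ B) (hBU : B ⊆ U) :
    IsLocalLagrangian (legendre H) B where
  superlinear Λ := by
    obtain ⟨C, hC, hC'⟩ := hH.exists_bound hB hBU |Λ|
    refine ⟨C, hC, fun z hz v => ?_⟩
    -- The trial covector is |Λ| times a norming functional of v, so that its pairing with v is
    -- |Λ|‖v‖.
    obtain ⟨g, hg, hgv⟩ := exists_dual_vector'' ℝ v
    have h1 := hH.le_legendre (hBU hz) v (|Λ| • g)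
    have h2 := hC' z hz (|Λ| • g) (by
      rw [norm_smul, Real.norm_eq_abs, abs_abs]
      exact mul_le_of_le_one_right (abs_nonneg _) hg)
    have h3 := (abs_le.1 h2).2
    simp only [smul_apply, hgv, smul_eq_mul, RCLike.ofReal_real_eq_id, id_eq] at h1
    have h4 : Λ * ‖v‖ ≤ |Λ| * ‖v‖ := by gcongr; exact le_abs_self _
    linarith
  rest_le := by
    obtain ⟨C, hC⟩ := hH.superlinear 0
    refine ⟨max C 0, le_max_right _ _, fun z hz => ciSup_le fun p => ?_⟩
    have := hC z (hBU hz) p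
    have := le_max_left C 0
    simp only [map_zero]
    linarith
  lipschitz K := by
    obtain ⟨R, hR, hmax⟩ := hH.exists_maximizer hB hBU K
    obtain ⟨C, hC, hlip⟩ := exists_lipschitz_bound (hU.prod isOpen_univ)
      (hH.contDiffOn.of_le (by norm_num)) (hB.prod (isCompact_closedBall (0 : E →L[ℝ] ℝ) R))
      (hBc.prod (convex_closedBall _ _)) (prod_mono hBU (subset_univ _))
    have half : ∀ z ∈ B, ∀ z' ∈ B, ∀ v v' : E, ‖v‖ ≤ K →
        legendre H z v - legendre H z' v' ≤ (C + R) * (‖z - z'‖ + ‖v - v'‖) := by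
      intro z hz z' hz' v v' hv
      obtain ⟨p, hp, he⟩ := hmax z hz v hv
      have h1 := hH.le_legendre (hBU hz') v' p
      have h2 := hlip (z', p) ⟨hz', by simpa using hp⟩ (z, p) ⟨hz, by simpa using hp⟩
      have h3 := (le_abs_self _).trans (p.le_opNorm (v - v'))
      have h4 : ‖p‖ * ‖v - v'‖ ≤ R * ‖v - v'‖ := by gcongr
      have h5 := (abs_le.1 h2).2
      simp only [Prod.mk_sub_mk, sub_self, Prod.norm_mk, norm_zero, norm_nonneg, sup_of_le_left,
        norm_sub_rev z' z] at h5
      rw [map_sub] at h3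
      nlinarith [norm_nonneg (z - z'), norm_nonneg (v - v'), mul_nonneg hC (norm_nonneg (v - v')),
        mul_nonneg hR (norm_nonneg (z - z'))]
    refine ⟨C + R, by positivity, fun z hz z' hz' v v' hv hv' => abs_le.2 ⟨?_, ?_⟩⟩
    · have := half z' hz' z hz v' v hv'
      rw [norm_sub_rev z' z, norm_sub_rev v' v] at this
      linarith
    · exact half z hz z' hz' v v' hv
  second_difference_le K := by
    obtain ⟨R, hR, hmax⟩ := hH.exists_maximizer hB hBU K
    obtain ⟨θ, hθ, C, hC, hb⟩ := exists_second_difference_bounds hU hH.contDiffOn hB hBc hBU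
      (hH.fderiv_fderiv_pos hU) R
    refine ⟨C + 1 / θ, by positivity, fun z h v k hp hm hvp hvm => ?_⟩
    have hz : z ∈ B := by
      have : z = (1 / 2 : ℝ) • (z + h) + (1 / 2 : ℝ) • (z - h) := by module
      rw [this]; exact hBc hp hm (by norm_num) (by norm_num) (by norm_num)
    obtain ⟨p, hpR, hpe⟩ := hmax _ hp _ hvp
    obtain ⟨q, hqR, hqe⟩ := hmax _ hm _ hvm
    -- The mean of the two maximizers is tried at the centre (z, v). The linear terms leave 2δ(k),
    -- which the term -θ‖δ‖² from the convexity of H absorbs at the price ‖k‖²/θ.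
    set a := (1 / 2 : ℝ) • (p + q)
    set δ := (1 / 2 : ℝ) • (p - q)
    have ep : p = a + δ := by simp only [a, δ]; module
    have eq : q = a - δ := by simp only [a, δ]; module
    have h1 := hH.le_legendre (hBU hz) v a
    have h2 := (hb z h hp hm a δ (ep ▸ hpR) (eq ▸ hqR)).1
    rw [← ep, ← eq] at h2
    have h3 := (le_abs_self _).trans (δ.le_opNorm k)
    have h4 : p (v + k) + q (v - k) - 2 * a v = 2 * δ k := by
      rw [ep, eq]; simp only [map_add, map_sub, add_apply, sub_apply]; ring
    have h5 : 2 * (‖δ‖ * ‖k‖) ≤ θ * ‖δ‖ ^ 2 + 1 / θ * ‖k‖ ^ 2 := by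
      have : θ * ‖δ‖ ^ 2 + 1 / θ * ‖k‖ ^ 2 - 2 * (‖δ‖ * ‖k‖) = (θ * ‖δ‖ - ‖k‖) ^ 2 / θ := by
        field_simp; ring
      have : 0 ≤ (θ * ‖δ‖ - ‖k‖) ^ 2 / θ := by positivity
      linarith
    have h6 : 0 ≤ C * ‖k‖ ^ 2 := by positivity
    have h7 : 0 ≤ 1 / θ * ‖h‖ ^ 2 := by positivity
    rw [hpe, hqe]
    linarith
  le_second_difference K := by
    obtain ⟨R, hR, hmax⟩ := hH.exists_maximizer hB hBU K
    obtain ⟨θ, hθ, C, hC, hb⟩ := exists_second_difference_bounds hU hH.contDiffOn hB hBc hBU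
      (hH.fderiv_fderiv_pos hU) (R + |K|)
    refine ⟨1 / (1 + C), by positivity, C, hC, fun z h v k hp hm hvp hvm => ?_⟩
    have hz : z ∈ B := by
      have : z = (1 / 2 : ℝ) • (z + h) + (1 / 2 : ℝ) • (z - h) := by module
      rw [this]; exact hBc hp hm (by norm_num) (by norm_num) (by norm_num)
    have hv : ‖v‖ ≤ K := by
      have e : v = (1 / 2 : ℝ) • (v + k) + (1 / 2 : ℝ) • (v - k) := by module
      have := (convex_closedBall (0 : E) K) (by simpa using hvp) (by simpa using hvm)
        (by norm_num : (0 : ℝ) ≤ 1 / 2) (by norm_num : (0 : ℝ) ≤ 1 / 2) (by norm_num)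
      rw [← e] at this
      simpa using this
    have hk : ‖k‖ ≤ K := by
      have e : k = (1 / 2 : ℝ) • (v + k) + (1 / 2 : ℝ) • (-(v - k)) := by module
      have := (convex_closedBall (0 : E) K) (by simpa using hvp)
        (by rw [mem_closedBall_zero_iff, norm_neg]; exact hvm)
        (by norm_num : (0 : ℝ) ≤ 1 / 2) (by norm_num : (0 : ℝ) ≤ 1 / 2) (by norm_num)
      rw [← e] at this
      simpa using this
    obtain ⟨p, hpR, hpe⟩ := hmax _ hz _ hv
    -- The maximizer p at the centre is tilted to p ± a with a = c⟨k, ·⟩. The gain is 2c‖k‖² and the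
    -- loss is C(‖h‖² + c²‖k‖²); since Cc ≤ 1, at least c‖k‖² of the gain remains. As ‖a‖ ≤ |K|, the
    -- bounds on H are needed only up to radius R + |K|.
    set c := 1 / (1 + C) with hc
    have hc0 : 0 < c := by positivity
    have hc1 : c ≤ 1 := by rw [hc, div_le_one (by positivity)]; linarith
    have hcC : c * (1 + C) = 1 := by rw [hc]; field_simp
    set a : E →L[ℝ] ℝ := c • innerSL ℝ k
    have hak : a k = c * ‖k‖ ^ 2 := by simp [a]
    have han : ‖a‖ = c * ‖k‖ := by
      simp [a, norm_smul, abs_of_pos hc0]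
    have haK : ‖a‖ ≤ |K| := by
      rw [han]
      calc c * ‖k‖ ≤ 1 * ‖k‖ := by gcongr
        _ ≤ |K| := by rw [one_mul]; exact hk.trans (le_abs_self _)
    have h1 := hH.le_legendre (hBU hp) (v + k) (p + a)
    have h2 := hH.le_legendre (hBU hm) (v - k) (p - a)
    have h3 := (hb z h hp hm p a ((norm_add_le _ _).trans (by gcongr))
      ((norm_sub_le _ _).trans (by gcongr))).2
    have h4 : (p + a) (v + k) + (p - a) (v - k) - 2 * p v = 2 * (c * ‖k‖ ^ 2) := by
      simp only [map_add, map_sub, add_apply, sub_apply, hak]; ring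
    rw [han, mul_pow] at h3
    have h5 : C * c ^ 2 * ‖k‖ ^ 2 ≤ c * ‖k‖ ^ 2 := by
      gcongr
      nlinarith
    rw [hpe]
    nlinarith

end Legendre

/-! ### Differentiability from bounds on second differences -/

section Differentiability

variable {E : Type*} [NormedAddCommGroup E] [NormedSpace ℝ E]

/-- Successive dyadic difference quotients differ by 2ᵏ times a second difference with step 2⁻ᵏ⁻¹h,
since x and x + 2⁻ᵏh are symmetric about x + 2⁻ᵏ⁻¹h. A bound by the squared increment makes these
changes summable in k. -/
theorem dyadic_step {f : E → ℝ} {x : E} (h : E) (k : ℕ) :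
    (2 : ℝ) ^ (k + 1) * (f (x + ((2 : ℝ) ^ (k + 1))⁻¹ • h) - f x)
      - 2 ^ k * (f (x + ((2 : ℝ) ^ k)⁻¹ • h) - f x)
    = - (2 ^ k * (f ((x + ((2 : ℝ) ^ (k + 1))⁻¹ • h) + ((2 : ℝ) ^ (k + 1))⁻¹ • h)
      + f ((x + ((2 : ℝ) ^ (k + 1))⁻¹ • h) - ((2 : ℝ) ^ (k + 1))⁻¹ • h)
      - 2 * f (x + ((2 : ℝ) ^ (k + 1))⁻¹ • h))) := by
  have e1 : (x + ((2 : ℝ) ^ (k + 1))⁻¹ • h) + ((2 : ℝ) ^ (k + 1))⁻¹ • h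
      = x + ((2 : ℝ) ^ k)⁻¹ • h := by
    rw [add_assoc, ← add_smul]; congr 2; rw [pow_succ]; field_simp; norm_num
  rw [e1, add_sub_cancel_right]
  ring

theorem dyadic_mem_ball {x h : E} {ρ : ℝ} (hh : ‖h‖ < ρ) (k : ℕ) :
    x + ((2 : ℝ) ^ k)⁻¹ • h ∈ Metric.ball x ρ := by
  rw [Metric.mem_ball, dist_self_add_left, norm_smul, norm_inv, norm_pow, Real.norm_ofNat]
  refine lt_of_le_of_lt ?_ hh
  exact mul_le_of_le_one_left (norm_nonneg _) (inv_le_one_of_one_le₀ (one_le_pow₀ (by norm_num)))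

theorem dyadic_second_difference_eq {x h : E} (k : ℕ) :
    (x + ((2 : ℝ) ^ (k + 1))⁻¹ • h) + ((2 : ℝ) ^ (k + 1))⁻¹ • h = x + ((2 : ℝ) ^ k)⁻¹ • h := by
  rw [add_assoc, ← add_smul]; congr 2; rw [pow_succ]; field_simp; norm_num

/-- A function with derivative `D` at `x` whose second differences are bounded above lies below a
paraboloid that touches it at `x`. -/
theorem le_quadratic_of_second_difference_le {f : E → ℝ} {x : E} {ρ C : ℝ} {D : E →L[ℝ] ℝ}
    (hD : HasFDerivAt f D x)
    (h2 : ∀ y h : E, y + h ∈ Metric.ball x ρ → y - h ∈ Metric.ball x ρ →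
      f (y + h) + f (y - h) - 2 * f y ≤ C * ‖h‖ ^ 2) {y : E} (hy : y ∈ Metric.ball x ρ) :
    f y ≤ f x + D (y - x) + C / 2 * ‖y - x‖ ^ 2 := by
  set h := y - x with hh
  have hn : ‖h‖ < ρ := by rwa [Metric.mem_ball, dist_eq_norm] at hy
  set a : ℕ → ℝ := fun k => 2 ^ k * (f (x + ((2 : ℝ) ^ k)⁻¹ • h) - f x)
  have hlim : Tendsto a atTop (𝓝 (D h)) := by
    have hline : HasDerivAt (fun t : ℝ => f (x + t • h)) (D h) 0 := by
      have hl : HasDerivAt (fun τ : ℝ => x + τ • h) h 0 := by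
        simpa using ((hasDerivAt_id (0 : ℝ)).smul_const h).const_add x
      exact HasFDerivAt.comp_hasDerivAt 0 (by simpa using hD) hl
    have ht : Tendsto (fun k : ℕ => ((2 : ℝ) ^ k)⁻¹) atTop (𝓝[≠] 0) := by
      rw [tendsto_nhdsWithin_iff]
      refine ⟨?_, Eventually.of_forall fun k => by simp⟩
      have := tendsto_pow_atTop_nhds_zero_of_lt_one (r := (1 / 2 : ℝ)) (by norm_num) (by norm_num)
      simpa using this
    have := (hasDerivAt_iff_tendsto_slope_zero.1 hline).comp ht
    refine this.congr fun k => ?_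
    simp [a]
  -- The correction term is exactly what the one-sided bound allows the quotients to lose in later
  -- steps, so b is monotone; comparing b 0 with the limit D h gives the claim.
  set b : ℕ → ℝ := fun k => a k - C / 2 * ‖h‖ ^ 2 * ((2 : ℝ) ^ k)⁻¹
  have hb : Monotone b := by
    refine monotone_nat_of_le_succ fun k => ?_
    have hstep := dyadic_step (f := f) (x := x) h k
    have h3 := h2 (x + ((2 : ℝ) ^ (k + 1))⁻¹ • h) (((2 : ℝ) ^ (k + 1))⁻¹ • h)
      (by rw [dyadic_second_difference_eq]; exact dyadic_mem_ball hn k)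
      (by rw [add_sub_cancel_right]
          exact Metric.mem_ball_self ((norm_nonneg _).trans_lt hn))
    rw [norm_smul, norm_inv, norm_pow, Real.norm_ofNat, mul_pow] at h3
    have h4 := mul_le_mul_of_nonneg_left h3 (by positivity : (0 : ℝ) ≤ 2 ^ k)
    have h5 : (2 : ℝ) ^ k * (C * ((((2 : ℝ) ^ (k + 1))⁻¹) ^ 2 * ‖h‖ ^ 2))
      = C / 2 * ‖h‖ ^ 2 * ((2 : ℝ) ^ k)⁻¹ - C / 2 * ‖h‖ ^ 2 * ((2 : ℝ) ^ (k + 1))⁻¹ := by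
      rw [pow_succ]; field_simp; ring
    simp only [b, a]
    linarith
  have hblim : Tendsto b atTop (𝓝 (D h)) := by
    have : Tendsto (fun k : ℕ => ((2 : ℝ) ^ k)⁻¹) atTop (𝓝 0) := by
      have := tendsto_pow_atTop_nhds_zero_of_lt_one (r := (1 / 2 : ℝ)) (by norm_num) (by norm_num)
      simpa using this
    simpa using hlim.sub (this.const_mul (C / 2 * ‖h‖ ^ 2))
  have h0 := hb.ge_of_tendsto hblim 0
  simp only [b, a, pow_zero, inv_one, one_smul, one_mul, mul_one] at h0
  have : x + h = y := by simp [hh]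
  rw [this] at h0
  linarith

/-- A Lipschitz function whose second differences are bounded on both sides by a multiple of the
squared increment is differentiable. -/
theorem exists_hasFDerivAt_of_second_difference_le {f : E → ℝ} {x : E} {ρ C Λ : ℝ} (hρ : 0 < ρ)
    (hlip : ∀ y ∈ Metric.ball x ρ, ∀ z ∈ Metric.ball x ρ, |f y - f z| ≤ Λ * ‖y - z‖)
    (h2 : ∀ y h : E, y + h ∈ Metric.ball x ρ → y - h ∈ Metric.ball x ρ →
      |f (y + h) + f (y - h) - 2 * f y| ≤ C * ‖h‖ ^ 2) :
    ∃ D : E →L[ℝ] ℝ, HasFDerivAt f D x := by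
  set d : ℕ → E → ℝ := fun k h => 2 ^ k * (f (x + ((2 : ℝ) ^ k)⁻¹ • h) - f x) with hd
  have htwo : Tendsto (fun k : ℕ => ((2 : ℝ) ^ k)⁻¹) atTop (𝓝 0) := by
    have := tendsto_pow_atTop_nhds_zero_of_lt_one (r := (1 / 2 : ℝ)) (by norm_num) (by norm_num)
    simpa using this
  have hev : ∀ h : E, ∀ᶠ k : ℕ in atTop, x + ((2 : ℝ) ^ k)⁻¹ • h ∈ Metric.ball x ρ := by
    intro h
    have : Tendsto (fun k : ℕ => x + ((2 : ℝ) ^ k)⁻¹ • h) atTop (𝓝 (x + (0 : ℝ) • h)) :=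
      (htwo.smul_const h).const_add x
    rw [zero_smul, add_zero] at this
    exact this (Metric.ball_mem_nhds x hρ)
  have hdist : ∀ h : E, ‖h‖ < ρ → ∀ k, dist (d k h) (d (k + 1) h) ≤ C * ‖h‖ ^ 2 / 4 * (1 / 2) ^ k := by
    intro h hn k
    rw [dist_comm, Real.dist_eq, hd, dyadic_step (f := f) (x := x) h k, abs_neg, abs_mul,
      abs_of_pos (by positivity : (0 : ℝ) < 2 ^ k)]
    have h3 := h2 (x + ((2 : ℝ) ^ (k + 1))⁻¹ • h) (((2 : ℝ) ^ (k + 1))⁻¹ • h)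
      (by rw [dyadic_second_difference_eq]; exact dyadic_mem_ball hn k)
      (by rw [add_sub_cancel_right]
          exact Metric.mem_ball_self ((norm_nonneg _).trans_lt hn))
    rw [norm_smul, norm_inv, norm_pow, Real.norm_ofNat, mul_pow] at h3
    have h4 := mul_le_mul_of_nonneg_left h3 (by positivity : (0 : ℝ) ≤ 2 ^ k)
    refine h4.trans (le_of_eq ?_)
    rw [one_div_pow, pow_succ]; field_simp; ring
  have hsmall : ∀ h : E, ‖h‖ < ρ → ∃ l, Tendsto (fun k => d k h) atTop (𝓝 l) := fun h hn =>
    cauchySeq_tendsto_of_complete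
      (cauchySeq_of_le_geometric (1 / 2) (C * ‖h‖ ^ 2 / 4) (by norm_num) (hdist h hn))
  -- A large h is divided by a power of 2 to enter the ball; this shifts the index of the quotients
  -- and rescales them.
  have hall : ∀ h : E, ∃ l, Tendsto (fun k => d k h) atTop (𝓝 l) := by
    intro h
    obtain ⟨j, hj⟩ := (hev h).exists
    obtain ⟨l, hl⟩ := hsmall (((2 : ℝ) ^ j)⁻¹ • h) (by simpa [dist_eq_norm] using hj)
    refine ⟨2 ^ j * l, ?_⟩
    rw [← tendsto_add_atTop_iff_nat j]
    refine (hl.const_mul (2 ^ j)).congr fun k => ?_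
    simp only [hd, smul_smul, ← mul_inv, ← pow_add]
    ring
  choose D hDlim using hall
  have hDlip : ∀ h g : E, |D h - D g| ≤ Λ * ‖h - g‖ := by
    intro h g
    refine le_of_tendsto ((hDlim h).sub (hDlim g)).abs ?_
    filter_upwards [hev h, hev g] with k hk hk'
    have := hlip _ hk _ hk'
    have e : d k h - d k g = 2 ^ k * (f (x + ((2 : ℝ) ^ k)⁻¹ • h)
      - f (x + ((2 : ℝ) ^ k)⁻¹ • g)) := by simp only [hd]; ring
    rw [e, abs_mul, abs_of_pos (by positivity : (0 : ℝ) < 2 ^ k)]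
    refine (mul_le_mul_of_nonneg_left this (by positivity)).trans (le_of_eq ?_)
    rw [add_sub_add_left_eq_sub, ← smul_sub, norm_smul, norm_inv, norm_pow, Real.norm_ofNat]
    field_simp
  have hDadd : ∀ h g : E, D (h + g) = D h + D g := by
    intro h g
    have l1 : Tendsto (fun k => d k h + d k g - d (k + 1) (h + g)) atTop
        (𝓝 (D h + D g - D (h + g))) :=
      ((hDlim h).add (hDlim g)).sub ((tendsto_add_atTop_iff_nat 1).2 (hDlim (h + g)))
    -- The points x + 2⁻ᵏh and x + 2⁻ᵏg have midpoint x + 2⁻ᵏ⁻¹(h + g), which is why the sum is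
    -- taken one dyadic scale lower: the expression is 2ᵏ times a second difference, hence O(2⁻ᵏ).
    have l2 : Tendsto (fun k => d k h + d k g - d (k + 1) (h + g)) atTop (𝓝 0) := by
      have hz : Tendsto (fun k : ℕ => C * ‖h - g‖ ^ 2 / 4 * ((2 : ℝ) ^ k)⁻¹) atTop (𝓝 0) := by
        simpa using htwo.const_mul (C * ‖h - g‖ ^ 2 / 4)
      refine squeeze_zero_norm' ?_ hz
      filter_upwards [hev h, hev g] with k hk hk'
      have e1 : (x + ((2 : ℝ) ^ (k + 1))⁻¹ • (h + g)) + ((2 : ℝ) ^ (k + 1))⁻¹ • (h - g)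
          = x + ((2 : ℝ) ^ k)⁻¹ • h := by
        rw [pow_succ, mul_inv]; module
      have e2 : (x + ((2 : ℝ) ^ (k + 1))⁻¹ • (h + g)) - ((2 : ℝ) ^ (k + 1))⁻¹ • (h - g)
          = x + ((2 : ℝ) ^ k)⁻¹ • g := by
        rw [pow_succ, mul_inv]; module
      have h3 := h2 (x + ((2 : ℝ) ^ (k + 1))⁻¹ • (h + g)) (((2 : ℝ) ^ (k + 1))⁻¹ • (h - g))
        (by rwa [e1]) (by rwa [e2])
      rw [e1, e2, norm_smul, norm_inv, norm_pow, Real.norm_ofNat, mul_pow] at h3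
      have e3 : d k h + d k g - d (k + 1) (h + g) = 2 ^ k * (f (x + ((2 : ℝ) ^ k)⁻¹ • h) +
          f (x + ((2 : ℝ) ^ k)⁻¹ • g) - 2 * f (x + ((2 : ℝ) ^ (k + 1))⁻¹ • (h + g))) := by
        simp only [hd]; ring
      rw [Real.norm_eq_abs, e3, abs_mul, abs_of_pos (by positivity : (0 : ℝ) < 2 ^ k)]
      refine (mul_le_mul_of_nonneg_left h3 (by positivity)).trans (le_of_eq ?_)
      rw [pow_succ]; field_simp; ring
    have := tendsto_nhds_unique l1 l2
    linarith
  have hDcont : Continuous D := by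
    have : LipschitzWith Λ.toNNReal D := LipschitzWith.of_dist_le_mul fun h g => by
      rw [Real.dist_eq, dist_eq_norm]
      refine (hDlip h g).trans ?_
      gcongr
      exact Real.le_coe_toNNReal Λ
    exact this.continuous
  -- A continuous additive map is real-linear, so homogeneity of the dyadic limits for arbitrary
  -- scalars comes for free.
  let A : E →+ ℝ := AddMonoidHom.mk' D hDadd
  refine ⟨A.toRealLinearMap hDcont, ?_⟩
  have hquad : ∀ h : E, ‖h‖ < ρ → |f (x + h) - f x - D h| ≤ C / 2 * ‖h‖ ^ 2 := by
    intro h hn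
    have := dist_le_of_le_geometric_of_tendsto₀ (1 / 2) (C * ‖h‖ ^ 2 / 4) (by norm_num)
      (hdist h hn) (hDlim h)
    simp only [hd, pow_zero, inv_one, one_smul, one_mul, Real.dist_eq] at this
    refine this.trans (le_of_eq ?_)
    ring
  rw [hasFDerivAt_iff_isLittleO_nhds_zero]
  have hO : (fun h => f (x + h) - f x - A.toRealLinearMap hDcont h) =O[𝓝 0]
      fun h : E => ‖h‖ ^ 2 := by
    refine Asymptotics.IsBigO.of_bound (C / 2) ?_
    filter_upwards [Metric.ball_mem_nhds (0 : E) hρ] with h hh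
    have := hquad h (by simpa using hh)
    rw [norm_pow, norm_norm]
    exact this
  exact hO.trans_isLittleO (Asymptotics.isLittleO_norm_pow_id one_lt_two)

end Differentiability

/-! ### A control problem with bounded speed and its value function -/

section Value

variable {E : Type*} [NormedAddCommGroup E] [InnerProductSpace ℝ E] [FiniteDimensional ℝ E]
  [MeasurableSpace E] [BorelSpace E]

/-- Measurable controls of speed at most `K`. -/
structure IsControl {E : Type*} [NormedAddCommGroup E] [MeasurableSpace E]
    (K : ℝ) (v : ℝ → E) : Prop where
  measurable : Measurable v
  norm_le : ∀ t, ‖v t‖ ≤ K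

/-- The trajectory with initial point `x` and velocity `v`. -/
def trajectory {E : Type*} [NormedAddCommGroup E] [NormedSpace ℝ E] (x : E) (v : ℝ → E)
    (t : ℝ) : E := x + ∫ τ in (0 : ℝ)..t, v τ

/-- The payoff of a control: terminal reward minus action. -/
def payoff {E : Type*} [NormedAddCommGroup E] [NormedSpace ℝ E] (L : E → E → ℝ) (φ : E → ℝ)
    (s : ℝ) (x : E) (v : ℝ → E) : ℝ :=
  φ (trajectory x v s) - ∫ σ in (0 : ℝ)..s, L (trajectory x v σ) (v σ)

/-- The value function for controls of speed at most `K`. -/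
def value {E : Type*} [NormedAddCommGroup E] [NormedSpace ℝ E] [MeasurableSpace E]
    (L : E → E → ℝ) (φ : E → ℝ) (K s : ℝ) (x : E) : ℝ :=
  ⨆ v : {v : ℝ → E // IsControl K v}, payoff L φ s x v

variable {L : E → E → ℝ} {φ : E → ℝ} {B : Set E} {z₀ x : E} {R K s : ℝ} {v : ℝ → E}

theorem IsControl.nonneg (hv : IsControl K v) : 0 ≤ K := (norm_nonneg _).trans (hv.norm_le 0)

theorem isControl_const {v₀ : E} (h : ‖v₀‖ ≤ K) : IsControl K fun _ : ℝ => v₀ :=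
  ⟨measurable_const, fun _ => h⟩

theorem IsControl.intervalIntegrable (hv : IsControl K v) (a b : ℝ) :
    IntervalIntegrable v volume a b := by
  refine (intervalIntegrable_const (c := K)).mono_fun hv.measurable.aestronglyMeasurable ?_
  refine Eventually.of_forall fun t => ?_
  rw [Real.norm_eq_abs]
  exact (hv.norm_le t).trans (le_abs_self _)

theorem IsControl.continuous_trajectory (hv : IsControl K v) (x : E) :
    Continuous (trajectory x v) :=
  continuous_const.add (intervalIntegral.continuous_primitive (fun a b => hv.intervalIntegrable a b) 0)

theorem IsControl.dist_trajectory_le (hv : IsControl K v) (x : E) {t : ℝ} (ht : 0 ≤ t) :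
    dist (trajectory x v t) x ≤ K * t := by
  rw [dist_eq_norm, trajectory, add_sub_cancel_left]
  have := intervalIntegral.norm_integral_le_of_norm_le_const (a := 0) (b := t) (C := K)
    (fun τ _ => hv.norm_le τ)
  simpa [abs_of_nonneg ht] using this

theorem IsControl.trajectory_mem (hv : IsControl K v) (hx : dist x z₀ + K * s ≤ R) {t : ℝ}
    (ht : t ∈ Icc 0 s) : trajectory x v t ∈ Metric.closedBall z₀ R := by
  rw [Metric.mem_closedBall]
  have h1 := hv.dist_trajectory_le x ht.1
  have h2 := dist_triangle (trajectory x v t) x z₀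
  have h3 : K * t ≤ K * s := mul_le_mul_of_nonneg_left ht.2 hv.nonneg
  linarith

theorem IsLocalLagrangian.exists_abs_le (hL : IsLocalLagrangian L B) (K : ℝ) :
    ∃ C ≥ 0, ∀ z ∈ B, ∀ v, ‖v‖ ≤ K → |L z v| ≤ C := by
  obtain ⟨C₁, hC₁, h1⟩ := hL.superlinear 0
  obtain ⟨C₂, hC₂, h2⟩ := hL.rest_le
  obtain ⟨C₃, hC₃, h3⟩ := hL.lipschitz |K|
  refine ⟨C₁ + C₂ + C₃ * |K|, by positivity, fun z hz v hv => abs_le.2 ⟨?_, ?_⟩⟩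
  · have := h1 z hz v
    have : 0 ≤ C₃ * |K| := by positivity
    linarith
  · have hv' := hv.trans (le_abs_self K)
    have a := (abs_le.1 (h3 z hz z hz v 0 hv' (by simp))).2
    have b := h2 z hz
    simp only [sub_self, norm_zero, sub_zero, zero_add] at a
    have : C₃ * ‖v‖ ≤ C₃ * |K| := by gcongr
    linarith

theorem IsLocalLagrangian.continuousOn (hL : IsLocalLagrangian L B) (K : ℝ) :
    ContinuousOn (fun w : E × E => L w.1 w.2) (B ×ˢ Metric.closedBall 0 K) := by
  obtain ⟨C, hC, h⟩ := hL.lipschitz K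
  have : LipschitzOnWith (2 * C).toNNReal (fun w : E × E => L w.1 w.2)
      (B ×ˢ Metric.closedBall 0 K) := by
    refine LipschitzOnWith.of_dist_le_mul fun w hw w' hw' => ?_
    rw [Real.dist_eq, Real.coe_toNNReal _ (by positivity)]
    refine (h w.1 hw.1 w'.1 hw'.1 w.2 w'.2 (by simpa using hw.2) (by simpa using hw'.2)).trans ?_
    have h1 : ‖w.1 - w'.1‖ ≤ dist w w' := by
      rw [← dist_eq_norm]; exact le_max_left _ _
    have h2 : ‖w.2 - w'.2‖ ≤ dist w w' := by
      rw [← dist_eq_norm]; exact le_max_right _ _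
    nlinarith
  exact this.continuousOn

/-- L is controlled only for positions in B and speeds at most K. Its extension by zero off this
closed set is a measurable function on the whole product, and the pair (ξ, v) never leaves the set.
-/
theorem IsLocalLagrangian.intervalIntegrable (hL : IsLocalLagrangian L B) (hB : IsClosed B)
    {ξ : ℝ → E} (hξ : Continuous ξ) (hmem : ∀ σ ∈ Icc 0 s, ξ σ ∈ B) (hv : IsControl K v)
    {a b : ℝ} (ha : a ∈ Icc 0 s) (hb : b ∈ Icc 0 s) :
    IntervalIntegrable (fun σ => L (ξ σ) (v σ)) volume a b := by
  obtain ⟨C, hC, hbound⟩ := hL.exists_abs_le K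
  have hS : MeasurableSet (B ×ˢ Metric.closedBall (0 : E) K) :=
    (hB.prod Metric.isClosed_closedBall).measurableSet
  have hmeas : Measurable ((B ×ˢ Metric.closedBall (0 : E) K).indicator
      fun w : E × E => L w.1 w.2) := by
    classical
    rw [← piecewise_eq_indicator]
    exact (hL.continuousOn K).measurable_piecewise continuousOn_const hS
  have hmeas2 : Measurable fun σ => (B ×ˢ Metric.closedBall (0 : E) K).indicator
      (fun w : E × E => L w.1 w.2) (ξ σ, v σ) :=
    hmeas.comp (hξ.measurable.prodMk hv.measurable)
  have hin : ∀ σ ∈ uIoc a b, (ξ σ, v σ) ∈ B ×ˢ Metric.closedBall (0 : E) K := by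
    intro σ hσ
    have : σ ∈ Icc 0 s := by
      have := uIoc_subset_uIcc hσ
      exact (uIcc_subset_Icc ha hb) this
    exact ⟨hmem σ this, by simpa using hv.norm_le σ⟩
  have hint : IntervalIntegrable (fun σ => (B ×ˢ Metric.closedBall (0 : E) K).indicator
      (fun w : E × E => L w.1 w.2) (ξ σ, v σ)) volume a b := by
    refine (intervalIntegrable_const (c := C)).mono_fun hmeas2.aestronglyMeasurable ?_
    refine Eventually.of_forall fun σ => ?_
    simp only [Real.norm_eq_abs, abs_of_nonneg hC]
    by_cases hσ : (ξ σ, v σ) ∈ B ×ˢ Metric.closedBall (0 : E) K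
    · rw [indicator_of_mem hσ]
      exact hbound _ hσ.1 _ (by simpa using hσ.2)
    · rw [indicator_of_notMem hσ]; simpa using hC
  refine hint.congr fun σ hσ => ?_
  simp only [indicator_of_mem (hin σ hσ)]

/-- The standing assumptions on the Lagrangian and the terminal reward on a closed ball. -/
structure IsLocalData {E : Type*} [NormedAddCommGroup E] [InnerProductSpace ℝ E]
    (L : E → E → ℝ) (φ : E → ℝ) (z₀ : E) (R Λ₀ Cφ : ℝ) : Prop where
  lagrangian : IsLocalLagrangian L (Metric.closedBall z₀ R)
  Λ_nonneg : 0 ≤ Λ₀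
  C_nonneg : 0 ≤ Cφ
  lipschitz : ∀ y ∈ Metric.closedBall z₀ R, ∀ y' ∈ Metric.closedBall z₀ R,
    |φ y - φ y'| ≤ Λ₀ * ‖y - y'‖
  semiconcave : ∀ y h : E, y + h ∈ Metric.closedBall z₀ R → y - h ∈ Metric.closedBall z₀ R →
    φ (y + h) + φ (y - h) - 2 * φ y ≤ Cφ * ‖h‖ ^ 2

variable {Λ₀ Cφ : ℝ}

theorem IsLocalData.integrable_action (hd : IsLocalData L φ z₀ R Λ₀ Cφ) (hv : IsControl K v)
    (hx : dist x z₀ + K * s ≤ R) {a b : ℝ} (ha : a ∈ Icc 0 s) (hb : b ∈ Icc 0 s) :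
    IntervalIntegrable (fun σ => L (trajectory x v σ) (v σ)) volume a b :=
  hd.lagrangian.intervalIntegrable Metric.isClosed_closedBall (hv.continuous_trajectory x)
    (fun _ hσ => hv.trajectory_mem hx hσ) hv ha hb

theorem IsLocalData.exists_payoff_le (hd : IsLocalData L φ z₀ R Λ₀ Cφ) (K : ℝ) :
    ∃ C ≥ 0, ∀ s ≥ 0, ∀ x, dist x z₀ + K * s ≤ R → ∀ v, IsControl K v →
      |payoff L φ s x v - φ x| ≤ C * s := by
  obtain ⟨C, hC, hb⟩ := hd.lagrangian.exists_abs_le K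
  refine ⟨Λ₀ * |K| + C, by have := hd.Λ_nonneg; positivity, fun s hs x hx v hv => ?_⟩
  have h1 := hd.lipschitz _ (hv.trajectory_mem hx (right_mem_Icc.2 hs)) x (by
    rw [Metric.mem_closedBall]; nlinarith [hv.nonneg])
  have h2 := hv.dist_trajectory_le x hs
  rw [dist_eq_norm] at h2
  have h3 : ‖∫ σ in (0 : ℝ)..s, L (trajectory x v σ) (v σ)‖ ≤ C * |s - 0| :=
    intervalIntegral.norm_integral_le_of_norm_le_const fun σ hσ => by
      rw [uIoc_of_le hs] at hσ
      exact hb _ (hv.trajectory_mem hx ⟨hσ.1.le, hσ.2⟩) _ (hv.norm_le σ)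
  rw [sub_zero, abs_of_nonneg hs, Real.norm_eq_abs] at h3
  have h4 : Λ₀ * ‖trajectory x v s - x‖ ≤ Λ₀ * (|K| * s) := by
    refine mul_le_mul_of_nonneg_left (h2.trans ?_) hd.Λ_nonneg
    gcongr; exact le_abs_self K
  rw [payoff, abs_le]
  have a1 := abs_le.1 h1
  have a3 := abs_le.1 h3
  constructor <;> nlinarith [a1.1, a1.2, a3.1, a3.2]

theorem IsLocalData.bddAbove_payoff (hd : IsLocalData L φ z₀ R Λ₀ Cφ) (hs : 0 ≤ s)
    (hx : dist x z₀ + K * s ≤ R) :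
    BddAbove (range fun v : {v : ℝ → E // IsControl K v} => payoff L φ s x v) := by
  obtain ⟨C, hC, hb⟩ := hd.exists_payoff_le K
  refine ⟨φ x + C * s, ?_⟩
  rintro _ ⟨v, rfl⟩
  linarith [(abs_le.1 (hb s hs x hx v v.2)).2]

theorem IsLocalData.payoff_le_value (hd : IsLocalData L φ z₀ R Λ₀ Cφ) (hs : 0 ≤ s)
    (hx : dist x z₀ + K * s ≤ R) (hv : IsControl K v) : payoff L φ s x v ≤ value L φ K s x :=
  le_ciSup (hd.bddAbove_payoff hs hx) ⟨v, hv⟩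

theorem value_le (hK : 0 ≤ K) {a : ℝ} (h : ∀ v, IsControl K v → payoff L φ s x v ≤ a) :
    value L φ K s x ≤ a := by
  have : Nonempty {v : ℝ → E // IsControl K v} := ⟨⟨fun _ => 0, isControl_const (by simpa)⟩⟩
  exact ciSup_le fun v => h v v.2

theorem IsLocalData.exists_abs_value_sub_le (hd : IsLocalData L φ z₀ R Λ₀ Cφ) (hK : 0 ≤ K) :
    ∃ C ≥ 0, ∀ s ≥ 0, ∀ x, dist x z₀ + K * s ≤ R → |value L φ K s x - φ x| ≤ C * s := by
  obtain ⟨C, hC, hb⟩ := hd.exists_payoff_le K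
  refine ⟨C, hC, fun s hs x hx => abs_le.2 ⟨?_, ?_⟩⟩
  · have h0 : IsControl K fun _ : ℝ => (0 : E) := isControl_const (by simpa)
    linarith [hd.payoff_le_value hs hx h0, (abs_le.1 (hb s hs x hx _ h0)).1]
  · have := value_le (L := L) (φ := φ) (s := s) (x := x) hK (a := φ x + C * s) fun v hv => by
      linarith [(abs_le.1 (hb s hs x hx v hv)).2]
    linarith

theorem value_zero (hK : 0 ≤ K) : value L φ K 0 x = φ x := by
  have : Nonempty {v : ℝ → E // IsControl K v} := ⟨⟨fun _ => 0, isControl_const (by simpa)⟩⟩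
  simp [value, payoff, trajectory]

/-- The value function is Lipschitz in the initial point. -/
theorem IsLocalData.exists_value_lipschitz (hd : IsLocalData L φ z₀ R Λ₀ Cφ) (hK : 0 ≤ K) :
    ∃ C ≥ 0, ∀ s ≥ 0, ∀ x, dist x z₀ + K * s ≤ R → ∀ x', dist x' z₀ + K * s ≤ R →
      |value L φ K s x - value L φ K s x'| ≤ (Λ₀ + C * s) * ‖x - x'‖ := by
  obtain ⟨C, hC, hl⟩ := hd.lagrangian.lipschitz K
  refine ⟨C, hC, fun s hs => ?_⟩
  have half : ∀ x, dist x z₀ + K * s ≤ R → ∀ x', dist x' z₀ + K * s ≤ R →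
      value L φ K s x - value L φ K s x' ≤ (Λ₀ + C * s) * ‖x - x'‖ := by
    intro x hx x' hx'
    rw [sub_le_iff_le_add]
    refine value_le hK fun v hv => ?_
    have h1 := hd.payoff_le_value hs hx' hv
    have hdiff : ∀ σ, trajectory x v σ - trajectory x' v σ = x - x' := fun σ => by
      simp [trajectory]
    have h2 := (abs_le.1 (hd.lipschitz _ (hv.trajectory_mem hx (right_mem_Icc.2 hs)) _
      (hv.trajectory_mem hx' (right_mem_Icc.2 hs)))).2
    rw [hdiff] at h2
    have i1 := hd.integrable_action hv hx (left_mem_Icc.2 hs) (right_mem_Icc.2 hs)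
    have i2 := hd.integrable_action hv hx' (left_mem_Icc.2 hs) (right_mem_Icc.2 hs)
    have h3 : ‖∫ σ in (0 : ℝ)..s, (L (trajectory x' v σ) (v σ) - L (trajectory x v σ) (v σ))‖
        ≤ C * ‖x - x'‖ * |s - 0| :=
      intervalIntegral.norm_integral_le_of_norm_le_const fun σ hσ => by
        rw [uIoc_of_le hs] at hσ
        have := hl _ (hv.trajectory_mem hx' ⟨hσ.1.le, hσ.2⟩) _
          (hv.trajectory_mem hx ⟨hσ.1.le, hσ.2⟩) (v σ) (v σ) (hv.norm_le σ) (hv.norm_le σ)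
        rw [norm_sub_rev, hdiff] at this
        simpa using this
    rw [intervalIntegral.integral_sub i2 i1, sub_zero, abs_of_nonneg hs, Real.norm_eq_abs] at h3
    have h4 := (abs_le.1 h3).2
    rw [payoff] at h1 ⊢
    linarith
  intro x hx x' hx'
  refine abs_le.2 ⟨?_, half x hx x' hx'⟩
  have := half x' hx' x hx
  rw [norm_sub_rev] at this
  linarith

/-- The control that first moves with constant velocity. -/
def concatControl {E : Type*} (h : ℝ) (v₀ : E) (v : ℝ → E) (t : ℝ) : E :=
  if t ≤ h then v₀ else v (t - h)

theorem IsControl.concat (hv : IsControl K v) {v₀ : E} (hv₀ : ‖v₀‖ ≤ K) (h : ℝ) :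
    IsControl K (concatControl h v₀ v) := by
  constructor
  · exact Measurable.ite measurableSet_Iic measurable_const
      (hv.measurable.comp (measurable_id.sub_const h))
  · intro t
    simp only [concatControl]
    split_ifs
    exacts [hv₀, hv.norm_le _]

theorem trajectory_concat_of_le {h t : ℝ} (ht : t ∈ Icc 0 h) (v₀ : E) (v : ℝ → E) :
    trajectory x (concatControl h v₀ v) t = x + t • v₀ := by
  have := FiniteDimensional.complete ℝ E
  rw [trajectory, intervalIntegral.integral_congr_ae (g := fun _ => v₀)]
  · simp
  · refine Eventually.of_forall fun τ hτ => ?_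
    rw [uIoc_of_le ht.1] at hτ
    exact if_pos (hτ.2.trans ht.2)

theorem trajectory_concat_add {h t : ℝ} (hh : 0 ≤ h) (ht : 0 ≤ t) {v₀ : E} (hv₀ : ‖v₀‖ ≤ K)
    (hv : IsControl K v) :
    trajectory x (concatControl h v₀ v) (t + h) = trajectory (x + h • v₀) v t := by
  have hc := hv.concat hv₀ h
  have e1 := trajectory_concat_of_le (x := x) (right_mem_Icc.2 hh) v₀ v
  rw [trajectory] at e1
  rw [trajectory, ← intervalIntegral.integral_add_adjacent_intervals (hc.intervalIntegrable 0 h)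
    (hc.intervalIntegrable h (t + h)), ← add_assoc, e1, trajectory]
  congr 1
  have e2 := intervalIntegral.integral_comp_add_right (a := 0) (b := t)
    (fun τ => concatControl h v₀ v τ) h
  rw [zero_add] at e2
  rw [← e2]
  refine intervalIntegral.integral_congr_ae (Eventually.of_forall fun τ hτ => ?_)
  rw [uIoc_of_le ht] at hτ
  simp only [concatControl]
  rw [if_neg (by linarith [hτ.1]), add_sub_cancel_right]

/-- Dynamic programming: moving first with constant velocity is not better than optimal. -/
theorem IsLocalData.value_le_add (hd : IsLocalData L φ z₀ R Λ₀ Cφ) {h : ℝ} (hh : 0 ≤ h)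
    (hhs : h ≤ s) (hx : dist x z₀ + K * s ≤ R) {v₀ : E} (hv₀ : ‖v₀‖ ≤ K) :
    value L φ K (s - h) (x + h • v₀)
      ≤ value L φ K s x + ∫ τ in (0 : ℝ)..h, L (x + τ • v₀) v₀ := by
  have hs : 0 ≤ s := hh.trans hhs
  have hK : 0 ≤ K := (norm_nonneg _).trans hv₀
  refine value_le hK fun v hv => ?_
  have hc := hv.concat hv₀ h
  have h1 := hd.payoff_le_value hs hx hc
  have hmem : h ∈ Icc 0 s := ⟨hh, hhs⟩
  have i1 := hd.integrable_action hc hx (left_mem_Icc.2 hs) hmem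
  have i2 := hd.integrable_action hc hx hmem (right_mem_Icc.2 hs)
  have hsh : 0 ≤ s - h := by linarith
  rw [payoff, ← intervalIntegral.integral_add_adjacent_intervals i1 i2] at h1
  have e0 : trajectory x (concatControl h v₀ v) s = trajectory (x + h • v₀) v (s - h) := by
    rw [← trajectory_concat_add hh hsh hv₀ hv, sub_add_cancel]
  have e1 : (∫ σ in (0 : ℝ)..h, L (trajectory x (concatControl h v₀ v) σ) (concatControl h v₀ v σ))
      = ∫ τ in (0 : ℝ)..h, L (x + τ • v₀) v₀ := by
    refine intervalIntegral.integral_congr_ae (Eventually.of_forall fun τ hτ => ?_)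
    rw [uIoc_of_le hh] at hτ
    rw [trajectory_concat_of_le ⟨hτ.1.le, hτ.2⟩, concatControl, if_pos hτ.2]
  have e2 : (∫ σ in h..s, L (trajectory x (concatControl h v₀ v) σ) (concatControl h v₀ v σ))
      = ∫ τ in (0 : ℝ)..(s - h), L (trajectory (x + h • v₀) v τ) (v τ) := by
    have := intervalIntegral.integral_comp_add_right (a := 0) (b := s - h)
      (fun σ => L (trajectory x (concatControl h v₀ v) σ) (concatControl h v₀ v σ)) h
    rw [zero_add, sub_add_cancel] at this
    rw [← this]
    refine intervalIntegral.integral_congr_ae (Eventually.of_forall fun τ hτ => ?_)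
    rw [uIoc_of_le hsh] at hτ
    rw [trajectory_concat_add hh hτ.1.le hv₀ hv]
    simp only [concatControl]
    rw [if_neg (by linarith [hτ.1]), add_sub_cancel_right]
  rw [e0, e1, e2] at h1
  rw [payoff]
  linarith

/-- The value function increases at most linearly in time. -/
theorem IsLocalData.exists_value_add_le (hd : IsLocalData L φ z₀ R Λ₀ Cφ) (hK : 0 ≤ K) :
    ∃ C ≥ 0, ∀ s ≥ 0, ∀ h ≥ 0, ∀ x, dist x z₀ + K * (s + h) ≤ R →
      value L φ K (s + h) x ≤ value L φ K s x + C * h := by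
  obtain ⟨C, hC, hb⟩ := hd.lagrangian.exists_abs_le K
  refine ⟨Λ₀ * K + C, by have := hd.Λ_nonneg; positivity, fun s hs h hh x hx => ?_⟩
  -- The same control, stopped at time s, is a competitor: what is lost is the action and the change
  -- of the reward over the last time h.
  refine value_le hK fun v hv => ?_
  have hxs : dist x z₀ + K * s ≤ R := by nlinarith
  have h1 := hd.payoff_le_value hs hxs hv
  have hsh : 0 ≤ s + h := by positivity
  have hmem : s ∈ Icc 0 (s + h) := ⟨hs, by linarith⟩
  have i1 := hd.integrable_action hv hx (left_mem_Icc.2 hsh) hmem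
  have i2 := hd.integrable_action hv hx hmem (right_mem_Icc.2 hsh)
  have h2 := (abs_le.1 (hd.lipschitz _ (hv.trajectory_mem hx (right_mem_Icc.2 hsh)) _
      (hv.trajectory_mem hx hmem))).2
  have h3 : ‖∫ σ in s..(s + h), L (trajectory x v σ) (v σ)‖ ≤ C * |s + h - s| :=
    intervalIntegral.norm_integral_le_of_norm_le_const fun σ hσ => by
      rw [uIoc_of_le hmem.2] at hσ
      exact hb _ (hv.trajectory_mem hx ⟨hs.trans hσ.1.le, hσ.2⟩) _ (hv.norm_le σ)
  have h4 : ‖trajectory x v (s + h) - trajectory x v s‖ ≤ K * h := by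
    have e : trajectory x v (s + h) - trajectory x v s = ∫ σ in s..(s + h), v σ := by
      rw [trajectory, trajectory, add_sub_add_left_eq_sub,
        intervalIntegral.integral_interval_sub_left (hv.intervalIntegrable _ _)
          (hv.intervalIntegrable _ _)]
    rw [e]
    have := intervalIntegral.norm_integral_le_of_norm_le_const (a := s) (b := s + h) (C := K)
      (fun τ _ => hv.norm_le τ)
    simpa [abs_of_nonneg hh] using this
  rw [add_sub_cancel_left, abs_of_nonneg hh, Real.norm_eq_abs] at h3
  have h5 := mul_le_mul_of_nonneg_left h4 hd.Λ_nonneg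
  have h6 := (abs_le.1 h3).1
  rw [payoff] at h1 ⊢
  rw [← intervalIntegral.integral_add_adjacent_intervals i1 i2]
  linarith

end Value

/-! ### Integral estimates for absolutely continuous curves -/

section AbsolutelyContinuous

/-- A function whose increments are controlled by those of an absolutely continuous function is
absolutely continuous. -/
theorem AbsolutelyContinuousOnInterval.of_dist_le {X Y : Type*} [PseudoMetricSpace X]
    [PseudoMetricSpace Y] {f : ℝ → X} {g : ℝ → Y} {a b A C : ℝ}
    (hf : AbsolutelyContinuousOnInterval f a b)
    (h : ∀ x ∈ uIcc a b, ∀ y ∈ uIcc a b,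
      dist (g x) (g y) ≤ A * dist (f x) (f y) + C * dist x y) :
    AbsolutelyContinuousOnInterval g a b := by
  have hid : AbsolutelyContinuousOnInterval (fun x : ℝ => x) a b :=
    (LipschitzWith.id.lipschitzOnWith (s := uIcc a b)).absolutelyContinuousOnInterval
  have hlim := (Tendsto.const_mul A hf).add (Tendsto.const_mul C hid)
  rw [mul_zero, mul_zero, add_zero] at hlim
  refine squeeze_zero' (Eventually.of_forall fun I => Finset.sum_nonneg fun _ _ => dist_nonneg)
    ?_ hlim
  have hmem : AbsolutelyContinuousOnInterval.disjWithin a b ∈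
      AbsolutelyContinuousOnInterval.totalLengthFilter ⊓
        𝓟 (AbsolutelyContinuousOnInterval.disjWithin a b) := mem_inf_of_right (mem_principal_self _)
  filter_upwards [hmem] with I hI
  rw [Finset.mul_sum, Finset.mul_sum, ← Finset.sum_add_distrib]
  exact Finset.sum_le_sum fun i hi => h _ (hI.1 i hi).1 _ (hI.1 i hi).2

/-- A bound on the derivative of an absolutely continuous function bounds its increment. -/
theorem AbsolutelyContinuousOnInterval.sub_le_integral {g ℓ : ℝ → ℝ} {s : ℝ} (hs : 0 ≤ s)
    (hg : AbsolutelyContinuousOnInterval g 0 s) (hℓ : IntervalIntegrable ℓ volume 0 s)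
    (h : ∀ᵐ σ : ℝ, σ ∈ Ioo 0 s → ∀ g', HasDerivAt g g' σ → g' ≤ ℓ σ) :
    g s - g 0 ≤ ∫ σ in (0 : ℝ)..s, ℓ σ := by
  rw [← hg.integral_deriv_eq_sub]
  refine intervalIntegral.integral_mono_ae_restrict hs hg.intervalIntegrable_deriv hℓ ?_
  rw [EventuallyLE, Measure.restrict_congr_set Ioo_ae_eq_Icc.symm,
    ae_restrict_iff' measurableSet_Ioo]
  filter_upwards [h, hg.ae_differentiableAt] with σ h1 h2 hσ
  exact h1 hσ _ (h2 (by rw [uIcc_of_le hs]; exact Ioo_subset_Icc_self hσ)).hasDerivAt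

/-- Pairing ξ with a norming functional q of its total displacement reduces this to the scalar
function Λ q(ξ(σ)) - Cσ. It serves to show that a long excursion in a short time has a large action.
-/
theorem AbsolutelyContinuousOnInterval.mul_norm_sub_le_integral {E : Type*}
    [NormedAddCommGroup E] [NormedSpace ℝ E] {ξ : ℝ → E} {ℓ : ℝ → ℝ}
    {s Λ C : ℝ} (hs : 0 ≤ s) (hΛ : 0 ≤ Λ) (hξ : AbsolutelyContinuousOnInterval ξ 0 s)
    (hℓ : IntervalIntegrable ℓ volume 0 s)
    (h : ∀ᵐ σ : ℝ, σ ∈ Ioo 0 s → ∃ v, HasDerivAt ξ v σ ∧ Λ * ‖v‖ - C ≤ ℓ σ) :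
    Λ * ‖ξ s - ξ 0‖ - C * s ≤ ∫ σ in (0 : ℝ)..s, ℓ σ := by
  obtain ⟨q, hq, hqe⟩ := exists_dual_vector'' ℝ (ξ s - ξ 0)
  have hg : AbsolutelyContinuousOnInterval (fun σ => Λ * q (ξ σ) - C * σ) 0 s := by
    refine AbsolutelyContinuousOnInterval.of_dist_le (A := Λ) (C := |C|) hξ fun x _ y _ => ?_
    have e : Λ * q (ξ x) - C * x - (Λ * q (ξ y) - C * y) = Λ * q (ξ x - ξ y) - C * (x - y) := by
      rw [map_sub]; ring
    rw [Real.dist_eq, e, Real.dist_eq, dist_eq_norm]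
    refine (abs_sub _ _).trans ?_
    rw [abs_mul, abs_mul, abs_of_nonneg hΛ]
    gcongr
    refine (q.le_opNorm _).trans (mul_le_of_le_one_left (norm_nonneg _) hq)
  have := AbsolutelyContinuousOnInterval.sub_le_integral hs hg hℓ (by
    filter_upwards [h] with σ hσ hmem g' hg'
    obtain ⟨v, hv, hle⟩ := hσ hmem
    have hd : HasDerivAt (fun σ => Λ * q (ξ σ) - C * σ) (Λ * q v - C * 1) σ :=
      ((q.hasFDerivAt.comp_hasDerivAt σ hv).const_mul Λ).sub ((hasDerivAt_id σ).const_mul C)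
    rw [hg'.unique hd]
    have h1 : q v ≤ ‖v‖ := (le_abs_self _).trans
      ((q.le_opNorm _).trans (mul_le_of_le_one_left (norm_nonneg _) hq))
    have h2 := mul_le_mul_of_nonneg_left h1 hΛ
    linarith)
  rw [map_sub] at hqe
  simp only [RCLike.ofReal_real_eq_id, id_eq] at hqe
  rw [← hqe]
  linarith

end AbsolutelyContinuous

/-! ### Verification: arbitrary curves against the value function -/

section Verification

variable {E : Type*} [NormedAddCommGroup E] [InnerProductSpace ℝ E] [FiniteDimensional ℝ E]
  [MeasurableSpace E] [BorelSpace E]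
  {L : E → E → ℝ} {φ : E → ℝ} {z₀ x : E} {R K s Λ₀ Cφ : ℝ} {v : ℝ → E}

/-- Verification: no absolutely continuous curve does better than the value function, provided
that high speeds are sufficiently expensive. -/
theorem IsLocalData.le_value_of_absolutelyContinuous (hd : IsLocalData L φ z₀ R Λ₀ Cφ)
    (hK : 0 ≤ K) (hs : 0 ≤ s) {ρ Λ C₀ : ℝ} (hρ : ρ + K * s ≤ R)
    (hΛ : ∀ σ ∈ Icc 0 s, ∀ x, dist x z₀ + K * σ ≤ R → ∀ x', dist x' z₀ + K * σ ≤ R →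
      |value L φ K σ x - value L φ K σ x'| ≤ Λ * ‖x - x'‖)
    (hC₀ : ∀ z ∈ Metric.closedBall z₀ R, L z 0 ≤ C₀)
    (hbig : ∀ z ∈ Metric.closedBall z₀ R, ∀ v, K < ‖v‖ → Λ * ‖v‖ + C₀ ≤ L z v)
    {ξ : ℝ → E} (hξ : AbsolutelyContinuousOnInterval ξ 0 s)
    (hmem : ∀ σ ∈ Icc 0 s, ξ σ ∈ Metric.closedBall z₀ ρ)
    {ℓ : ℝ → ℝ} (hℓ : IntervalIntegrable ℓ volume 0 s)
    (hae : ∀ᵐ σ : ℝ, σ ∈ Ioo 0 s → ∃ v, HasDerivAt ξ v σ ∧ L (ξ σ) v ≤ ℓ σ) :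
    φ (ξ s) - ∫ σ in (0 : ℝ)..s, ℓ σ ≤ value L φ K s (ξ 0) := by
  obtain ⟨C₁, hC₁, hup⟩ := hd.exists_value_add_le hK
  obtain ⟨C₂, hC₂, hlip⟩ := hd.lagrangian.lipschitz K
  have adm : ∀ σ ∈ Icc 0 s, ∀ τ ≤ s, dist (ξ σ) z₀ + K * τ ≤ R := by
    intro σ hσ τ hτ
    have h1 := hmem σ hσ
    rw [Metric.mem_closedBall] at h1
    have : K * τ ≤ K * s := mul_le_mul_of_nonneg_left hτ hK
    linarith
  have hdown : ∀ y τ h, 0 ≤ h → h ≤ τ → dist y z₀ + K * τ ≤ R →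
      value L φ K (τ - h) y ≤ value L φ K τ y + C₀ * h := by
    intro y τ h hh hhτ hy
    have h1 := hd.value_le_add hh hhτ hy (v₀ := 0) (by simpa using hK)
    have hyB : y ∈ Metric.closedBall z₀ R := by
      rw [Metric.mem_closedBall]; nlinarith
    simp only [smul_zero, add_zero, intervalIntegral.integral_const, sub_zero, smul_eq_mul] at h1
    have := mul_le_mul_of_nonneg_left (hC₀ y hyB) hh
    linarith
  -- The value of the remaining problem along the curve: g(0) is the value at the initial point and
  -- g(s) = φ(ξ(s)). It is absolutely continuous, so it suffices that g' ≤ ℓ almost everywhere.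
  set g : ℝ → ℝ := fun σ => value L φ K (s - σ) (ξ σ) with hg
  have hgbound : ∀ σ ∈ Icc 0 s, ∀ σ' ∈ Icc 0 s, σ ≤ σ' →
      |g σ - g σ'| ≤ Λ * ‖ξ σ - ξ σ'‖ + (C₁ + |C₀|) * (σ' - σ) := by
    intro σ hσ σ' hσ' hle
    have h1 := abs_le.1 (hΛ (s - σ') ⟨by linarith [hσ'.2], by linarith [hσ'.1]⟩ (ξ σ)
      (adm σ hσ _ (by linarith [hσ'.1])) (ξ σ') (adm σ' hσ' _ (by linarith [hσ'.1])))
    have h2 := hup (s - σ') (by linarith [hσ'.2]) (σ' - σ) (by linarith) (ξ σ)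
      (adm σ hσ _ (by linarith [hσ.1]))
    have h3 := hdown (ξ σ) (s - σ) (σ' - σ) (by linarith) (by linarith [hσ'.2])
      (adm σ hσ _ (by linarith [hσ.1]))
    have e1 : s - σ' + (σ' - σ) = s - σ := by ring
    have e2 : s - σ - (σ' - σ) = s - σ' := by ring
    rw [e1] at h2
    rw [e2] at h3
    have h4 : C₀ * (σ' - σ) ≤ |C₀| * (σ' - σ) :=
      mul_le_mul_of_nonneg_right (le_abs_self _) (by linarith)
    have h5 : 0 ≤ |C₀| * (σ' - σ) := mul_nonneg (abs_nonneg _) (by linarith)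
    have h6 : 0 ≤ C₁ * (σ' - σ) := mul_nonneg hC₁ (by linarith)
    rw [abs_le]
    simp only [hg]
    constructor <;> linarith [h1.1, h1.2]
  have hgac : AbsolutelyContinuousOnInterval g 0 s := by
    refine AbsolutelyContinuousOnInterval.of_dist_le (A := Λ) (C := C₁ + |C₀|) hξ
      fun σ hσ σ' hσ' => ?_
    rw [uIcc_of_le hs] at hσ hσ'
    rw [Real.dist_eq, dist_eq_norm, Real.dist_eq]
    rcases le_total σ σ' with hle | hle
    · rw [abs_sub_comm σ σ', abs_of_nonneg (sub_nonneg.2 hle)]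
      exact hgbound σ hσ σ' hσ' hle
    · rw [abs_sub_comm (g σ), norm_sub_rev, abs_of_nonneg (sub_nonneg.2 hle)]
      exact hgbound σ' hσ' σ hσ hle
  have hmain := AbsolutelyContinuousOnInterval.sub_le_integral hs hgac hℓ (by
    filter_upwards [hae] with σ hσae hσ g' hg'
    obtain ⟨v, hv, hle⟩ := hσae hσ
    refine le_trans ?_ hle
    have hσI := Ioo_subset_Icc_self hσ
    have slope_g : Tendsto (fun h : ℝ => h⁻¹ • (g (σ + h) - g σ)) (𝓝[>] 0) (𝓝 g') :=
      (hasDerivAt_iff_tendsto_slope_zero.1 hg').mono_left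
        (nhdsWithin_mono _ fun h hh => ne_of_gt hh)
    have slope_ξ : Tendsto (fun h : ℝ => h⁻¹ • (ξ (σ + h) - ξ σ)) (𝓝[>] 0) (𝓝 v) :=
      (hasDerivAt_iff_tendsto_slope_zero.1 hv).mono_left
        (nhdsWithin_mono _ fun h hh => ne_of_gt hh)
    have hpos : ∀ᶠ h : ℝ in 𝓝[>] 0, 0 < h ∧ h < s - σ := by
      filter_upwards [Ioo_mem_nhdsGT (sub_pos.2 hσ.2)] with h hh using hh
    -- For an admissible velocity, dynamic programming with constant velocity v bounds the increment
    -- of g by the action of a straight segment. Replacing the endpoint ξ(σ) + hv by ξ(σ + h) costs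
    -- Λ·o(h).
    by_cases hvK : ‖v‖ ≤ K
    · have hlim : Tendsto (fun h : ℝ => L (ξ σ) v + C₂ * ‖v‖ * h
          + Λ * ‖h⁻¹ • (ξ (σ + h) - ξ σ) - v‖) (𝓝[>] 0) (𝓝 (L (ξ σ) v + C₂ * ‖v‖ * 0
          + Λ * ‖v - v‖)) :=
        ((tendsto_const_nhds.add ((tendsto_id.mono_left nhdsWithin_le_nhds).const_mul _))).add
          ((slope_ξ.sub_const v).norm.const_mul Λ)
      rw [mul_zero, add_zero, sub_self, norm_zero, mul_zero, add_zero] at hlim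
      refine le_of_tendsto_of_tendsto slope_g hlim ?_
      filter_upwards [hpos] with h hh
      have hσh : σ + h ∈ Icc 0 s := ⟨by linarith [hσ.1, hh.1], by linarith [hh.2]⟩
      have a1 := hd.value_le_add (s := s - σ) (h := h) hh.1.le hh.2.le
        (adm σ hσI _ (by linarith [hσ.1])) hvK
      have admv : dist (ξ σ + h • v) z₀ + K * (s - σ - h) ≤ R := by
        have b1 := hmem σ hσI
        rw [Metric.mem_closedBall] at b1
        have b2 := dist_triangle (ξ σ + h • v) (ξ σ) z₀
        rw [dist_self_add_left, norm_smul, Real.norm_eq_abs, abs_of_pos hh.1] at b2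
        have b3 : h * ‖v‖ ≤ h * K := mul_le_mul_of_nonneg_left hvK hh.1.le
        nlinarith [mul_nonneg hK hσ.1.le]
      have a2 := (abs_le.1 (hΛ (s - σ - h) ⟨by linarith [hh.2], by linarith [hσ.1, hh.1]⟩
        (ξ (σ + h)) (adm _ hσh _ (by linarith [hσ.1, hh.1])) (ξ σ + h • v) admv)).2
      have hBseg : ∀ τ ∈ Icc 0 h, ξ σ + τ • v ∈ Metric.closedBall z₀ R := by
        intro τ hτ
        have b1 := hmem σ hσI
        rw [Metric.mem_closedBall] at b1 ⊢
        have b2 := dist_triangle (ξ σ + τ • v) (ξ σ) z₀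
        rw [dist_self_add_left, norm_smul, Real.norm_eq_abs, abs_of_nonneg hτ.1] at b2
        have b3 : τ * ‖v‖ ≤ s * K :=
          mul_le_mul (by linarith [hτ.2, hh.2, hσ.1]) hvK (norm_nonneg _) hs
        linarith
      have hσB : ξ σ ∈ Metric.closedBall z₀ R := by
        simpa using hBseg 0 ⟨le_rfl, hh.1.le⟩
      have a3 : (∫ τ in (0 : ℝ)..h, L (ξ σ + τ • v) v) - h * L (ξ σ) v ≤ C₂ * ‖v‖ * h * h := by
        have i1 : IntervalIntegrable (fun τ => L (ξ σ + τ • v) v) volume 0 h :=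
          hd.lagrangian.intervalIntegrable Metric.isClosed_closedBall
            (ξ := fun τ => ξ σ + τ • v) (s := h) (by fun_prop) hBseg (isControl_const hvK)
            (left_mem_Icc.2 hh.1.le) (right_mem_Icc.2 hh.1.le)
        have e : (∫ τ in (0 : ℝ)..h, L (ξ σ + τ • v) v) - h * L (ξ σ) v
            = ∫ τ in (0 : ℝ)..h, (L (ξ σ + τ • v) v - L (ξ σ) v) := by
          rw [intervalIntegral.integral_sub i1 intervalIntegrable_const]; simp
        have b : ‖∫ τ in (0 : ℝ)..h, (L (ξ σ + τ • v) v - L (ξ σ) v)‖ ≤ C₂ * ‖v‖ * h * |h - 0| :=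
          intervalIntegral.norm_integral_le_of_norm_le_const fun τ hτ => by
            rw [uIoc_of_le hh.1.le] at hτ
            have := hlip _ (hBseg τ ⟨hτ.1.le, hτ.2⟩) _ hσB v v hvK hvK
            rw [add_sub_cancel_left, sub_self, norm_zero, add_zero, norm_smul, Real.norm_eq_abs,
              abs_of_pos hτ.1] at this
            refine this.trans ?_
            have : τ * ‖v‖ ≤ h * ‖v‖ := mul_le_mul_of_nonneg_right hτ.2 (norm_nonneg _)
            nlinarith
        rw [sub_zero, abs_of_pos hh.1] at b
        rw [e]
        exact (le_abs_self _).trans b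
      have a4 : ‖ξ (σ + h) - (ξ σ + h • v)‖ = h * ‖h⁻¹ • (ξ (σ + h) - ξ σ) - v‖ := by
        have : ξ (σ + h) - (ξ σ + h • v) = h • (h⁻¹ • (ξ (σ + h) - ξ σ) - v) := by
          rw [smul_sub, smul_inv_smul₀ hh.1.ne']; abel
        rw [this, norm_smul, Real.norm_eq_abs, abs_of_pos hh.1]
      rw [a4] at a2
      have e3 : s - σ - h = s - (σ + h) := by ring
      rw [e3] at a1 a2
      rw [smul_eq_mul, inv_mul_le_iff₀ hh.1]
      simp only [hg]
      nlinarith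
    -- An inadmissible velocity is compared with resting: the value changes at rate at most C₀ in
    -- time and Λ‖v‖ in space, and at such speeds L exceeds the sum.
    · have hvK' : K < ‖v‖ := not_le.1 hvK
      have hσB : ξ σ ∈ Metric.closedBall z₀ R := by
        have b1 := hmem σ hσI
        rw [Metric.mem_closedBall] at b1 ⊢
        nlinarith
      refine le_trans ?_ (hbig _ hσB v hvK')
      have hlim : Tendsto (fun h : ℝ => Λ * ‖h⁻¹ • (ξ (σ + h) - ξ σ)‖ + C₀) (𝓝[>] 0)
          (𝓝 (Λ * ‖v‖ + C₀)) := (slope_ξ.norm.const_mul Λ).add_const C₀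
      refine le_of_tendsto_of_tendsto slope_g hlim ?_
      filter_upwards [hpos] with h hh
      have hσh : σ + h ∈ Icc 0 s := ⟨by linarith [hσ.1, hh.1], by linarith [hh.2]⟩
      have a1 := hdown (ξ σ) (s - σ) h hh.1.le hh.2.le (adm σ hσI _ (by linarith [hσ.1]))
      have a2 := (abs_le.1 (hΛ (s - σ - h) ⟨by linarith [hh.2], by linarith [hσ.1, hh.1]⟩
        (ξ (σ + h)) (adm _ hσh _ (by linarith [hσ.1, hh.1])) (ξ σ)
        (adm _ hσI _ (by linarith [hσ.1, hh.1])))).2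
      have a4 : ‖ξ (σ + h) - ξ σ‖ = h * ‖h⁻¹ • (ξ (σ + h) - ξ σ)‖ := by
        rw [norm_smul, norm_inv, Real.norm_eq_abs, abs_of_pos hh.1]
        field_simp [hh.1.ne']
      rw [a4] at a2
      have e3 : s - σ - h = s - (σ + h) := by ring
      rw [e3] at a1 a2
      rw [smul_eq_mul, inv_mul_le_iff₀ hh.1]
      simp only [hg]
      nlinarith)
  simp only [hg, sub_self, sub_zero, value_zero hK] at hmain
  linarith

end Verification

/-! ### Short-time semiconcavity and differentiability of the value function -/

section Regularity

variable {E : Type*} [NormedAddCommGroup E] [InnerProductSpace ℝ E] [FiniteDimensional ℝ E]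
  [MeasurableSpace E] [BorelSpace E]
  {L : E → E → ℝ} {φ : E → ℝ} {z₀ x : E} {R K s Λ₀ Cφ : ℝ} {v : ℝ → E}

theorem IsControl.intervalIntegrable_norm_sq (hv : IsControl K v) (a b : ℝ) :
    IntervalIntegrable (fun t => ‖v t‖ ^ 2) volume a b := by
  refine (intervalIntegrable_const (c := K ^ 2)).mono_fun
    (hv.measurable.norm.pow_const 2).aestronglyMeasurable ?_
  refine Eventually.of_forall fun t => ?_
  simp only [norm_pow, Real.norm_eq_abs, sq_abs]
  exact pow_le_pow_left₀ (norm_nonneg _) (hv.norm_le t) 2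

/-- The Cauchy-Schwarz inequality for the displacement. -/
theorem IsControl.norm_integral_sq_le (hv : IsControl K v) {t : ℝ} (ht : t ∈ Icc 0 s) :
    ‖∫ τ in (0 : ℝ)..t, v τ‖ ^ 2 ≤ s * ∫ τ in (0 : ℝ)..s, ‖v τ‖ ^ 2 := by
  have hs : 0 ≤ s := ht.1.trans ht.2
  have i1 := (hv.intervalIntegrable 0 s).norm
  have i2 := hv.intervalIntegrable_norm_sq 0 s
  set A := ∫ τ in (0 : ℝ)..s, ‖v τ‖ with hA
  have hle : ‖∫ τ in (0 : ℝ)..t, v τ‖ ≤ A := by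
    refine (intervalIntegral.norm_integral_le_integral_norm ht.1).trans ?_
    exact intervalIntegral.integral_mono_interval le_rfl ht.1 ht.2
      (Eventually.of_forall fun τ => norm_nonneg _) i1
  have hA0 : 0 ≤ A := (norm_nonneg _).trans hle
  rcases hs.eq_or_lt with rfl | hs'
  · have : t = 0 := le_antisymm ht.2 ht.1
    simp [this]
  have h0 : 0 ≤ ∫ τ in (0 : ℝ)..s, (‖v τ‖ - A / s) ^ 2 :=
    intervalIntegral.integral_nonneg hs fun τ _ => sq_nonneg _
  have e : (∫ τ in (0 : ℝ)..s, (‖v τ‖ - A / s) ^ 2)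
      = (∫ τ in (0 : ℝ)..s, ‖v τ‖ ^ 2) - A ^ 2 / s := by
    have e1 : (fun τ => (‖v τ‖ - A / s) ^ 2)
        = fun τ => ‖v τ‖ ^ 2 - (2 * A / s) * ‖v τ‖ + (A / s) ^ 2 := by ext τ; ring
    rw [e1, intervalIntegral.integral_add (i2.sub (i1.const_mul _)) intervalIntegrable_const,
      intervalIntegral.integral_sub i2 (i1.const_mul _), intervalIntegral.integral_const_mul, ← hA]
    simp only [intervalIntegral.integral_const, sub_zero, smul_eq_mul]
    field_simp; ring
  rw [e, sub_nonneg, div_le_iff₀ hs'] at h0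
  calc ‖∫ τ in (0 : ℝ)..t, v τ‖ ^ 2 ≤ A ^ 2 := by gcongr
    _ ≤ s * ∫ τ in (0 : ℝ)..s, ‖v τ‖ ^ 2 := by linarith

theorem trajectory_combination {y h : E} {a b c d : ℝ} {v w : ℝ → E}
    (hv : IsControl K v) (hw : IsControl K w) (t : ℝ) :
    trajectory (a • y + b • h) (fun τ => c • v τ + d • w τ) t
      = a • y + b • h + (c • (∫ τ in (0 : ℝ)..t, v τ) + d • ∫ τ in (0 : ℝ)..t, w τ) := by
  have hi := intervalIntegral.integral_add (f := fun τ => c • v τ) (g := fun τ => d • w τ)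
    ((hv.intervalIntegrable 0 t).smul c) ((hw.intervalIntegrable 0 t).smul d)
  rw [trajectory, hi, intervalIntegral.integral_smul, intervalIntegral.integral_smul]

/-- For short times the value function is semiconcave, with a constant that does not depend on the
time. -/
theorem IsLocalData.exists_value_second_difference_le (hd : IsLocalData L φ z₀ R Λ₀ Cφ)
    (hK : 0 ≤ K) :
    ∃ s₀ > 0, ∃ C ≥ 0, ∀ s ∈ Icc 0 s₀, ∀ y h : E, dist (y + h) z₀ + K * s ≤ R →
      dist (y - h) z₀ + K * s ≤ R →
      value L φ K s (y + h) + value L φ K s (y - h) - 2 * value L φ K s y ≤ C * ‖h‖ ^ 2 := by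
  obtain ⟨θ, hθ, C, hC, hlow⟩ := hd.lagrangian.le_second_difference K
  have hCφ := hd.C_nonneg
  -- With J = ∫‖k‖², where k is half the difference of the two controls, the sum of the two payoffs
  -- exceeds twice the value by at most a multiple of ‖h‖² plus 2(Cφ + C)sJ - θJ, once s ≤ 1. The
  -- second bound on s makes the J-terms nonpositive, so the remaining constant does not involve s.
  refine ⟨min 1 (θ / (2 * (Cφ + C) + 1)), by positivity, 2 * (Cφ + C), by positivity, ?_⟩
  intro s hs y h hp hm
  have hs1 : s ≤ 1 := hs.2.trans (min_le_left _ _)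
  have hsθ : 2 * (Cφ + C) * s ≤ θ := by
    have := hs.2.trans (min_le_right _ _)
    rw [le_div_iff₀ (by positivity)] at this
    nlinarith [hs.1]
  have hy : dist y z₀ + K * s ≤ R := by
    have e : y - z₀ = (1 / 2 : ℝ) • ((y + h) - z₀) + (1 / 2 : ℝ) • ((y - h) - z₀) := by module
    rw [dist_eq_norm] at hp hm ⊢
    rw [e]
    refine (add_le_add_left (norm_add_le _ _) _).trans ?_
    rw [norm_smul, norm_smul]
    norm_num
    linarith
  have key : ∀ v, IsControl K v → ∀ w, IsControl K w →
      payoff L φ s (y + h) v + payoff L φ s (y - h) w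
        ≤ 2 * value L φ K s y + 2 * (Cφ + C) * ‖h‖ ^ 2 := by
    intro v hv w hw
    -- The mean u of the controls is tried from the midpoint y. The two trajectories are then
    -- symmetric about that of u, at displacement ± η with η(0) = h and velocity k.
    set u : ℝ → E := fun τ => (1 / 2 : ℝ) • v τ + (1 / 2 : ℝ) • w τ with hu
    set k : ℝ → E := fun τ => (1 / 2 : ℝ) • v τ + (-(1 / 2) : ℝ) • w τ with hk
    have huc : IsControl K u := by
      refine ⟨(hv.measurable.const_smul _).add (hw.measurable.const_smul _), fun t => ?_⟩
      have := (convex_closedBall (0 : E) K) (by simpa using hv.norm_le t)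
        (by simpa using hw.norm_le t) (by norm_num : (0 : ℝ) ≤ 1 / 2)
        (by norm_num : (0 : ℝ) ≤ 1 / 2) (by norm_num)
      simpa [hu] using this
    have hkc : IsControl K k := by
      refine ⟨(hv.measurable.const_smul _).add (hw.measurable.const_smul _), fun t => ?_⟩
      have := (convex_closedBall (0 : E) K) (by simpa using hv.norm_le t)
        (y := - w t) (by simpa using hw.norm_le t) (by norm_num : (0 : ℝ) ≤ 1 / 2)
        (by norm_num : (0 : ℝ) ≤ 1 / 2) (by norm_num)
      simpa [hk] using this
    set η : ℝ → E := trajectory h k with hη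
    have hηt : ∀ t, η t = h + ((1 / 2 : ℝ) • (∫ τ in (0 : ℝ)..t, v τ)
        + (-(1 / 2) : ℝ) • ∫ τ in (0 : ℝ)..t, w τ) := fun t => by
      have := trajectory_combination (y := h) (h := 0) (a := 1) (b := 0) (c := 1 / 2)
        (d := -(1 / 2)) hv hw t
      simpa [hη, hk] using this
    have hut : ∀ t, trajectory y u t = y + ((1 / 2 : ℝ) • (∫ τ in (0 : ℝ)..t, v τ)
        + (1 / 2 : ℝ) • ∫ τ in (0 : ℝ)..t, w τ) := fun t => by
      have := trajectory_combination (y := y) (h := 0) (a := 1) (b := 0) (c := 1 / 2)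
        (d := 1 / 2) hv hw t
      simpa [hu] using this
    have tv : ∀ t, trajectory (y + h) v t = trajectory y u t + η t := fun t => by
      rw [hut, hηt, trajectory]; module
    have tw : ∀ t, trajectory (y - h) w t = trajectory y u t - η t := fun t => by
      rw [hut, hηt, trajectory]; module
    have ev : ∀ t, v t = u t + k t := fun t => by simp only [hu, hk]; module
    have ew : ∀ t, w t = u t - k t := fun t => by simp only [hu, hk]; module
    set J := ∫ τ in (0 : ℝ)..s, ‖k τ‖ ^ 2 with hJ
    have hJ0 : 0 ≤ J := intervalIntegral.integral_nonneg hs.1 fun τ _ => sq_nonneg _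
    have hηb : ∀ t ∈ Icc 0 s, ‖η t‖ ^ 2 ≤ 2 * ‖h‖ ^ 2 + 2 * (s * J) := by
      intro t ht
      have h1 := hkc.norm_integral_sq_le ht
      have h2 : ‖η t‖ ≤ ‖h‖ + ‖∫ τ in (0 : ℝ)..t, k τ‖ := norm_add_le _ _
      have h3 : ‖η t‖ ^ 2 ≤ (‖h‖ + ‖∫ τ in (0 : ℝ)..t, k τ‖) ^ 2 := by gcongr
      nlinarith [sq_nonneg (‖h‖ - ‖∫ τ in (0 : ℝ)..t, k τ‖)]
    have l0 := left_mem_Icc.2 hs.1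
    have l1 := right_mem_Icc.2 hs.1
    have f1 := hd.semiconcave (trajectory y u s) (η s)
      (by rw [← tv]; exact hv.trajectory_mem hp l1) (by rw [← tw]; exact hw.trajectory_mem hm l1)
    rw [← tv, ← tw] at f1
    have f2 := mul_le_mul_of_nonneg_left (hηb s l1) hCφ
    have iv := hd.integrable_action hv hp l0 l1
    have iw := hd.integrable_action hw hm l0 l1
    have iu := hd.integrable_action huc hy l0 l1
    have ik := (hkc.intervalIntegrable_norm_sq 0 s).const_mul θ
    have f3 : θ * J - s * (C * (2 * ‖h‖ ^ 2 + 2 * (s * J)))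
        ≤ (∫ σ in (0 : ℝ)..s, L (trajectory (y + h) v σ) (v σ))
        + (∫ σ in (0 : ℝ)..s, L (trajectory (y - h) w σ) (w σ))
        - 2 * ∫ σ in (0 : ℝ)..s, L (trajectory y u σ) (u σ) := by
      rw [← intervalIntegral.integral_const_mul (2 : ℝ), ← intervalIntegral.integral_add iv iw,
        ← intervalIntegral.integral_sub (iv.add iw) (iu.const_mul 2)]
      have e : θ * J - s * (C * (2 * ‖h‖ ^ 2 + 2 * (s * J)))
          = ∫ τ in (0 : ℝ)..s, (θ * ‖k τ‖ ^ 2 - C * (2 * ‖h‖ ^ 2 + 2 * (s * J))) := by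
        rw [intervalIntegral.integral_sub ik intervalIntegrable_const,
          intervalIntegral.integral_const_mul, intervalIntegral.integral_const, sub_zero,
          smul_eq_mul]
      rw [e]
      refine intervalIntegral.integral_mono_on hs.1 (ik.sub intervalIntegrable_const)
        ((iv.add iw).sub (iu.const_mul 2)) fun σ hσ => ?_
      have g1 := hlow (trajectory y u σ) (η σ) (u σ) (k σ)
        (by rw [← tv]; exact hv.trajectory_mem hp hσ) (by rw [← tw]; exact hw.trajectory_mem hm hσ)
        (by rw [← ev]; exact hv.norm_le σ) (by rw [← ew]; exact hw.norm_le σ)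
      rw [← tv, ← tw, ← ev, ← ew] at g1
      have g2 := mul_le_mul_of_nonneg_left (hηb σ hσ) hC
      linarith
    have f4 := hd.payoff_le_value hs.1 hy huc
    rw [payoff] at f4 ⊢
    rw [payoff]
    have f5 : 2 * (Cφ + C) * s * J ≤ θ * J := mul_le_mul_of_nonneg_right hsθ hJ0
    have f6 : s * (C * ‖h‖ ^ 2) ≤ 1 * (C * ‖h‖ ^ 2) :=
      mul_le_mul_of_nonneg_right hs1 (by positivity)
    have f7 : s * (C * (s * J)) ≤ 1 * (C * (s * J)) :=
      mul_le_mul_of_nonneg_right hs1 (mul_nonneg hC (mul_nonneg hs.1 hJ0))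
    nlinarith
  have step : ∀ w, IsControl K w → value L φ K s (y + h)
      ≤ 2 * value L φ K s y + 2 * (Cφ + C) * ‖h‖ ^ 2 - payoff L φ s (y - h) w := fun w hw =>
    value_le hK fun v hv => by linarith [key v hv w hw]
  have := value_le (L := L) (φ := φ) (s := s) (x := y - h) hK
    (a := 2 * value L φ K s y + 2 * (Cφ + C) * ‖h‖ ^ 2 - value L φ K s (y + h))
    fun w hw => by linarith [step w hw]
  linarith

/-- The trajectory of a control is Lipschitz. -/
theorem IsControl.lipschitz_trajectory (hv : IsControl K v) (x : E) :
    LipschitzWith K.toNNReal (trajectory x v) := by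
  refine LipschitzWith.of_dist_le_mul fun a b => ?_
  have e : trajectory x v a - trajectory x v b = ∫ σ in b..a, v σ := by
    rw [trajectory, trajectory, add_sub_add_left_eq_sub,
      intervalIntegral.integral_interval_sub_left (hv.intervalIntegrable _ _)
        (hv.intervalIntegrable _ _)]
  rw [dist_eq_norm, e, Real.dist_eq, Real.coe_toNNReal _ hv.nonneg]
  exact intervalIntegral.norm_integral_le_of_norm_le_const fun τ _ => hv.norm_le τ

theorem IsControl.ae_hasDerivAt_trajectory (hv : IsControl K v) (x : E) (hs : 0 ≤ s) :
    ∀ᵐ σ : ℝ, σ ∈ Icc 0 s → HasDerivAt (trajectory x v) (v σ) σ := by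
  have := FiniteDimensional.complete ℝ E
  filter_upwards [(hv.intervalIntegrable 0 s).ae_hasDerivAt_integral] with σ h hσ
  have := h (by rwa [uIcc_of_le hs]) 0 (by simp)
  exact this.const_add x

/-- A lower bound for second differences, from perturbing near-optimal controls by an affine
displacement. -/
theorem IsLocalData.exists_le_value_second_difference (hd : IsLocalData L φ z₀ R Λ₀ Cφ) (K : ℝ) :
    ∃ C ≥ 0, ∀ s > 0, ∀ y h : E, ‖h‖ ≤ s → dist (y + h) z₀ + (K + 1) * s ≤ R →
      dist (y - h) z₀ + (K + 1) * s ≤ R → 0 ≤ K → ∀ a b : ℝ,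
      (∀ w, IsControl (K + 1) w → payoff L φ s (y + h) w ≤ a) →
      (∀ w, IsControl (K + 1) w → payoff L φ s (y - h) w ≤ b) →
      - (C * (s + 1 / s) * ‖h‖ ^ 2) ≤ a + b - 2 * value L φ K s y := by
  obtain ⟨C, hC, hup⟩ := hd.lagrangian.second_difference_le (K + 1)
  refine ⟨C, hC, fun s hs y h hhs hp hm hK a b ha hb => ?_⟩
  have hy : dist y z₀ + (K + 1) * s ≤ R := by
    have e : y - z₀ = (1 / 2 : ℝ) • ((y + h) - z₀) + (1 / 2 : ℝ) • ((y - h) - z₀) := by module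
    rw [dist_eq_norm] at hp hm ⊢
    rw [e]
    refine (add_le_add_left (norm_add_le _ _) _).trans ?_
    rw [norm_smul, norm_smul]
    norm_num
    linarith
  have key : value L φ K s y ≤ (a + b + C * (s + 1 / s) * ‖h‖ ^ 2) / 2 := by
    refine value_le hK fun v hv => ?_
    have hv1 : IsControl (K + 1) v := ⟨hv.measurable, fun t => (hv.norm_le t).trans (by linarith)⟩
    have hks : ‖s⁻¹ • h‖ ≤ 1 := by
      rw [norm_smul, norm_inv, Real.norm_eq_abs, abs_of_pos hs, inv_mul_le_iff₀ hs, mul_one]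
      exact hhs
    have hk : IsControl (K + 1) fun _ : ℝ => s⁻¹ • h := isControl_const (by linarith)
    -- The displacement ±(1 - t/s)h vanishes at time s, so all three trajectories end at the same
    -- point and φ cancels. Its velocity has norm ‖h‖/s ≤ 1, whence the speed K + 1 and the factor
    -- 1/s. The bounds a and b are abstract because the perturbed controls may exceed the speed K of
    -- the value function.
    set vp : ℝ → E := fun τ => v τ + (-(s⁻¹ • h)) with hvp
    set vm : ℝ → E := fun τ => v τ - (-(s⁻¹ • h)) with hvm
    have hcp : IsControl (K + 1) vp := ⟨hv.measurable.add_const _, fun t =>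
      (norm_add_le _ _).trans (by rw [norm_neg]; linarith [hv.norm_le t])⟩
    have hcm : IsControl (K + 1) vm := ⟨hv.measurable.sub_const _, fun t =>
      (norm_sub_le _ _).trans (by rw [norm_neg]; linarith [hv.norm_le t])⟩
    have tp : ∀ t, trajectory (y + h) vp t = trajectory y v t + (1 - t / s) • h := fun t => by
      have := trajectory_combination (y := y) (h := h) (a := 1) (b := 1) (c := 1) (d := -1)
        hv1 hk t
      have e : (fun τ => (1 : ℝ) • v τ + (-1 : ℝ) • (fun _ : ℝ => s⁻¹ • h) τ) = vp := by
        ext1 τ; simp [hvp]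
      rw [e] at this
      simp only [one_smul, intervalIntegral.integral_const, sub_zero] at this
      rw [this, trajectory, div_eq_mul_inv]
      module
    have tm : ∀ t, trajectory (y - h) vm t = trajectory y v t - (1 - t / s) • h := fun t => by
      have := trajectory_combination (y := y) (h := h) (a := 1) (b := -1) (c := 1) (d := 1)
        hv1 hk t
      have e : (fun τ => (1 : ℝ) • v τ + (1 : ℝ) • (fun _ : ℝ => s⁻¹ • h) τ) = vm := by
        ext1 τ; simp [hvm]
      rw [e] at this
      simp only [one_smul, neg_smul, ← sub_eq_add_neg, intervalIntegral.integral_const,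
        sub_zero] at this
      rw [this, trajectory, div_eq_mul_inv]
      module
    have l0 := left_mem_Icc.2 hs.le
    have l1 := right_mem_Icc.2 hs.le
    have ip := hd.integrable_action hcp hp l0 l1
    have im := hd.integrable_action hcm hm l0 l1
    have iv := hd.integrable_action hv1 hy l0 l1
    have f3 : (∫ σ in (0 : ℝ)..s, L (trajectory (y + h) vp σ) (vp σ))
        + (∫ σ in (0 : ℝ)..s, L (trajectory (y - h) vm σ) (vm σ))
        - 2 * (∫ σ in (0 : ℝ)..s, L (trajectory y v σ) (v σ))
        ≤ s * (C * (‖h‖ ^ 2 + (s⁻¹ * ‖h‖) ^ 2)) := by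
      have e : s * (C * (‖h‖ ^ 2 + (s⁻¹ * ‖h‖) ^ 2))
          = ∫ τ in (0 : ℝ)..s, C * (‖h‖ ^ 2 + (s⁻¹ * ‖h‖) ^ 2) := by
        rw [intervalIntegral.integral_const, sub_zero, smul_eq_mul]
      rw [← intervalIntegral.integral_const_mul (2 : ℝ), ← intervalIntegral.integral_add ip im,
        ← intervalIntegral.integral_sub (ip.add im) (iv.const_mul 2), e]
      refine intervalIntegral.integral_mono_on hs.le ((ip.add im).sub (iv.const_mul 2))
        intervalIntegrable_const fun σ hσ => ?_
      have g1 := hup (trajectory y v σ) ((1 - σ / s) • h) (v σ) (-(s⁻¹ • h))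
        (by rw [← tp]; exact hcp.trajectory_mem hp hσ) (by rw [← tm]; exact hcm.trajectory_mem hm hσ)
        (hcp.norm_le σ) (hcm.norm_le σ)
      rw [← tp, ← tm] at g1
      refine g1.trans (mul_le_mul_of_nonneg_left (add_le_add ?_ ?_) hC)
      · have h1 : ‖(1 - σ / s) • h‖ ≤ ‖h‖ := by
          rw [norm_smul]
          refine mul_le_of_le_one_left (norm_nonneg _) ?_
          rw [Real.norm_eq_abs, abs_le]
          have : σ / s ≤ 1 := (div_le_one hs).2 hσ.2
          have : 0 ≤ σ / s := div_nonneg hσ.1 hs.le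
          constructor <;> linarith
        gcongr
      · rw [norm_neg, norm_smul, norm_inv, Real.norm_eq_abs, abs_of_pos hs]
    have f1 := ha vp hcp
    have f2 := hb vm hcm
    have ep : trajectory (y + h) vp s = trajectory y v s := by rw [tp]; simp [hs.ne']
    have em : trajectory (y - h) vm s = trajectory y v s := by rw [tm]; simp [hs.ne']
    rw [payoff, ep] at f1
    rw [payoff, em] at f2
    rw [payoff]
    have e5 : s * (C * (‖h‖ ^ 2 + (s⁻¹ * ‖h‖) ^ 2)) = C * (s + 1 / s) * ‖h‖ ^ 2 := by
      field_simp
    linarith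
  linarith

/-- Short-time regularity of the value function: verification, differentiability, and
semiconcavity with a constant that does not depend on the time. -/
theorem IsLocalData.exists_regularity (hd : IsLocalData L φ z₀ R Λ₀ Cφ) (hR : 0 < R) :
    ∃ K ≥ 0, ∃ s₀ > 0, ∃ C ≥ 0, (K + 1) * s₀ ≤ R / 8 ∧ ∀ s, 0 < s → s ≤ s₀ →
      (∀ (ξ : ℝ → E) (ℓ : ℝ → ℝ), AbsolutelyContinuousOnInterval ξ 0 s →
        (∀ σ ∈ Icc 0 s, ξ σ ∈ Metric.closedBall z₀ (R / 2)) →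
        IntervalIntegrable ℓ volume 0 s →
        (∀ᵐ σ : ℝ, σ ∈ Ioo 0 s → ∃ v, HasDerivAt ξ v σ ∧ L (ξ σ) v ≤ ℓ σ) →
        φ (ξ s) - ∫ σ in (0 : ℝ)..s, ℓ σ ≤ value L φ K s (ξ 0)) ∧
      (∀ z ∈ Metric.ball z₀ (R / 8), |value L φ K s z - φ z| ≤ C * s) ∧
      ∀ z ∈ Metric.ball z₀ (R / 8), ∃ P : E →L[ℝ] ℝ, HasFDerivAt (value L φ K s) P z ∧
        ‖P‖ ≤ C ∧ ∀ y ∈ Metric.ball z₀ (R / 8),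
          value L φ K s y ≤ value L φ K s z + P (y - z) + C * ‖y - z‖ ^ 2 := by
  -- The order of choices avoids a circle. First Λ is fixed, then K: with superlinear slope Λ + 1,
  -- every speed above C₀ + C₁ has L ≥ Λ‖v‖ + C₀, as verification requires. The spatial Lipschitz
  -- constant of the value function is Λ₀ + C₂s with C₂ depending on K, and it is brought below Λ by
  -- shrinking s₀.
  set Λ := Λ₀ + 1 with hΛdef
  have hΛ0 : 0 ≤ Λ := by have := hd.Λ_nonneg; positivity
  obtain ⟨C₀, hC₀, hrest⟩ := hd.lagrangian.rest_le
  obtain ⟨C₁, hC₁, hsup⟩ := hd.lagrangian.superlinear (Λ + 1)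
  set K := C₀ + C₁ with hKdef
  have hK : 0 ≤ K := by positivity
  obtain ⟨C₂, hC₂, hlip⟩ := hd.exists_value_lipschitz (K := K) hK
  obtain ⟨s₁, hs₁, C₃, hC₃, hsc⟩ := hd.exists_value_second_difference_le (K := K) hK
  obtain ⟨C₄, hC₄, hlow⟩ := hd.exists_le_value_second_difference K
  obtain ⟨C₅, hC₅, hval⟩ := hd.exists_abs_value_sub_le (K := K) hK
  set s₀ := min s₁ (min (R / 8 / (K + 1)) (1 / (C₂ + 1))) with hs₀
  have hs₀pos : 0 < s₀ := by positivity
  have hKs₀ : (K + 1) * s₀ ≤ R / 8 := by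
    have : s₀ ≤ R / 8 / (K + 1) := (min_le_right _ _).trans (min_le_left _ _)
    rw [le_div_iff₀ (by positivity)] at this
    linarith
  have hC₂s₀ : C₂ * s₀ ≤ 1 := by
    have : s₀ ≤ 1 / (C₂ + 1) := (min_le_right _ _).trans (min_le_right _ _)
    rw [le_div_iff₀ (by positivity)] at this
    linarith
  refine ⟨K, hK, s₀, hs₀pos, max (max C₃ Λ) C₅, by positivity, hKs₀, fun s hs hss₀ => ?_⟩
  have hKs : (K + 1) * s ≤ R / 8 := (mul_le_mul_of_nonneg_left hss₀ (by positivity)).trans hKs₀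
  have hKs' : K * s ≤ R / 8 := by linarith
  have hΛ : ∀ σ ∈ Icc 0 s, ∀ x, dist x z₀ + K * σ ≤ R → ∀ x', dist x' z₀ + K * σ ≤ R →
      |value L φ K σ x - value L φ K σ x'| ≤ Λ * ‖x - x'‖ := by
    intro σ hσ x hx x' hx'
    refine (hlip σ hσ.1 x hx x' hx').trans ?_
    gcongr
    have : C₂ * σ ≤ C₂ * s₀ := mul_le_mul_of_nonneg_left (hσ.2.trans hss₀) hC₂
    linarith
  have hver : ∀ (ξ : ℝ → E) (ℓ : ℝ → ℝ), AbsolutelyContinuousOnInterval ξ 0 s →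
        (∀ σ ∈ Icc 0 s, ξ σ ∈ Metric.closedBall z₀ (R / 2)) →
        IntervalIntegrable ℓ volume 0 s →
        (∀ᵐ σ : ℝ, σ ∈ Ioo 0 s → ∃ v, HasDerivAt ξ v σ ∧ L (ξ σ) v ≤ ℓ σ) →
        φ (ξ s) - ∫ σ in (0 : ℝ)..s, ℓ σ ≤ value L φ K s (ξ 0) := by
    intro ξ ℓ hξ hmem hℓ hae
    refine hd.le_value_of_absolutelyContinuous hK hs.le (by linarith) hΛ hrest ?_ hξ hmem hℓ hae
    intro z hz v hv
    have := hsup z hz v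
    linarith
  -- Trajectories of speed K + 1 are absolutely continuous curves, so verification bounds their
  -- payoffs by the value for speed K. This closes the gap between K and K + 1 in the lower
  -- second-difference bound.
  have hcontrol : ∀ x, dist x z₀ ≤ 3 * R / 8 → ∀ w, IsControl (K + 1) w →
      payoff L φ s x w ≤ value L φ K s x := by
    intro x hx w hw
    have hadm : dist x z₀ + (K + 1) * s ≤ R / 2 := by linarith
    have hadm' : dist x z₀ + (K + 1) * s ≤ R := by linarith
    have h0 : trajectory x w 0 = x := by simp [trajectory]
    have := hver (trajectory x w) (fun σ => L (trajectory x w σ) (w σ))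
      ((hw.lipschitz_trajectory x).lipschitzOnWith).absolutelyContinuousOnInterval
      (fun σ hσ => hw.trajectory_mem hadm hσ)
      (hd.integrable_action hw hadm' (left_mem_Icc.2 hs.le) (right_mem_Icc.2 hs.le)) (by
        filter_upwards [hw.ae_hasDerivAt_trajectory x hs.le] with σ h hσ
        exact ⟨w σ, h (Ioo_subset_Icc_self hσ), le_rfl⟩)
    rwa [h0] at this
  refine ⟨hver, fun z hz => ?_, fun z hz => ?_⟩
  · rw [Metric.mem_ball] at hz
    refine (hval s hs.le z (by linarith)).trans ?_
    gcongr
    exact le_max_right _ _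
  rw [Metric.mem_ball] at hz
  have hball : ∀ y ∈ Metric.ball z (R / 4), dist y z₀ ≤ 3 * R / 8 := by
    intro y hy
    rw [Metric.mem_ball] at hy
    linarith [dist_triangle y z z₀]
  have hlipz : ∀ y ∈ Metric.ball z (R / 4), ∀ y' ∈ Metric.ball z (R / 4),
      |value L φ K s y - value L φ K s y'| ≤ Λ * ‖y - y'‖ := fun y hy y' hy' =>
    hΛ s ⟨hs.le, le_rfl⟩ y (by linarith [hball y hy]) y' (by linarith [hball y' hy'])
  have hupz : ∀ y h : E, y + h ∈ Metric.ball z (R / 4) → y - h ∈ Metric.ball z (R / 4) →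
      value L φ K s (y + h) + value L φ K s (y - h) - 2 * value L φ K s y ≤ C₃ * ‖h‖ ^ 2 :=
    fun y h hp hm => hsc s ⟨hs.le, hss₀.trans (min_le_left _ _)⟩ y h
      (by linarith [hball _ hp]) (by linarith [hball _ hm])
  -- The lower bound holds only for ‖h‖ ≤ s and degenerates as s → 0. It is used solely for the
  -- existence of the derivative, so neither ρ nor its constant enters the final estimates.
  set ρ := min (R / 4) s with hρ
  have hρpos : 0 < ρ := by positivity
  have hsub : Metric.ball z ρ ⊆ Metric.ball z (R / 4) := Metric.ball_subset_ball (min_le_left _ _)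
  obtain ⟨P, hP⟩ := exists_hasFDerivAt_of_second_difference_le (f := value L φ K s) (x := z)
    (C := max C₃ (C₄ * (s + 1 / s))) (Λ := Λ) hρpos
    (fun y hy y' hy' => hlipz y (hsub hy) y' (hsub hy')) (by
      intro y h hp hm
      have hhs : ‖h‖ ≤ s := by
        have e : h = (1 / 2 : ℝ) • ((y + h) - z) + (1 / 2 : ℝ) • (-((y - h) - z)) := by module
        rw [Metric.mem_ball, dist_eq_norm] at hp hm
        have hρs : ρ ≤ s := min_le_right _ _
        rw [e]
        refine (norm_add_le _ _).trans ?_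
        rw [norm_smul, norm_smul, norm_neg]
        norm_num
        linarith
      have bp := hball _ (hsub hp)
      have bm := hball _ (hsub hm)
      have h1 := hupz y h (hsub hp) (hsub hm)
      have h2 := hlow s hs y h hhs (by linarith) (by linarith) hK _ _
        (hcontrol _ bp) (hcontrol _ bm)
      have h3 : C₃ * ‖h‖ ^ 2 ≤ max C₃ (C₄ * (s + 1 / s)) * ‖h‖ ^ 2 := by
        gcongr; exact le_max_left _ _
      have h4 : C₄ * (s + 1 / s) * ‖h‖ ^ 2 ≤ max C₃ (C₄ * (s + 1 / s)) * ‖h‖ ^ 2 := by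
        gcongr; exact le_max_right _ _
      rw [abs_le]
      constructor <;> linarith)
  refine ⟨P, hP, ?_, fun y hy => ?_⟩
  · have hl : LipschitzOnWith Λ.toNNReal (value L φ K s) (Metric.ball z (R / 4)) :=
      LipschitzOnWith.of_dist_le_mul fun y hy y' hy' => by
        rw [Real.dist_eq, dist_eq_norm, Real.coe_toNNReal _ hΛ0]
        exact hlipz y hy y' hy'
    have := hP.le_of_lipschitzOn (Metric.ball_mem_nhds z (by positivity)) hl
    rw [Real.coe_toNNReal _ hΛ0] at this
    exact this.trans ((le_max_right _ _).trans (le_max_left _ _))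
  · rw [Metric.mem_ball] at hy
    have := le_quadratic_of_second_difference_le (ρ := R / 4) hP hupz (y := y) (by
      rw [Metric.mem_ball]
      linarith [dist_triangle_right y z z₀])
    have h5 : C₃ / 2 * ‖y - z‖ ^ 2 ≤ max (max C₃ Λ) C₅ * ‖y - z‖ ^ 2 := by
      gcongr
      have : C₃ ≤ max (max C₃ Λ) C₅ := (le_max_left _ _).trans (le_max_left _ _)
      linarith
    linarith

end Regularity

/-! ### Velocities and differentials in charts -/

section Charts

variable {n : ℕ} {M : Type*} [MetricSpace M] [ChartedSpace (EuclideanSpace ℝ (Fin n)) M]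
  [IsManifold (𝓡 n) ∞ M]

/-- The differential at `y` of the chart at `c`, as a map to the model space. -/
def chartD (c y : M) : TangentSpace (𝓡 n) y →L[ℝ] EuclideanSpace ℝ (Fin n) :=
  (trivializationAt (EuclideanSpace ℝ (Fin n)) (TangentSpace (𝓡 n)) c).continuousLinearMapAt ℝ y

/-- The inverse of the differential at `y` of the chart at `c`. -/
def chartDinv (c y : M) : EuclideanSpace ℝ (Fin n) →L[ℝ] TangentSpace (𝓡 n) y :=
  (trivializationAt (EuclideanSpace ℝ (Fin n)) (TangentSpace (𝓡 n)) c).symmL ℝ y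

variable {c y : M}

theorem chartDinv_chartD (hy : y ∈ (extChartAt (𝓡 n) c).source) (v : TangentSpace (𝓡 n) y) :
    chartDinv c y (chartD c y v) = v :=
  Trivialization.symmL_continuousLinearMapAt _ (by simpa using hy) v

theorem chartD_chartDinv (hy : y ∈ (extChartAt (𝓡 n) c).source)
    (w : EuclideanSpace ℝ (Fin n)) : chartD c y (chartDinv c y w) = w :=
  Trivialization.continuousLinearMapAt_symmL _ (by simpa using hy) w

theorem hasMFDerivAt_extChartAt (hy : y ∈ (extChartAt (𝓡 n) c).source) :
    HasMFDerivAt (𝓡 n) 𝓘(ℝ, EuclideanSpace ℝ (Fin n)) (extChartAt (𝓡 n) c) y (chartD c y) := by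
  have hy' : y ∈ (chartAt (EuclideanSpace ℝ (Fin n)) c).source := by simpa using hy
  have h := (mdifferentiableAt_extChartAt (I := 𝓡 n) hy').hasMFDerivAt
  rwa [← TangentBundle.continuousLinearMapAt_trivializationAt hy'] at h

/-- The tangent space at c is the model space through the chart at c itself. This is what allows
covectors on the model space to be read as elements of T*_c M. -/
theorem chartD_self (w : TangentSpace (𝓡 n) c) : chartD c c w = w := by
  have h1 := (hasMFDerivAt_extChartAt (n := n) (c := c) (y := c) (by simp)).mfderiv
  have h2 := mfderiv_extChartAt_self (I := 𝓡 n) (x := c)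
  rw [h1] at h2
  exact congrArg (fun f : EuclideanSpace ℝ (Fin n) →L[ℝ] EuclideanSpace ℝ (Fin n) => f w) h2

theorem HasVelocityAt.hasDerivAt {ξ : ℝ → M} {t : ℝ} {v : TangentSpace (𝓡 n) (ξ t)}
    (h : HasVelocityAt ξ t v) (hy : ξ t ∈ (extChartAt (𝓡 n) c).source) :
    HasDerivAt (fun s => extChartAt (𝓡 n) c (ξ s)) (chartD c (ξ t) v) t := by
  have := (hasMFDerivAt_extChartAt hy).comp t h
  have h2 : HasFDerivAt (fun s => extChartAt (𝓡 n) c (ξ s))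
      ((chartD c (ξ t)).comp (ContinuousLinearMap.toSpanSingleton ℝ v) :
        ℝ →L[ℝ] EuclideanSpace ℝ (Fin n)) t := hasMFDerivAt_iff_hasFDerivAt.1 this
  refine h2.hasDerivAt.congr_deriv ?_
  have : (ContinuousLinearMap.toSpanSingleton ℝ v : ℝ →L[ℝ] TangentSpace (𝓡 n) (ξ t)) (1 : ℝ) = v :=
    ContinuousLinearMap.toSpanSingleton_apply_one ℝ v
  exact congrArg (chartD c (ξ t)) this

theorem HasVelocityAt.velocity_eq {ξ : ℝ → M} {t : ℝ} {v : TangentSpace (𝓡 n) (ξ t)}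
    (h : HasVelocityAt ξ t v) : velocity n ξ t = v := by
  rw [velocity, HasMFDerivAt.mfderiv h]
  exact ContinuousLinearMap.toSpanSingleton_apply_one ℝ v

/-- Converse of `HasVelocityAt.hasDerivAt`, by composition with the inverse chart. Continuity of ξ
at t is a separate hypothesis: it keeps the curve in the chart domain, outside which the chart
expression carries no information. -/
theorem hasVelocityAt_of_hasDerivAt {ξ : ℝ → M} {t : ℝ} {w : EuclideanSpace ℝ (Fin n)}
    (hξ : ContinuousAt ξ t) (hy : ξ t ∈ (extChartAt (𝓡 n) c).source)
    (h : HasDerivAt (fun s => extChartAt (𝓡 n) c (ξ s)) w t) :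
    HasVelocityAt ξ t (chartDinv c (ξ t) w) := by
  have hy' : ξ t ∈ (chartAt (EuclideanSpace ℝ (Fin n)) c).source := by simpa using hy
  have htarget : extChartAt (𝓡 n) c (ξ t) ∈ (extChartAt (𝓡 n) c).target :=
    (extChartAt (𝓡 n) c).map_source hy
  have hsymm : MDifferentiableAt 𝓘(ℝ, EuclideanSpace ℝ (Fin n)) (𝓡 n) (extChartAt (𝓡 n) c).symm
      (extChartAt (𝓡 n) c (ξ t)) := by
    have := (contMDiffOn_extChartAt_symm (I := 𝓡 n) (n := 1) c).contMDiffAt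
      ((isOpen_extChartAt_target (I := 𝓡 n) c).mem_nhds htarget)
    exact this.mdifferentiableAt (by norm_num)
  have hd : MDifferentiableAt 𝓘(ℝ, ℝ) 𝓘(ℝ, EuclideanSpace ℝ (Fin n))
      (fun s => extChartAt (𝓡 n) c (ξ s)) t := h.differentiableAt.mdifferentiableAt
  have hcomp := MDifferentiableAt.comp t hsymm hd
  have hev : ξ =ᶠ[𝓝 t] (extChartAt (𝓡 n) c).symm ∘ fun s => extChartAt (𝓡 n) c (ξ s) := by
    filter_upwards [hξ ((isOpen_extChartAt_source (I := 𝓡 n) c).mem_nhds hy)] with s hs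
    exact ((extChartAt (𝓡 n) c).left_inv hs).symm
  have hm : MDifferentiableAt 𝓘(ℝ, ℝ) (𝓡 n) ξ t := hcomp.congr_of_eventuallyEq hev
  have hv : HasVelocityAt ξ t (velocity n ξ t) := by
    have h1 := hm.hasMFDerivAt
    have e : mfderiv 𝓘(ℝ, ℝ) (𝓡 n) ξ t
        = (ContinuousLinearMap.toSpanSingleton ℝ (velocity n ξ t) :
          ℝ →L[ℝ] TangentSpace (𝓡 n) (ξ t)) := by
      refine ContinuousLinearMap.ext_ring (R₁ := ℝ) ?_
      exact (ContinuousLinearMap.toSpanSingleton_apply_one ℝ (velocity n ξ t)).symm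
    rw [e] at h1
    exact h1
  have h2 := (hv.hasDerivAt hy).unique h
  rwa [← h2, chartDinv_chartD hy]

theorem hasMFDerivAt_of_hasFDerivAt_chart {u : M → ℝ} {P : EuclideanSpace ℝ (Fin n) →L[ℝ] ℝ}
    (hy : y ∈ (extChartAt (𝓡 n) c).source)
    (h : HasFDerivAt (fun z => u ((extChartAt (𝓡 n) c).symm z)) P (extChartAt (𝓡 n) c y)) :
    HasMFDerivAt (𝓡 n) 𝓘(ℝ, ℝ) u y (P.comp (chartD c y)) := by
  have h1 := HasMFDerivAt.comp y h.hasMFDerivAt (hasMFDerivAt_extChartAt hy)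
  refine HasMFDerivAt.congr_of_eventuallyEq h1 ?_
  filter_upwards [(isOpen_extChartAt_source (I := 𝓡 n) c).mem_nhds hy] with x hx
  simp only [Function.comp_apply, (extChartAt (𝓡 n) c).left_inv hx]

end Charts

/-! ### The Hamiltonian, the Lagrangian and H_p in charts -/

section LocalHamiltonian

variable {n : ℕ} {M : Type*} [MetricSpace M] [ChartedSpace (EuclideanSpace ℝ (Fin n)) M]
  [IsManifold (𝓡 n) ∞ M]

/-- The Hamiltonian read in the chart at `c`. -/
def localHam (H : ∀ x : M, CotangentSpace n x → ℝ) (c : M) (z : EuclideanSpace ℝ (Fin n))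
    (q : EuclideanSpace ℝ (Fin n) →L[ℝ] ℝ) : ℝ :=
  H ((extChartAt (𝓡 n) c).symm z) (q.comp (chartD c ((extChartAt (𝓡 n) c).symm z)))

variable {H : ∀ x : M, CotangentSpace n x → ℝ} {c y : M}

theorem localHam_extChartAt (hy : y ∈ (extChartAt (𝓡 n) c).source)
    (q : EuclideanSpace ℝ (Fin n) →L[ℝ] ℝ) :
    localHam H c (extChartAt (𝓡 n) c y) q = H y (q.comp (chartD c y)) := by
  unfold localHam
  rw [(extChartAt (𝓡 n) c).left_inv hy]

theorem comp_chartDinv_comp_chartD (hy : y ∈ (extChartAt (𝓡 n) c).source)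
    (p : CotangentSpace n y) : (p.comp (chartDinv c y)).comp (chartD c y) = p := by
  ext v
  simp only [ContinuousLinearMap.comp_apply, chartDinv_chartD hy]

/-- Pullback by the differential of the chart is a bijection of covectors that preserves the pairing
with vectors, so the two suprema agree after reindexing. -/
theorem lagrangian_eq_legendre (hy : y ∈ (extChartAt (𝓡 n) c).source)
    (v : TangentSpace (𝓡 n) y) :
    lagrangian H y v = legendre (localHam H c) (extChartAt (𝓡 n) c y) (chartD c y v) := by
  unfold lagrangian legendre
  refine Function.Surjective.iSup_congr (fun p : CotangentSpace n y => p.comp (chartDinv c y))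
    (fun q => ⟨q.comp (chartD c y), ?_⟩) fun p => ?_
  · ext w
    simp only [ContinuousLinearMap.comp_apply, chartD_chartDinv hy]
  · rw [localHam_extChartAt hy, comp_chartDinv_comp_chartD hy]
    simp only [ContinuousLinearMap.comp_apply, chartDinv_chartD hy]

variable [RiemannianBundle (fun x : M => TangentSpace (𝓡 n) x)]

/-- The map (z, q) ↦ (y, q ∘ chartD c y), with y the point of coordinates z, is the inverse of the
cotangent bundle trivialization at c composed with the inverse chart; it is smooth, and H is C² on
the bundle. -/
theorem IsTonelli.contDiffOn_localHam (hH : IsTonelli H) (c : M) :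
    ContDiffOn ℝ 2 (fun w : EuclideanSpace ℝ (Fin n) × (EuclideanSpace ℝ (Fin n) →L[ℝ] ℝ) =>
      localHam H c w.1 w.2) ((extChartAt (𝓡 n) c).target ×ˢ univ) := by
  set t := trivializationAt (EuclideanSpace ℝ (Fin n) →L[ℝ] ℝ)
    (fun x : M => TangentSpace (𝓡 n) x →L[ℝ] Bundle.Trivial M ℝ x) c with ht
  have hbase : t.baseSet = (chartAt (EuclideanSpace ℝ (Fin n)) c).source := by
    rw [ht, hom_trivializationAt_baseSet]
    simp
  have hsymm : ∀ y ∈ (chartAt (EuclideanSpace ℝ (Fin n)) c).source,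
      ∀ q : EuclideanSpace ℝ (Fin n) →L[ℝ] ℝ,
      t.toOpenPartialHomeomorph.symm (y, q) = ⟨y, q.comp (chartD c y)⟩ := by
    intro y hy q
    have hsrc : (⟨y, q.comp (chartD c y)⟩ : TotalSpace (EuclideanSpace ℝ (Fin n) →L[ℝ] ℝ)
      (fun x : M => TangentSpace (𝓡 n) x →L[ℝ] Bundle.Trivial M ℝ x)) ∈ t.source := by
      rw [t.mem_source, hbase]; exact hy
    have happ : t (⟨y, q.comp (chartD c y)⟩ : TotalSpace (EuclideanSpace ℝ (Fin n) →L[ℝ] ℝ)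
      (fun x : M => TangentSpace (𝓡 n) x →L[ℝ] Bundle.Trivial M ℝ x)) = (y, q) := by
      rw [ht, hom_trivializationAt_apply]
      refine Prod.ext rfl ?_
      ext w
      have := chartD_chartDinv (c := c) (y := y) (by simpa using hy) w
      simp only [ContinuousLinearMap.inCoordinates, ContinuousLinearMap.comp_apply]
      simp only [chartDinv] at this
      rw [this]
      simp
    have := t.toOpenPartialHomeomorph.left_inv hsrc
    rw [← this]
    exact congrArg _ happ.symm
  have hmap : ContMDiffOn 𝓘(ℝ, EuclideanSpace ℝ (Fin n) × (EuclideanSpace ℝ (Fin n) →L[ℝ] ℝ))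
      ((𝓡 n).prod 𝓘(ℝ, EuclideanSpace ℝ (Fin n) →L[ℝ] ℝ)) 2
      (fun w : EuclideanSpace ℝ (Fin n) × (EuclideanSpace ℝ (Fin n) →L[ℝ] ℝ) =>
        ((extChartAt (𝓡 n) c).symm w.1, w.2)) ((extChartAt (𝓡 n) c).target ×ˢ univ) := by
    have h1 : ContMDiffOn 𝓘(ℝ, EuclideanSpace ℝ (Fin n) × (EuclideanSpace ℝ (Fin n) →L[ℝ] ℝ))
        𝓘(ℝ, EuclideanSpace ℝ (Fin n)) 2
        (fun w : EuclideanSpace ℝ (Fin n) × (EuclideanSpace ℝ (Fin n) →L[ℝ] ℝ) => w.1)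
        ((extChartAt (𝓡 n) c).target ×ˢ univ) := contDiff_fst.contMDiff.contMDiffOn
    have h2 : ContMDiffOn 𝓘(ℝ, EuclideanSpace ℝ (Fin n) × (EuclideanSpace ℝ (Fin n) →L[ℝ] ℝ))
        𝓘(ℝ, EuclideanSpace ℝ (Fin n) →L[ℝ] ℝ) 2
        (fun w : EuclideanSpace ℝ (Fin n) × (EuclideanSpace ℝ (Fin n) →L[ℝ] ℝ) => w.2)
        ((extChartAt (𝓡 n) c).target ×ˢ univ) := contDiff_snd.contMDiff.contMDiffOn
    exact ((contMDiffOn_extChartAt_symm (n := 2) c).comp h1 fun w hw => hw.1).prodMk h2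
  have hcomp := (t.contMDiffOn_symm (IB := 𝓡 n) (n := 2)).comp hmap (by
    intro w hw
    rw [mem_preimage, t.mem_target, hbase]
    have := (extChartAt (𝓡 n) c).map_target hw.1
    simpa using this)
  have hfin := hH.contMDiff.comp_contMDiffOn hcomp
  rw [contMDiffOn_iff_contDiffOn] at hfin
  refine hfin.congr fun w hw => ?_
  have hy := (extChartAt (𝓡 n) c).map_target hw.1
  have := hsymm ((extChartAt (𝓡 n) c).symm w.1) (by simpa using hy) w.2
  simp only [Function.comp_apply]
  rw [this]
  rfl

variable [IsContMDiffRiemannianBundle (𝓡 n) ∞ (EuclideanSpace ℝ (Fin n))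
      (fun x : M => TangentSpace (𝓡 n) x)]

variable (n M) in
/-- A smooth Riemannian metric is continuous. -/
theorem isContinuousRiemannianBundle_tangent :
    IsContinuousRiemannianBundle (EuclideanSpace ℝ (Fin n))
      (fun x : M => TangentSpace (𝓡 n) x) := by
  obtain ⟨g, hg, h⟩ := IsContMDiffRiemannianBundle.exists_contMDiff (IB := 𝓡 n) (n := ∞)
    (F := EuclideanSpace ℝ (Fin n)) (E := fun x : M => TangentSpace (𝓡 n) x)
  exact ⟨⟨g, hg.continuous, h⟩⟩

theorem exists_norm_chartD_le (c : M) : ∃ C > 0, ∀ᶠ y in 𝓝 c,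
    (∀ v : TangentSpace (𝓡 n) y, ‖chartD c y v‖ ≤ C * ‖v‖) ∧
    ∀ w, ‖chartDinv (n := n) c y w‖ ≤ C * ‖w‖ := by
  have := isContinuousRiemannianBundle_tangent n M
  obtain ⟨C₁, hC₁, h1⟩ := eventually_norm_trivializationAt_lt (EuclideanSpace ℝ (Fin n))
    (fun x : M => TangentSpace (𝓡 n) x) c
  obtain ⟨C₂, hC₂, h2⟩ := eventually_norm_symmL_trivializationAt_lt (EuclideanSpace ℝ (Fin n))
    (fun x : M => TangentSpace (𝓡 n) x) c
  refine ⟨max C₁ C₂, by positivity, ?_⟩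
  filter_upwards [h1, h2] with y h1 h2
  refine ⟨fun v => ?_, fun w => ?_⟩
  · exact (ContinuousLinearMap.le_of_opNorm_le _ (h1.le.trans (le_max_left _ _)) v)
  · exact (ContinuousLinearMap.le_of_opNorm_le _ (h2.le.trans (le_max_right _ _)) w)

/-- A Tonelli Hamiltonian is Tonelli in charts. -/
theorem IsTonelli.exists_isLocalTonelli (hH : IsTonelli H) (c : M) :
    ∃ R > 0, Metric.ball (extChartAt (𝓡 n) c c) R ⊆ (extChartAt (𝓡 n) c).target ∧
      IsLocalTonelli (localHam H c) (Metric.ball (extChartAt (𝓡 n) c c) R) := by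
  obtain ⟨C, hC, hev⟩ := exists_norm_chartD_le (n := n) c
  have hev2 : ∀ᶠ z in 𝓝 (extChartAt (𝓡 n) c c), z ∈ (extChartAt (𝓡 n) c).target ∧
      ∀ w, ‖chartDinv (n := n) c ((extChartAt (𝓡 n) c).symm z) w‖ ≤ C * ‖w‖ := by
    have h1 : Tendsto (extChartAt (𝓡 n) c).symm (𝓝 (extChartAt (𝓡 n) c c)) (𝓝 c) := by
      have := continuousAt_extChartAt_symm (I := 𝓡 n) c
      rwa [ContinuousAt, extChartAt_to_inv] at this
    filter_upwards [extChartAt_target_mem_nhds (I := 𝓡 n) c, h1.eventually hev] with z hz h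
    exact ⟨hz, h.2⟩
  obtain ⟨R, hR, hball⟩ := Metric.eventually_nhds_iff_ball.1 hev2
  refine ⟨R, hR, fun z hz => (hball z hz).1, ?_, ?_, ?_⟩
  · exact (hH.contDiffOn_localHam c).mono (prod_mono (fun z hz => (hball z hz).1) Subset.rfl)
  · intro z hz p q hq
    have hy := (extChartAt (𝓡 n) c).map_target (hball z hz).1
    refine (hH.hessian_pos ((extChartAt (𝓡 n) c).symm z) (p.comp (chartD c _))
      (q.comp (chartD c _)) ?_).trans_eq ?_
    · intro h0
      refine hq ?_
      ext w
      have := congrArg (fun f : CotangentSpace n ((extChartAt (𝓡 n) c).symm z) =>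
        f (chartDinv c _ w)) h0
      simp only [ContinuousLinearMap.comp_apply, chartD_chartDinv hy] at this
      exact this
    · rfl
  · intro K
    -- The Euclidean norm of a covector in the chart is at most C times its Riemannian norm, so the
    -- slope is enlarged by C; `max K 0` handles negative K, where that comparison would go the
    -- wrong way.
    obtain ⟨C₁, hC₁⟩ := hH.superlinear (max K 0 * C)
    refine ⟨C₁, fun z hz q => ?_⟩
    have hy := (extChartAt (𝓡 n) c).map_target (hball z hz).1
    set p : CotangentSpace n ((extChartAt (𝓡 n) c).symm z) := q.comp (chartD c _) with hp
    have h1 := hC₁ _ p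
    have h2 : ‖q‖ ≤ ‖p‖ * C := by
      refine ContinuousLinearMap.opNorm_le_bound _ (by positivity) fun w => ?_
      have e : q w = p (chartDinv c _ w) := by
        simp only [hp, ContinuousLinearMap.comp_apply, chartD_chartDinv hy]
      rw [e]
      refine (p.le_opNorm _).trans ?_
      rw [mul_assoc]
      gcongr
      exact (hball z hz).2 w
    have h3 : K * ‖q‖ ≤ max K 0 * C * ‖p‖ := by
      calc K * ‖q‖ ≤ max K 0 * ‖q‖ := by gcongr; exact le_max_left _ _
        _ ≤ max K 0 * (‖p‖ * C) := by gcongr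
        _ = max K 0 * C * ‖p‖ := by ring
    have h4 : localHam H c z q = H _ p := rfl
    rw [h4]
    linarith

/-- The gradient of the local Hamiltonian in the momentum variable. -/
def localHp (H : ∀ x : M, CotangentSpace n x → ℝ) (c : M)
    (w : EuclideanSpace ℝ (Fin n) × (EuclideanSpace ℝ (Fin n) →L[ℝ] ℝ)) :
    EuclideanSpace ℝ (Fin n) :=
  (InnerProductSpace.toDual ℝ (EuclideanSpace ℝ (Fin n))).symm
    ((fderiv ℝ (fun w : EuclideanSpace ℝ (Fin n) × (EuclideanSpace ℝ (Fin n) →L[ℝ] ℝ) =>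
      localHam H c w.1 w.2) w).comp
      ((ContinuousLinearMap.inr ℝ _ _).comp (innerSL ℝ (E := EuclideanSpace ℝ (Fin n)))))

theorem apply_localHp (w : EuclideanSpace ℝ (Fin n) × (EuclideanSpace ℝ (Fin n) →L[ℝ] ℝ))
    (q : EuclideanSpace ℝ (Fin n) →L[ℝ] ℝ) :
    q (localHp H c w) =
      fderiv ℝ (fun w : EuclideanSpace ℝ (Fin n) × (EuclideanSpace ℝ (Fin n) →L[ℝ] ℝ) =>
        localHam H c w.1 w.2) w (0, q) := by
  set a := (InnerProductSpace.toDual ℝ (EuclideanSpace ℝ (Fin n))).symm q with ha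
  have hq : q = innerSL ℝ a := by
    have := (InnerProductSpace.toDual ℝ (EuclideanSpace ℝ (Fin n))).apply_symm_apply q
    rw [← this, ← ha]
    rfl
  rw [hq, innerSL_apply_apply, real_inner_comm, localHp,
    InnerProductSpace.toDual_symm_apply]
  rfl

theorem IsTonelli.continuousOn_localHp (hH : IsTonelli H) (c : M) :
    ContinuousOn (localHp H c) ((extChartAt (𝓡 n) c).target ×ˢ univ) := by
  have h := (hH.contDiffOn_localHam c).continuousOn_fderiv_of_isOpen
    ((isOpen_extChartAt_target (I := 𝓡 n) c).prod isOpen_univ) (by norm_num)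
  exact (LinearIsometryEquiv.continuous _).comp_continuousOn (h.clm_comp continuousOn_const)

/-- `Hp` is defined by a choice, so both existence and uniqueness of the representing vector are
needed: the transported local gradient satisfies the defining property, and covectors separate
vectors. -/
theorem IsTonelli.Hp_eq (hH : IsTonelli H) (hy : y ∈ (extChartAt (𝓡 n) c).source)
    (p : CotangentSpace n y) :
    Hp H y p = chartDinv c y (localHp H c (extChartAt (𝓡 n) c y, p.comp (chartDinv c y))) := by
  set v := chartDinv c y (localHp H c (extChartAt (𝓡 n) c y, p.comp (chartDinv c y))) with hv
  have hspec : ∀ q : CotangentSpace n y, HasDerivAt (fun s : ℝ => H y (p + s • q)) (q v) 0 := by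
    intro q
    set F := fun w : EuclideanSpace ℝ (Fin n) × (EuclideanSpace ℝ (Fin n) →L[ℝ] ℝ) =>
        localHam H c w.1 w.2 with hF
    have hmem : (extChartAt (𝓡 n) c y, p.comp (chartDinv c y)) ∈
        (extChartAt (𝓡 n) c).target ×ˢ (univ : Set (EuclideanSpace ℝ (Fin n) →L[ℝ] ℝ)) :=
      ⟨(extChartAt (𝓡 n) c).map_source hy, mem_univ _⟩
    have hd : DifferentiableAt ℝ F (extChartAt (𝓡 n) c y, p.comp (chartDinv c y)) :=
      ((hH.contDiffOn_localHam c).contDiffAt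
        (((isOpen_extChartAt_target (I := 𝓡 n) c).prod isOpen_univ).mem_nhds hmem)).differentiableAt
        (by norm_num)
    have hl : HasDerivAt (fun s : ℝ => (extChartAt (𝓡 n) c y, p.comp (chartDinv c y)
        + s • q.comp (chartDinv c y))) ((0 : EuclideanSpace ℝ (Fin n)), q.comp (chartDinv c y)) 0 := by
      refine (hasDerivAt_const _ _).prodMk ?_
      simpa using ((hasDerivAt_id (0 : ℝ)).smul_const (q.comp (chartDinv c y))).const_add
        (p.comp (chartDinv c y))
    have hd' : HasFDerivAt F (fderiv ℝ F (extChartAt (𝓡 n) c y, p.comp (chartDinv c y)))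
        ((fun s : ℝ => (extChartAt (𝓡 n) c y, p.comp (chartDinv c y)
        + s • q.comp (chartDinv c y))) 0) := by
      simpa using hd.hasFDerivAt
    have hcomp := hd'.comp_hasDerivAt 0 hl
    rw [← apply_localHp] at hcomp
    refine (hcomp.congr_of_eventuallyEq (Eventually.of_forall fun s => ?_)).congr_deriv ?_
    · simp only [Function.comp_apply, hF]
      rw [localHam_extChartAt hy]
      congr 1
      ext w
      have := chartDinv_chartD hy w
      simp only [ContinuousLinearMap.comp_apply, add_apply, smul_apply, this]
    · rfl
  have hε := Classical.epsilon_spec (p := fun v : TangentSpace (𝓡 n) y =>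
    ∀ q : CotangentSpace n y, HasDerivAt (fun s : ℝ => H y (p + s • q)) (q v) 0) ⟨v, hspec⟩
  have huniq : ∀ q : CotangentSpace n y, q (Hp H y p) = q v := fun q => (hε q).unique (hspec q)
  have h1 : chartD c y (Hp H y p) = chartD c y v := by
    refine ext_inner_left ℝ fun a => ?_
    exact huniq ((innerSL ℝ a).comp (chartD c y))
  rw [← chartDinv_chartD hy (Hp H y p), h1, chartDinv_chartD hy]

end LocalHamiltonian

/-! ### Charts are bi-Lipschitz for the Riemannian distance -/

section RiemannianDistance

variable {n : ℕ} {M : Type*} [MetricSpace M] [ChartedSpace (EuclideanSpace ℝ (Fin n)) M]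
  [IsManifold (𝓡 n) ∞ M]

theorem hasVelocityAt_velocity {ξ : ℝ → M} {t : ℝ} (h : MDifferentiableAt 𝓘(ℝ, ℝ) (𝓡 n) ξ t) :
    HasVelocityAt ξ t (velocity n ξ t) := by
  have h1 := h.hasMFDerivAt
  have e : mfderiv 𝓘(ℝ, ℝ) (𝓡 n) ξ t
      = (ContinuousLinearMap.toSpanSingleton ℝ (velocity n ξ t) :
        ℝ →L[ℝ] TangentSpace (𝓡 n) (ξ t)) := by
    refine ContinuousLinearMap.ext_ring (R₁ := ℝ) ?_
    exact (ContinuousLinearMap.toSpanSingleton_apply_one ℝ (velocity n ξ t)).symm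
  rw [e] at h1
  exact h1

theorem tendsto_extChartAt_symm_self (c : M) :
    Tendsto (extChartAt (𝓡 n) c).symm (𝓝 (extChartAt (𝓡 n) c c)) (𝓝 c) := by
  have := continuousAt_extChartAt_symm (I := 𝓡 n) c
  rwa [ContinuousAt, extChartAt_to_inv] at this

variable [RiemannianBundle (fun x : M => TangentSpace (𝓡 n) x)]
  [IsContMDiffRiemannianBundle (𝓡 n) ∞ (EuclideanSpace ℝ (Fin n))
      (fun x : M => TangentSpace (𝓡 n) x)]
  [IsRiemannianManifold (𝓡 n) M]

variable (n) in
/-- Charts of a Riemannian manifold are locally Lipschitz. -/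
theorem exists_lipschitz_extChartAt (c : M) : ∃ r > 0, ∃ C ≥ 0,
    Metric.ball c r ⊆ (extChartAt (𝓡 n) c).source ∧
    ∀ x ∈ Metric.ball c r, ∀ y ∈ Metric.ball c r,
      dist (extChartAt (𝓡 n) c x) (extChartAt (𝓡 n) c y) ≤ C * dist x y := by
  obtain ⟨C, hC, hev⟩ := exists_norm_chartD_le (n := n) c
  obtain ⟨ρ, hρ, hball⟩ := Metric.eventually_nhds_iff_ball.1
    (hev.and (extChartAt_source_mem_nhds (I := 𝓡 n) c))
  -- Two points within ρ/3 of c are joined by a curve shorter than 2ρ/3, which cannot leave the ball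
  -- of radius ρ where the differential of the chart is bounded.
  refine ⟨ρ / 3, by positivity, C, hC.le, fun x hx => (hball x
    (Metric.ball_subset_ball (by linarith) hx)).2, fun x hx y hy => ?_⟩
  have hxy : dist x y < 2 * ρ / 3 := by
    have := dist_triangle_right x y c
    rw [Metric.mem_ball] at hx hy
    linarith
  have key : ∀ l : ℝ, dist x y < l → l < 2 * ρ / 3 →
      dist (extChartAt (𝓡 n) c x) (extChartAt (𝓡 n) c y) ≤ C * l := by
    intro l hl hlρ
    have hl0 : 0 < l := dist_nonneg.trans_lt hl
    have hlt : riemannianEDist (𝓡 n) x y < ENNReal.ofReal l := by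
      rw [← IsRiemannianManifold.out (I := 𝓡 n) x y, edist_dist]
      exact (ENNReal.ofReal_lt_ofReal_iff hl0).2 hl
    obtain ⟨γ, hγ0, hγ1, hγ, hlen, -⟩ :=
      exists_lt_locally_constant_of_riemannianEDist_lt hlt zero_lt_one
    have hmem : ∀ t ∈ Icc (0 : ℝ) 1, γ t ∈ Metric.ball c ρ := by
      intro t ht
      have h1 : edist x (γ t) < ENNReal.ofReal l := by
        rw [IsRiemannianManifold.out (I := 𝓡 n) x (γ t)]
        refine (riemannianEDist_le_pathELength hγ.contMDiffOn hγ0 rfl ht.1).trans_lt ?_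
        exact (pathELength_mono le_rfl ht.2).trans_lt hlen
      rw [edist_dist, ENNReal.ofReal_lt_ofReal_iff hl0] at h1
      have := dist_triangle_left (γ t) c x
      rw [Metric.mem_ball] at hx ⊢
      linarith
    have hsrc : ∀ t ∈ Icc (0 : ℝ) 1, γ t ∈ (extChartAt (𝓡 n) c).source :=
      fun t ht => (hball _ (hmem t ht)).2
    have hcd : ContDiffOn ℝ 1 (fun t => extChartAt (𝓡 n) c (γ t)) (Icc 0 1) := by
      rw [← contMDiffOn_iff_contDiffOn]
      exact (contMDiffOn_extChartAt (I := 𝓡 n) (n := 1) (x := c)).comp hγ.contMDiffOn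
        fun t ht => by simpa using hsrc t ht
    have hle := enorm_sub_le_lintegral_derivWithin_Icc_of_contDiffOn_Icc hcd zero_le_one
    rw [← restrict_Ioo_eq_restrict_Icc] at hle
    have hle2 : ‖extChartAt (𝓡 n) c (γ 1) - extChartAt (𝓡 n) c (γ 0)‖ₑ ≤
        ENNReal.ofReal C * ENNReal.ofReal l := by
      refine hle.trans ?_
      calc _ ≤ ∫⁻ t in Ioo (0 : ℝ) 1, ENNReal.ofReal C * ‖velocity n γ t‖ₑ := by
            refine setLIntegral_mono' measurableSet_Ioo fun t ht => ?_
            have hv := hasVelocityAt_velocity ((hγ.mdifferentiable one_ne_zero) t)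
            have hd := hv.hasDerivAt (hsrc t (Ioo_subset_Icc_self ht))
            rw [derivWithin_of_mem_nhds (Icc_mem_nhds ht.1 ht.2), hd.deriv]
            have := (hball _ (hmem t (Ioo_subset_Icc_self ht))).1.1 (velocity n γ t)
            rw [← ofReal_norm, ← ofReal_norm, ← ENNReal.ofReal_mul hC.le]
            exact ENNReal.ofReal_le_ofReal this
        _ = ENNReal.ofReal C * pathELength (𝓡 n) γ 0 1 := by
            rw [lintegral_const_mul' _ _ ENNReal.ofReal_ne_top,
              pathELength_eq_lintegral_mfderiv_Ioo]
            rfl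
        _ ≤ _ := by gcongr
    rw [hγ0, hγ1, ← ENNReal.ofReal_mul hC.le, ← ofReal_norm,
      ENNReal.ofReal_le_ofReal_iff (by positivity)] at hle2
    rwa [dist_comm, dist_eq_norm]
  refine le_of_forall_gt_imp_ge_of_dense fun a ha => ?_
  have h1 : dist x y < a / C := by rwa [lt_div_iff₀ hC, mul_comm]
  obtain ⟨l, hl1, hl2⟩ := exists_between (lt_min hxy h1)
  refine (key l hl1 (hl2.trans_le (min_le_left _ _))).trans ?_
  have := hl2.le.trans (min_le_right _ _)
  rwa [le_div_iff₀ hC, mul_comm] at this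

variable (n) in
/-- Inverse charts of a Riemannian manifold are locally Lipschitz. -/
theorem exists_lipschitz_extChartAt_symm (c : M) : ∃ r > 0, ∃ C ≥ 0,
    Metric.ball (extChartAt (𝓡 n) c c) r ⊆ (extChartAt (𝓡 n) c).target ∧
    ∀ z ∈ Metric.ball (extChartAt (𝓡 n) c c) r, ∀ w ∈ Metric.ball (extChartAt (𝓡 n) c c) r,
      dist ((extChartAt (𝓡 n) c).symm z) ((extChartAt (𝓡 n) c).symm w) ≤ C * dist z w := by
  obtain ⟨C, hC, hev⟩ := exists_norm_chartD_le (n := n) c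
  obtain ⟨ρ, hρ, hball⟩ := Metric.eventually_nhds_iff_ball.1
    (((tendsto_extChartAt_symm_self (n := n) c).eventually hev).and
      (extChartAt_target_mem_nhds (I := 𝓡 n) c))
  refine ⟨ρ, hρ, C, hC.le, fun z hz => (hball z hz).2, fun z hz w hw => ?_⟩
  set γ : ℝ → M := fun t => (extChartAt (𝓡 n) c).symm (z + t • (w - z)) with hγ
  have hmem : ∀ t ∈ Icc (0 : ℝ) 1, z + t • (w - z) ∈ Metric.ball (extChartAt (𝓡 n) c c) ρ := by
    intro t ht
    have := (convex_ball (extChartAt (𝓡 n) c c) ρ) hz hw (sub_nonneg.2 ht.2) ht.1 (by ring)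
    convert this using 1
    module
  have hγsmooth : ContMDiffOn 𝓘(ℝ, ℝ) (𝓡 n) 1 γ (Icc 0 1) := by
    refine (contMDiffOn_extChartAt_symm (I := 𝓡 n) (n := 1) c).comp ?_
      fun t ht => (hball _ (hmem t ht)).2
    rw [contMDiffOn_iff_contDiffOn]
    fun_prop
  have h1 := riemannianEDist_le_pathELength hγsmooth rfl rfl zero_le_one
  rw [← IsRiemannianManifold.out (I := 𝓡 n), pathELength_eq_lintegral_mfderiv_Ioo] at h1
  have h2 : ∫⁻ t in Ioo (0 : ℝ) 1, ‖velocity n γ t‖ₑ ≤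
      ∫⁻ _ in Ioo (0 : ℝ) 1, ENNReal.ofReal (C * dist z w) := by
    refine setLIntegral_mono' measurableSet_Ioo fun t ht => ?_
    have htar := (hball _ (hmem t (Ioo_subset_Icc_self ht))).2
    have hsrc : γ t ∈ (extChartAt (𝓡 n) c).source := (extChartAt (𝓡 n) c).map_target htar
    have hcont : ContinuousAt γ t :=
      (hγsmooth.continuousOn t (Ioo_subset_Icc_self ht)).continuousAt (Icc_mem_nhds ht.1 ht.2)
    have hd : HasDerivAt (fun s => extChartAt (𝓡 n) c (γ s)) (w - z) t := by
      have h0 : HasDerivAt (fun s : ℝ => z + s • (w - z)) (w - z) t := by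
        simpa using ((hasDerivAt_id t).smul_const (w - z)).const_add z
      refine h0.congr_of_eventuallyEq ?_
      filter_upwards [Ioo_mem_nhds ht.1 ht.2] with s hs
      exact (extChartAt (𝓡 n) c).right_inv (hball _ (hmem s (Ioo_subset_Icc_self hs))).2
    have hv := (hasVelocityAt_of_hasDerivAt hcont hsrc hd).velocity_eq
    rw [hv, ← ofReal_norm]
    refine ENNReal.ofReal_le_ofReal ?_
    rw [dist_comm, dist_eq_norm]
    exact (hball _ (hmem t (Ioo_subset_Icc_self ht))).1.2 (w - z)
  have h3 : edist (γ 0) (γ 1) ≤ ENNReal.ofReal (C * dist z w) := by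
    refine (h1.trans h2).trans ?_
    simp
  rw [edist_dist, ENNReal.ofReal_le_ofReal_iff (by positivity)] at h3
  simpa [hγ] using h3

end RiemannianDistance

/-! ### Actions of curves -/

section Action

variable {n : ℕ} {M : Type*} [MetricSpace M] [ChartedSpace (EuclideanSpace ℝ (Fin n)) M]
  [IsManifold (𝓡 n) ∞ M] [RiemannianBundle (fun x : M => TangentSpace (𝓡 n) x)]

variable {H : ∀ x : M, CotangentSpace n x → ℝ} {φ : M → ℝ}

theorem IsTonelli.neg_le_lagrangian (hH : IsTonelli H) (x : M) (v : TangentSpace (𝓡 n) x) :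
    -H x 0 ≤ lagrangian H x v := by
  have hbdd : BddAbove (range fun p : CotangentSpace n x => p v - H x p) := by
    obtain ⟨C, hC⟩ := hH.superlinear ‖v‖
    refine ⟨C, ?_⟩
    rintro _ ⟨p, rfl⟩
    have h1 := hC x p
    have h2 := (le_abs_self _).trans (p.le_opNorm v)
    simp only
    linarith [mul_comm ‖p‖ ‖v‖]
  have := le_ciSup hbdd 0
  simpa [lagrangian] using this

theorem IsTonelli.continuous_zero (hH : IsTonelli H) : Continuous fun x => H x 0 := by
  refine continuous_iff_continuousAt.2 fun c => ?_
  have h1 : ContinuousAt (fun w : EuclideanSpace ℝ (Fin n) × (EuclideanSpace ℝ (Fin n) →L[ℝ] ℝ) =>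
      localHam H c w.1 w.2) (extChartAt (𝓡 n) c c, 0) :=
    (hH.contDiffOn_localHam c).continuousOn.continuousAt
      (((isOpen_extChartAt_target (I := 𝓡 n) c).prod isOpen_univ).mem_nhds
        ⟨mem_extChartAt_target c, mem_univ _⟩)
  have h2 : ContinuousAt (fun y : M => (extChartAt (𝓡 n) c y,
      (0 : EuclideanSpace ℝ (Fin n) →L[ℝ] ℝ))) c :=
    (continuousAt_extChartAt (I := 𝓡 n) c).prodMk continuousAt_const
  refine (ContinuousAt.comp (f := fun y : M => (extChartAt (𝓡 n) c y,
      (0 : EuclideanSpace ℝ (Fin n) →L[ℝ] ℝ))) h1 h2).congr ?_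
  filter_upwards [extChartAt_source_mem_nhds (I := 𝓡 n) c] with y hy
  simp only [Function.comp_apply]
  rw [localHam_extChartAt hy, ContinuousLinearMap.zero_comp]

theorem IsTonelli.exists_neg_le_lagrangian [CompactSpace M] (hH : IsTonelli H) :
    ∃ C ≥ 0, ∀ (x : M) (v : TangentSpace (𝓡 n) x), -C ≤ lagrangian H x v := by
  obtain ⟨C, hC⟩ := isCompact_univ.exists_bound_of_continuousOn hH.continuous_zero.continuousOn
  refine ⟨max C 0, le_max_right _ _, fun x v => ?_⟩
  have h1 := (le_abs_self _).trans (hC x (mem_univ x))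
  linarith [hH.neg_le_lagrangian x v, le_max_left C 0]

/-- The set of actions of curves from `x` to `y` in time `t`. -/
def actions (H : ∀ x : M, CotangentSpace n x → ℝ) (t : ℝ) (x y : M) : Set ℝ :=
  {a : ℝ | ∃ ξ : ℝ → M, AbsolutelyContinuousOnInterval ξ 0 t ∧ ξ 0 = x ∧ ξ t = y ∧
    IntervalIntegrable (fun s => lagrangian H (ξ s) (velocity n ξ s)) volume 0 t ∧
    a = ∫ s in (0 : ℝ)..t, lagrangian H (ξ s) (velocity n ξ s)}

theorem neg_mul_le_of_mem_actions {C t : ℝ} {x y : M} (ht : 0 ≤ t)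
    (hC : ∀ (x : M) (v : TangentSpace (𝓡 n) x), -C ≤ lagrangian H x v) {a : ℝ}
    (ha : a ∈ actions H t x y) : -(C * t) ≤ a := by
  obtain ⟨ξ, -, -, -, hi, rfl⟩ := ha
  have := intervalIntegral.integral_mono_on ht intervalIntegrable_const hi
    (fun s _ => hC (ξ s) (velocity n ξ s))
  simp only [intervalIntegral.integral_const, sub_zero, smul_eq_mul] at this
  linarith

theorem fundamentalSolution_le {C t : ℝ} {x y : M} (ht : 0 ≤ t)
    (hC : ∀ (x : M) (v : TangentSpace (𝓡 n) x), -C ≤ lagrangian H x v) {a : ℝ}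
    (ha : a ∈ actions H t x y) : fundamentalSolution H t x y ≤ a :=
  csInf_le ⟨_, fun _ hb => neg_mul_le_of_mem_actions ht hC hb⟩ ha

variable [IsContMDiffRiemannianBundle (𝓡 n) ∞ (EuclideanSpace ℝ (Fin n))
      (fun x : M => TangentSpace (𝓡 n) x)]

/-- In a chart the Legendre transform is Lipschitz on bounded sets of velocities, and a C¹ curve has
continuous velocity there. In particular C¹ curves satisfy the integrability requirement in the
definition of the action. -/
theorem IsTonelli.continuous_lagrangian_velocity (hH : IsTonelli H) {ξ : ℝ → M}
    (hξ : ContMDiff 𝓘(ℝ, ℝ) (𝓡 n) 1 ξ) :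
    Continuous fun s => lagrangian H (ξ s) (velocity n ξ s) := by
  refine continuous_iff_continuousAt.2 fun s₀ => ?_
  set c := ξ s₀ with hc
  obtain ⟨R, hR, hRt, hloc⟩ := hH.exists_isLocalTonelli c
  have hL := hloc.isLocalLagrangian Metric.isOpen_ball
    (isCompact_closedBall (extChartAt (𝓡 n) c c) (R / 2)) (convex_closedBall _ _)
    (Metric.closedBall_subset_ball (by linarith))
  set N := ξ ⁻¹' (extChartAt (𝓡 n) c).source
  have hNo : IsOpen N := (isOpen_extChartAt_source (I := 𝓡 n) c).preimage hξ.continuous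
  have hN : s₀ ∈ N := mem_extChartAt_source (I := 𝓡 n) c
  set g : ℝ → EuclideanSpace ℝ (Fin n) := fun s => extChartAt (𝓡 n) c (ξ s) with hg
  have hgC : ContDiffOn ℝ 1 g N := by
    rw [← contMDiffOn_iff_contDiffOn]
    exact (contMDiffOn_extChartAt (I := 𝓡 n) (n := 1) (x := c)).comp hξ.contMDiffOn
      fun t (ht : ξ t ∈ (extChartAt (𝓡 n) c).source) => by simpa using ht
  have hg1 : ContinuousAt g s₀ := hgC.continuousOn.continuousAt (hNo.mem_nhds hN)
  have hg2 : ContinuousAt (deriv g) s₀ :=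
    (hgC.continuousOn_deriv_of_isOpen hNo le_rfl).continuousAt (hNo.mem_nhds hN)
  have hLc : ContinuousAt (fun w : EuclideanSpace ℝ (Fin n) × EuclideanSpace ℝ (Fin n) =>
      legendre (localHam H c) w.1 w.2) (g s₀, deriv g s₀) := by
    refine (hL.continuousOn (‖deriv g s₀‖ + 1)).continuousAt (prod_mem_nhds ?_ ?_)
    · exact Metric.closedBall_mem_nhds _ (by positivity)
    · refine mem_of_superset (Metric.ball_mem_nhds (deriv g s₀) one_pos) fun w hw => ?_
      rw [mem_closedBall_zero_iff]
      rw [mem_ball_iff_norm] at hw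
      have := norm_le_insert' w (deriv g s₀)
      linarith
  refine (ContinuousAt.comp (f := fun s => (g s, deriv g s)) hLc (hg1.prodMk hg2)).congr ?_
  filter_upwards [hNo.mem_nhds hN] with s hs
  have hv := hasVelocityAt_velocity ((hξ.mdifferentiable one_ne_zero) s)
  simp only [Function.comp_apply]
  rw [(hv.hasDerivAt hs).deriv, lagrangian_eq_legendre hs]

variable [IsRiemannianManifold (𝓡 n) M]

/-- A curve that is Lipschitz in a chart is Lipschitz. -/
theorem exists_lipschitzOnWith_of_extChartAt {ξ : ℝ → M} {S : Set ℝ} {t : ℝ}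
    (hξ : ContinuousWithinAt ξ S t) {K : ℝ≥0} {U : Set ℝ} (hU : U ∈ 𝓝[S] t)
    (hK : LipschitzOnWith K (fun s => extChartAt (𝓡 n) (ξ t) (ξ s)) U) :
    ∃ K' : ℝ≥0, ∃ V ∈ 𝓝[S] t, LipschitzOnWith K' ξ V := by
  obtain ⟨r, hr, C, hC, htar, hlip⟩ := exists_lipschitz_extChartAt_symm n (ξ t)
  have h1 : ∀ᶠ s in 𝓝[S] t, ξ s ∈ (extChartAt (𝓡 n) (ξ t)).source :=
    hξ (extChartAt_source_mem_nhds (I := 𝓡 n) (ξ t))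
  have h2 : ∀ᶠ s in 𝓝[S] t, extChartAt (𝓡 n) (ξ t) (ξ s) ∈
      Metric.ball (extChartAt (𝓡 n) (ξ t) (ξ t)) r :=
    ((continuousAt_extChartAt (I := 𝓡 n) (ξ t)).tendsto.comp hξ) (Metric.ball_mem_nhds _ hr)
  refine ⟨C.toNNReal * K, _, inter_mem hU (inter_mem h1 h2), ?_⟩
  refine LipschitzOnWith.of_dist_le_mul fun a ha b hb => ?_
  have h3 := hlip _ ha.2.2 _ hb.2.2
  rw [(extChartAt (𝓡 n) (ξ t)).left_inv ha.2.1, (extChartAt (𝓡 n) (ξ t)).left_inv hb.2.1] at h3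
  have h4 := hK.dist_le_mul a ha.1 b hb.1
  rw [NNReal.coe_mul, Real.coe_toNNReal C hC, mul_assoc]
  exact h3.trans (mul_le_mul_of_nonneg_left h4 hC)

/-- The infimum of an empty set of reals is 0 by convention, so lower bounds on actions transfer to
`fundamentalSolution` only if some curve exists. The distance on M is finite and Riemannian, which
provides a C¹ curve between any two points. -/
theorem nonempty_actions (hH : IsTonelli H) {t : ℝ} (ht : 0 < t) (x y : M) :
    (actions H t x y).Nonempty := by
  have hlt : riemannianEDist (𝓡 n) x y < ⊤ := by
    rw [← IsRiemannianManifold.out (I := 𝓡 n) x y]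
    exact edist_lt_top x y
  obtain ⟨γ, hγ0, hγ1, hγ, -, -⟩ := exists_lt_locally_constant_of_riemannianEDist_lt hlt ht
  have hloc : LocallyLipschitzOn (Icc 0 t) γ := by
    intro s hs
    have hN : γ ⁻¹' (extChartAt (𝓡 n) (γ s)).source ∈ 𝓝 s :=
      hγ.continuous.continuousAt (extChartAt_source_mem_nhds (I := 𝓡 n) (γ s))
    have hg : ContDiffAt ℝ 1 (fun σ => extChartAt (𝓡 n) (γ s) (γ σ)) s := by
      rw [← contMDiffAt_iff_contDiffAt]
      exact (contMDiffAt_extChartAt (I := 𝓡 n) (n := 1) (x := γ s)).comp s hγ.contMDiffAt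
    obtain ⟨K, U, hU, hK⟩ := hg.exists_lipschitzOnWith
    exact exists_lipschitzOnWith_of_extChartAt hγ.continuous.continuousWithinAt
      (mem_nhdsWithin_of_mem_nhds hU) hK
  obtain ⟨K, hK⟩ := hloc.exists_lipschitzOnWith_of_compact isCompact_Icc
  refine ⟨_, γ, ?_, hγ0, hγ1, (hH.continuous_lagrangian_velocity hγ).intervalIntegrable _ _, rfl⟩
  rw [← uIcc_of_le ht.le] at hK
  exact hK.absolutelyContinuousOnInterval

end Action

/-! ### Semiconcave functions in charts -/

section SemiconcaveData

variable {n : ℕ} {M : Type*} [MetricSpace M] [ChartedSpace (EuclideanSpace ℝ (Fin n)) M]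

/-- A semiconcave function is, in a chart, Lipschitz with bounded second differences. -/
theorem IsSemiconcave.exists_local {φ : M → ℝ} (hφ : IsSemiconcave n φ) (c : M) :
    ∃ r > 0, ∃ C ≥ 0, ∀ R, 0 < R → R < r → ∃ Λ ≥ 0,
      (∀ y ∈ Metric.closedBall (extChartAt (𝓡 n) c c) R,
        ∀ y' ∈ Metric.closedBall (extChartAt (𝓡 n) c c) R,
        |φ ((extChartAt (𝓡 n) c).symm y) - φ ((extChartAt (𝓡 n) c).symm y')| ≤ Λ * ‖y - y'‖) ∧
      ∀ y h, y + h ∈ Metric.closedBall (extChartAt (𝓡 n) c c) R →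
        y - h ∈ Metric.closedBall (extChartAt (𝓡 n) c c) R →
        φ ((extChartAt (𝓡 n) c).symm (y + h)) + φ ((extChartAt (𝓡 n) c).symm (y - h))
          - 2 * φ ((extChartAt (𝓡 n) c).symm y) ≤ C * ‖h‖ ^ 2 := by
  obtain ⟨-, hφ⟩ := hφ
  obtain ⟨C, hC, r, hr, -, h⟩ := hφ c
  refine ⟨r, hr, C, hC, fun R hR hRr => ?_⟩
  set z₀ := extChartAt (𝓡 n) c c with hz₀
  set f : EuclideanSpace ℝ (Fin n) → ℝ := fun z => φ ((extChartAt (𝓡 n) c).symm z) with hf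
  have hsub : Metric.closedBall z₀ R ⊆ Metric.ball z₀ r := Metric.closedBall_subset_ball hRr
  -- Subtracting C/2 ‖z‖² turns semiconcavity into concavity, and concave functions are locally
  -- Lipschitz in the interior of their domain.
  have hconc : ConcaveOn ℝ (Metric.ball z₀ r) fun z => f z - C / 2 * ‖z‖ ^ 2 := by
    refine ⟨convex_ball _ _, fun z hz w hw a b ha hb hab => ?_⟩
    obtain rfl : b = 1 - a := by linarith
    have h1 := h z hz w hw a ⟨ha, by linarith⟩
    have h2 : ‖a • z + (1 - a) • w‖ ^ 2 = a * ‖z‖ ^ 2 + (1 - a) * ‖w‖ ^ 2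
        - a * (1 - a) * ‖z - w‖ ^ 2 := by
      rw [norm_add_sq_real, norm_sub_sq_real, norm_smul, norm_smul, inner_smul_left,
        inner_smul_right]
      simp only [Real.norm_eq_abs, mul_pow, sq_abs, RCLike.conj_to_real]
      ring
    simp only [smul_eq_mul, h2]
    simp only [hf]
    linarith
  have hlocl := (hconc.locallyLipschitzOn Metric.isOpen_ball).mono hsub
  obtain ⟨K, hK⟩ := hlocl.exists_lipschitzOnWith_of_compact (isCompact_closedBall _ _)
  refine ⟨K + C / 2 * (2 * (‖z₀‖ + R)), by positivity, fun y hy y' hy' => ?_, fun y k hy hk => ?_⟩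
  · have h1 := hK.dist_le_mul y hy y' hy'
    rw [Real.dist_eq, dist_eq_norm] at h1
    have hn : ∀ w ∈ Metric.closedBall z₀ R, ‖w‖ ≤ ‖z₀‖ + R := fun w hw => by
      rw [mem_closedBall_iff_norm] at hw
      linarith [norm_le_insert' w z₀]
    have h2 : |‖y‖ ^ 2 - ‖y'‖ ^ 2| ≤ 2 * (‖z₀‖ + R) * ‖y - y'‖ := by
      rw [sq_sub_sq, abs_mul, abs_of_nonneg (by positivity)]
      refine mul_le_mul ?_ (abs_norm_sub_norm_le _ _) (abs_nonneg _) (by positivity)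
      linarith [hn y hy, hn y' hy']
    have e : f y - f y' = ((f y - C / 2 * ‖y‖ ^ 2) - (f y' - C / 2 * ‖y'‖ ^ 2))
        + C / 2 * (‖y‖ ^ 2 - ‖y'‖ ^ 2) := by ring
    calc |f y - f y'| ≤ |(f y - C / 2 * ‖y‖ ^ 2) - (f y' - C / 2 * ‖y'‖ ^ 2)|
        + |C / 2 * (‖y‖ ^ 2 - ‖y'‖ ^ 2)| := by rw [e]; exact abs_add_le _ _
      _ ≤ K * ‖y - y'‖ + C / 2 * (2 * (‖z₀‖ + R) * ‖y - y'‖) := by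
          rw [abs_mul, abs_of_nonneg (by positivity : 0 ≤ C / 2)]
          gcongr
      _ = _ := by ring
  · have h1 := h (y + k) (hsub hy) (y - k) (hsub hk) (1 / 2) ⟨by norm_num, by norm_num⟩
    have e1 : (1 / 2 : ℝ) • (y + k) + (1 - 1 / 2 : ℝ) • (y - k) = y := by module
    have e2 : y + k - (y - k) = (2 : ℝ) • k := by module
    rw [e1, e2, norm_smul, mul_pow, Real.norm_ofNat] at h1
    linarith

end SemiconcaveData

/-! ### Short-time regularity of the Lax-Oleinik operator -/

section LaxOleinik

variable {n : ℕ} {M : Type*} [MetricSpace M] [ChartedSpace (EuclideanSpace ℝ (Fin n)) M]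
  [IsManifold (𝓡 n) ∞ M]

/-- For values in a metric space, continuity at t follows from the real case applied to the distance
to f(t). -/
theorem AbsolutelyContinuousOnInterval.continuousOn_Icc {X : Type*} [PseudoMetricSpace X]
    {f : ℝ → X} {s : ℝ} (hs : 0 ≤ s) (hf : AbsolutelyContinuousOnInterval f 0 s) :
    ContinuousOn f (Icc 0 s) := by
  intro t ht
  have h1 : AbsolutelyContinuousOnInterval (fun σ => dist (f σ) (f t)) 0 s := by
    refine AbsolutelyContinuousOnInterval.of_dist_le (A := 1) (C := 0) hf fun x _ y _ => ?_
    simpa [Real.dist_eq] using abs_dist_sub_le (f x) (f y) (f t)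
  have h2 := h1.continuousOn
  rw [uIcc_of_le hs] at h2
  have h3 := h2 t ht
  rw [ContinuousWithinAt, dist_self] at h3
  exact tendsto_iff_dist_tendsto_zero.2 h3

/-- A continuous curve that starts in a chart ball either stays in it or reaches its boundary. -/
theorem exists_exit_time {ξ : ℝ → M} {c : M} {s r : ℝ} (hs : 0 ≤ s)
    (hξ : ContinuousOn ξ (Icc 0 s))
    (hr : Metric.closedBall (extChartAt (𝓡 n) c c) r ⊆ (extChartAt (𝓡 n) c).target)
    (h0 : ξ 0 ∈ (extChartAt (𝓡 n) c).source)
    (h0' : extChartAt (𝓡 n) c (ξ 0) ∈ Metric.ball (extChartAt (𝓡 n) c c) r) :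
    ∃ τ ∈ Icc 0 s, (∀ σ ∈ Icc 0 τ, ξ σ ∈ (extChartAt (𝓡 n) c).source ∧
      extChartAt (𝓡 n) c (ξ σ) ∈ Metric.closedBall (extChartAt (𝓡 n) c c) r) ∧
      (τ = s ∨ r ≤ dist (extChartAt (𝓡 n) c (ξ τ)) (extChartAt (𝓡 n) c c)) := by
  set z₀ := extChartAt (𝓡 n) c c with hz₀
  set O : Set M := (extChartAt (𝓡 n) c).source ∩ extChartAt (𝓡 n) c ⁻¹' Metric.ball z₀ r with hO
  have hOo : IsOpen O := (continuousOn_extChartAt (I := 𝓡 n) c).isOpen_inter_preimage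
    (isOpen_extChartAt_source (I := 𝓡 n) c) Metric.isOpen_ball
  -- N is compact, hence closed in M. At the first time outside the open set O the curve is
  -- therefore still in N, so in the chart domain, where its exit distance makes sense.
  set N : Set M := (extChartAt (𝓡 n) c).symm '' Metric.closedBall z₀ r with hN
  have hNc : IsClosed N := ((isCompact_closedBall z₀ r).image_of_continuousOn
    ((continuousOn_extChartAt_symm (I := 𝓡 n) c).mono hr)).isClosed
  have hON : O ⊆ N := fun y hy => ⟨extChartAt (𝓡 n) c y, Metric.ball_subset_closedBall hy.2,
    (extChartAt (𝓡 n) c).left_inv hy.1⟩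
  have hNmem : ∀ y ∈ N, y ∈ (extChartAt (𝓡 n) c).source ∧
      extChartAt (𝓡 n) c y ∈ Metric.closedBall z₀ r := by
    rintro _ ⟨z, hz, rfl⟩
    refine ⟨(extChartAt (𝓡 n) c).map_target (hr hz), ?_⟩
    rwa [(extChartAt (𝓡 n) c).right_inv (hr hz)]
  by_cases hall : ∀ σ ∈ Icc 0 s, ξ σ ∈ O
  · exact ⟨s, right_mem_Icc.2 hs, fun σ hσ => hNmem _ (hON (hall σ hσ)), Or.inl rfl⟩
  push Not at hall
  have hcl : IsCompact (Icc 0 s ∩ ξ ⁻¹' Oᶜ) :=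
    isCompact_Icc.of_isClosed_subset (hξ.preimage_isClosed_of_isClosed isClosed_Icc
      hOo.isClosed_compl) inter_subset_left
  obtain ⟨τ, ⟨hτ, hτO⟩, hmin⟩ := hcl.exists_isLeast (by
    obtain ⟨σ, hσ, hσO⟩ := hall
    exact ⟨σ, hσ, hσO⟩)
  have hlt : ∀ σ ∈ Ico 0 τ, ξ σ ∈ O := by
    intro σ hσ
    by_contra hcon
    exact absurd (hmin ⟨⟨hσ.1, hσ.2.le.trans hτ.2⟩, hcon⟩) (not_le.2 hσ.2)
  have hτ0 : 0 < τ := by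
    rcases hτ.1.eq_or_lt with h | h
    · rw [← h] at hτO
      exact absurd ⟨h0, h0'⟩ hτO
    · exact h
  have hτN : ξ τ ∈ N := by
    have hc : ContinuousWithinAt ξ (Ico 0 τ) τ :=
      (hξ τ hτ).mono fun σ hσ => ⟨hσ.1, hσ.2.le.trans hτ.2⟩
    have hcl : τ ∈ closure (Ico 0 τ) := by
      rw [closure_Ico hτ0.ne]
      exact right_mem_Icc.2 hτ0.le
    have := hc.mem_closure_image hcl
    refine hNc.closure_subset_iff.2 ?_ this
    rintro _ ⟨σ, hσ, rfl⟩
    exact hON (hlt σ hσ)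
  refine ⟨τ, hτ, fun σ hσ => hNmem _ ?_, Or.inr ?_⟩
  · rcases hσ.2.eq_or_lt with h | h
    · rwa [h]
    · exact hON (hlt σ ⟨hσ.1, h⟩)
  · by_contra hcon
    exact hτO ⟨(hNmem _ hτN).1, not_le.1 hcon⟩

/-- An absolutely continuous curve in the domain of a Lipschitz chart has, almost everywhere, a
velocity, which is that of its expression in the chart. -/
theorem absolutelyContinuous_extChartAt {H : ∀ x : M, CotangentSpace n x → ℝ} {ξ : ℝ → M} {c : M}
    {r C τ : ℝ} (hτ : 0 ≤ τ) (hsrc : Metric.ball c r ⊆ (extChartAt (𝓡 n) c).source)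
    (hlip : ∀ x ∈ Metric.ball c r, ∀ y ∈ Metric.ball c r,
      dist (extChartAt (𝓡 n) c x) (extChartAt (𝓡 n) c y) ≤ C * dist x y)
    (hξ : AbsolutelyContinuousOnInterval ξ 0 τ) (hmem : ∀ σ ∈ Icc 0 τ, ξ σ ∈ Metric.ball c r) :
    AbsolutelyContinuousOnInterval (fun σ => extChartAt (𝓡 n) c (ξ σ)) 0 τ ∧
    ∀ᵐ σ : ℝ, σ ∈ Ioo 0 τ → ∃ w, HasDerivAt (fun σ => extChartAt (𝓡 n) c (ξ σ)) w σ ∧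
      lagrangian H (ξ σ) (velocity n ξ σ)
        = legendre (localHam H c) (extChartAt (𝓡 n) c (ξ σ)) w := by
  have hac : AbsolutelyContinuousOnInterval (fun σ => extChartAt (𝓡 n) c (ξ σ)) 0 τ := by
    refine AbsolutelyContinuousOnInterval.of_dist_le (A := C) (C := 0) hξ fun x hx y hy => ?_
    rw [uIcc_of_le hτ] at hx hy
    simpa using hlip _ (hmem x hx) _ (hmem y hy)
  refine ⟨hac, ?_⟩
  filter_upwards [hac.boundedVariationOn.ae_differentiableAt_of_mem_uIcc] with σ hσ hσI
  have hd := (hσ (by rw [uIcc_of_le hτ]; exact Ioo_subset_Icc_self hσI)).hasDerivAt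
  refine ⟨_, hd, ?_⟩
  have hs : ξ σ ∈ (extChartAt (𝓡 n) c).source := hsrc (hmem σ (Ioo_subset_Icc_self hσI))
  have hc : ContinuousAt ξ σ :=
    (AbsolutelyContinuousOnInterval.continuousOn_Icc hτ hξ).continuousAt
      (Icc_mem_nhds hσI.1 hσI.2)
  have hv := hasVelocityAt_of_hasDerivAt hc hs hd
  rw [hv.velocity_eq, lagrangian_eq_legendre hs, chartD_chartDinv hs]

variable [RiemannianBundle (fun x : M => TangentSpace (𝓡 n) x)] [CompactSpace M]
variable {H : ∀ x : M, CotangentSpace n x → ℝ} {φ : M → ℝ}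
  [IsContMDiffRiemannianBundle (𝓡 n) ∞ (EuclideanSpace ℝ (Fin n))
      (fun x : M => TangentSpace (𝓡 n) x)] [IsRiemannianManifold (𝓡 n) M]

/-- The supremum defining T⁺_t φ is meaningful only if bounded above: φ is bounded on the compact M
and actions are at least -Ct. -/
theorem sub_le_laxOleinikPos (hH : IsTonelli H) (hφ : Continuous φ) {t : ℝ} (ht : 0 < t)
    {x y : M} {a : ℝ} (ha : a ∈ actions H t x y) : φ y - a ≤ laxOleinikPos H t φ x := by
  obtain ⟨C, -, hC⟩ := hH.exists_neg_le_lagrangian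
  obtain ⟨B, hB⟩ := isCompact_univ.exists_bound_of_continuousOn hφ.continuousOn
  have hbdd : BddAbove (range fun y => φ y - fundamentalSolution H t x y) := by
    refine ⟨B + C * t, ?_⟩
    rintro _ ⟨y', rfl⟩
    have h1 : -(C * t) ≤ fundamentalSolution H t x y' :=
      le_csInf (nonempty_actions hH ht x y') fun b hb => neg_mul_le_of_mem_actions ht.le hC hb
    have h2 := (le_abs_self _).trans (hB y' (mem_univ _))
    simp only
    linarith
  have h1 := le_ciSup hbdd y
  have h2 := fundamentalSolution_le ht.le hC ha
  rw [laxOleinikPos]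
  linarith

theorem laxOleinikPos_le (hH : IsTonelli H) {t : ℝ} (ht : 0 < t) {x : M} {b : ℝ}
    (h : ∀ y, ∀ a ∈ actions H t x y, φ y - a ≤ b) : laxOleinikPos H t φ x ≤ b := by
  have : Nonempty M := ⟨x⟩
  refine ciSup_le fun y => ?_
  have : φ y - b ≤ fundamentalSolution H t x y :=
    le_csInf (nonempty_actions hH ht x y) fun a ha => by linarith [h y a ha]
  linarith

/-- Every control in a chart gives a lower bound for the Lax-Oleinik operator. -/
theorem payoff_le_laxOleinikPos (hH : IsTonelli H) (hφ : Continuous φ) {c : M}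
    {R Λ₀ Cφ K s C : ℝ} (hs : 0 < s)
    (hd : IsLocalData (legendre (localHam H c)) (fun z => φ ((extChartAt (𝓡 n) c).symm z))
      (extChartAt (𝓡 n) c c) R Λ₀ Cφ)
    (htar : Metric.closedBall (extChartAt (𝓡 n) c c) R ⊆ (extChartAt (𝓡 n) c).target)
    (hlip : ∀ z ∈ Metric.closedBall (extChartAt (𝓡 n) c c) R,
      ∀ w ∈ Metric.closedBall (extChartAt (𝓡 n) c c) R,
      dist ((extChartAt (𝓡 n) c).symm z) ((extChartAt (𝓡 n) c).symm w) ≤ C * dist z w)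
    {z : EuclideanSpace ℝ (Fin n)} (hz : dist z (extChartAt (𝓡 n) c c) + K * s ≤ R)
    {v : ℝ → EuclideanSpace ℝ (Fin n)} (hv : IsControl K v) :
    payoff (legendre (localHam H c)) (fun z => φ ((extChartAt (𝓡 n) c).symm z)) s z v
      ≤ laxOleinikPos H s φ ((extChartAt (𝓡 n) c).symm z) := by
  set ξ : ℝ → M := fun σ => (extChartAt (𝓡 n) c).symm (trajectory z v σ) with hξ
  have hmem : ∀ σ ∈ Icc 0 s, trajectory z v σ ∈ Metric.closedBall (extChartAt (𝓡 n) c c) R :=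
    fun σ hσ => hv.trajectory_mem hz hσ
  have hac : AbsolutelyContinuousOnInterval ξ 0 s := by
    have h0 : AbsolutelyContinuousOnInterval (trajectory z v) 0 s :=
      ((hv.lipschitz_trajectory z).lipschitzOnWith (s := uIcc 0 s)).absolutelyContinuousOnInterval
    refine AbsolutelyContinuousOnInterval.of_dist_le (A := C) (C := 0) h0 fun x hx y hy => ?_
    rw [uIcc_of_le hs.le] at hx hy
    rw [zero_mul, add_zero]
    exact hlip _ (hmem x hx) _ (hmem y hy)
  have hcont : ContinuousOn ξ (Icc 0 s) :=
    AbsolutelyContinuousOnInterval.continuousOn_Icc hs.le hac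
  have hL : ∀ᵐ σ : ℝ, σ ∈ Ioo 0 s → legendre (localHam H c) (trajectory z v σ) (v σ)
      = lagrangian H (ξ σ) (velocity n ξ σ) := by
    filter_upwards [hv.ae_hasDerivAt_trajectory z hs.le] with σ hσ hσI
    have hd := hσ (Ioo_subset_Icc_self hσI)
    have htarσ := htar (hmem σ (Ioo_subset_Icc_self hσI))
    have hsrc : ξ σ ∈ (extChartAt (𝓡 n) c).source := (extChartAt (𝓡 n) c).map_target htarσ
    have hd' : HasDerivAt (fun σ => extChartAt (𝓡 n) c (ξ σ)) (v σ) σ := by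
      refine hd.congr_of_eventuallyEq ?_
      filter_upwards [Ioo_mem_nhds hσI.1 hσI.2] with σ' hσ'
      exact (extChartAt (𝓡 n) c).right_inv (htar (hmem σ' (Ioo_subset_Icc_self hσ')))
    have hvel := hasVelocityAt_of_hasDerivAt
      (hcont.continuousAt (Icc_mem_nhds hσI.1 hσI.2)) hsrc hd'
    rw [hvel.velocity_eq, lagrangian_eq_legendre hsrc, chartD_chartDinv hsrc,
      (extChartAt (𝓡 n) c).right_inv htarσ]
  have hae : (fun σ => legendre (localHam H c) (trajectory z v σ) (v σ))
      =ᵐ[volume.restrict (uIoc 0 s)] fun σ => lagrangian H (ξ σ) (velocity n ξ σ) := by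
    rw [uIoc_of_le hs.le, Measure.restrict_congr_set Ioo_ae_eq_Ioc.symm]
    exact (ae_restrict_iff' measurableSet_Ioo).2 hL
  have hint := (hd.integrable_action hv hz (left_mem_Icc.2 hs.le) (right_mem_Icc.2 hs.le)).congr_ae
    hae
  have ha : (∫ σ in (0 : ℝ)..s, lagrangian H (ξ σ) (velocity n ξ σ)) ∈
      actions H s ((extChartAt (𝓡 n) c).symm z) (ξ s) := by
    refine ⟨ξ, hac, ?_, rfl, hint, rfl⟩
    simp [hξ, trajectory]
  have := sub_le_laxOleinikPos hH hφ hs ha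
  rw [payoff, intervalIntegral.integral_congr_ae_restrict hae]
  exact this

/-- Near every point and for short times, `T⁺_s φ` is differentiable, and in the chart its
differential is bounded and gives a quadratic upper bound, uniformly in `s`. -/
theorem exists_laxOleinikPos_regularity (hH : IsTonelli H) (hφ : IsSemiconcave n φ) (c : M) :
    ∃ r > 0, ∃ s₀ > 0, ∃ C ≥ 0,
      Metric.ball (extChartAt (𝓡 n) c c) r ⊆ (extChartAt (𝓡 n) c).target ∧
      ∀ s, 0 < s → s ≤ s₀ →
      (∀ z ∈ Metric.ball (extChartAt (𝓡 n) c c) r,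
        |laxOleinikPos H s φ ((extChartAt (𝓡 n) c).symm z)
          - φ ((extChartAt (𝓡 n) c).symm z)| ≤ C * s) ∧
      ∀ z ∈ Metric.ball (extChartAt (𝓡 n) c c) r, ∃ P : EuclideanSpace ℝ (Fin n) →L[ℝ] ℝ,
        HasFDerivAt (fun z => laxOleinikPos H s φ ((extChartAt (𝓡 n) c).symm z)) P z ∧
        ‖P‖ ≤ C ∧ ∀ y ∈ Metric.ball (extChartAt (𝓡 n) c c) r,
          laxOleinikPos H s φ ((extChartAt (𝓡 n) c).symm y) ≤
            laxOleinikPos H s φ ((extChartAt (𝓡 n) c).symm z) + P (y - z) + C * ‖y - z‖ ^ 2 := by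
  obtain ⟨R₁, hR₁, hR₁t, hton⟩ := hH.exists_isLocalTonelli c
  obtain ⟨R₂, hR₂, Cφ, hCφ, hsemi⟩ := hφ.exists_local c
  obtain ⟨R₃, hR₃, C₃, hC₃, -, hsymm⟩ := exists_lipschitz_extChartAt_symm n c
  obtain ⟨ρ, hρ, C₄, hC₄, hρs, hchart⟩ := exists_lipschitz_extChartAt n c
  obtain ⟨R₄, hR₄, hR₄b⟩ := Metric.eventually_nhds_iff_ball.1
    ((tendsto_extChartAt_symm_self (n := n) c).eventually (Metric.ball_mem_nhds c hρ))
  obtain ⟨C_L, hC_L, hlow⟩ := hH.exists_neg_le_lagrangian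
  obtain ⟨B, hB⟩ := isCompact_univ.exists_bound_of_continuousOn hφ.1.continuousOn
  have hB0 : 0 ≤ B := (norm_nonneg _).trans (hB c (mem_univ _))
  set z₀ := extChartAt (𝓡 n) c c with hz₀
  set e := extChartAt (𝓡 n) c with he
  set f : EuclideanSpace ℝ (Fin n) → ℝ := fun z => φ (e.symm z) with hf
  set L := legendre (localHam H c) with hL
  set R := min (min R₁ R₂) (min R₃ R₄) / 2 with hRdef
  have hRpos : 0 < R := by positivity
  have hm : 2 * R = min (min R₁ R₂) (min R₃ R₄) := by rw [hRdef]; ring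
  have hRR₁ : R < R₁ := by
    have := (min_le_left (min R₁ R₂) (min R₃ R₄)).trans (min_le_left _ _); linarith
  have hRR₂ : R < R₂ := by
    have := (min_le_left (min R₁ R₂) (min R₃ R₄)).trans (min_le_right _ _); linarith
  have hRR₃ : R < R₃ := by
    have := (min_le_right (min R₁ R₂) (min R₃ R₄)).trans (min_le_left _ _); linarith
  have hRR₄ : R < R₄ := by
    have := (min_le_right (min R₁ R₂) (min R₃ R₄)).trans (min_le_right _ _); linarith
  have htar : Metric.closedBall z₀ R ⊆ e.target :=
    (Metric.closedBall_subset_ball hRR₁).trans hR₁t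
  obtain ⟨Λ₀, hΛ₀, hlipφ, hscφ⟩ := hsemi R hRpos hRR₂
  have hd : IsLocalData L f z₀ R Λ₀ Cφ :=
    ⟨hton.isLocalLagrangian Metric.isOpen_ball (isCompact_closedBall _ _) (convex_closedBall _ _)
      (Metric.closedBall_subset_ball hRR₁), hΛ₀, hCφ, hlipφ, hscφ⟩
  obtain ⟨K, hK, s₁, hs₁, C, hC, hKs, hreg⟩ := hd.exists_regularity hRpos
  -- A curve from the ball of radius R/8 that reaches radius R/2 travels at least 3R/8 in the chart.
  -- This slope makes its action at least 2B + 1 minus O(s), so its payoff is at most -B - 1 + O(s),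
  -- whereas the value is at least -B - Cs; the bound on s₀ decides the comparison.
  set Λ := (2 * B + 1) * 8 / (3 * R) with hΛ
  have hΛ0 : 0 ≤ Λ := by positivity
  obtain ⟨CΛ, hCΛ, hsup⟩ := hd.lagrangian.superlinear Λ
  set s₀ := min s₁ (1 / (CΛ + C_L + C + 1)) with hs₀
  have hs₀pos : 0 < s₀ := by positivity
  have hvalue : ∀ s, 0 < s → s ≤ s₀ → ∀ z ∈ Metric.ball z₀ (R / 8),
      laxOleinikPos H s φ (e.symm z) = value L f K s z := by
    intro s hs hss z hz
    have hss₁ : s ≤ s₁ := hss.trans (min_le_left _ _)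
    obtain ⟨hver, hval, -⟩ := hreg s hs hss₁
    have hz' : dist z z₀ < R / 8 := hz
    have hKs' : K * s ≤ R / 8 := by nlinarith
    have hztar : z ∈ e.target := htar (by rw [Metric.mem_closedBall]; linarith)
    refine le_antisymm (laxOleinikPos_le hH hs fun y a ha => ?_) (value_le hK fun v hv => ?_)
    · obtain ⟨ξ, hξ, hξ0, hξs, hint, rfl⟩ := ha
      have hξc : ContinuousOn ξ (Icc 0 s) :=
        AbsolutelyContinuousOnInterval.continuousOn_Icc hs.le hξ
      have hez : e (ξ 0) = z := by rw [hξ0, e.right_inv hztar]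
      have hhalf : Metric.closedBall z₀ (R / 2) ⊆ Metric.closedBall z₀ R :=
        Metric.closedBall_subset_closedBall (by linarith)
      -- Either the curve stays in the half ball and verification applies, or it leaves at time τ,
      -- and its action is split there: superlinearity in the chart before τ, only the global lower
      -- bound on L afterwards.
      obtain ⟨τ, hτ, hin, hexit⟩ := exists_exit_time (c := c) (r := R / 2) hs.le hξc
        (hhalf.trans htar) (by rw [hξ0]; exact e.map_target hztar)
        (by rw [← he, hez, Metric.mem_ball]; linarith)
      have hball : ∀ σ ∈ Icc 0 τ, ξ σ ∈ Metric.ball c ρ := by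
        intro σ hσ
        have h1 := hR₄b (e (ξ σ)) (Metric.closedBall_subset_ball hRR₄ (hhalf (hin σ hσ).2))
        rwa [e.left_inv (hin σ hσ).1] at h1
      have hsubτ : uIcc 0 τ ⊆ uIcc 0 s := by
        rw [uIcc_of_le hτ.1, uIcc_of_le hs.le]
        exact Icc_subset_Icc_right hτ.2
      obtain ⟨hac, hae⟩ := absolutelyContinuous_extChartAt (H := H) hτ.1 hρs hchart
        (hξ.mono hsubτ) hball
      rcases hexit with rfl | hexit
      · have := hver (fun σ => e (ξ σ)) _ hac (fun σ hσ => (hin σ hσ).2) hint (by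
          filter_upwards [hae] with σ hσ hσI
          obtain ⟨w, hw, heq⟩ := hσ hσI
          exact ⟨w, hw, heq.ge⟩)
        simp only [hf] at this
        rwa [e.left_inv (hin _ (right_mem_Icc.2 hτ.1)).1, hξs, hez] at this
      · have hi1 : IntervalIntegrable (fun s => lagrangian H (ξ s) (velocity n ξ s)) volume 0 τ :=
          hint.mono_set hsubτ
        have hi2 : IntervalIntegrable (fun s => lagrangian H (ξ s) (velocity n ξ s)) volume τ s :=
          hint.mono_set (by
            rw [uIcc_of_le hτ.2, uIcc_of_le hs.le]
            exact Icc_subset_Icc_left hτ.1)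
        have h1 := AbsolutelyContinuousOnInterval.mul_norm_sub_le_integral hτ.1 hΛ0 hac hi1
          (C := CΛ) (by
            filter_upwards [hae] with σ hσ hσI
            obtain ⟨w, hw, heq⟩ := hσ hσI
            refine ⟨w, hw, ?_⟩
            rw [heq]
            exact hsup _ (hhalf (hin σ (Ioo_subset_Icc_self hσI)).2) w)
        have h2 : -(C_L * (s - τ)) ≤ ∫ σ in τ..s, lagrangian H (ξ σ) (velocity n ξ σ) := by
          have := intervalIntegral.integral_mono_on hτ.2 intervalIntegrable_const hi2
            (fun σ _ => hlow (ξ σ) (velocity n ξ σ))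
          simp only [intervalIntegral.integral_const, smul_eq_mul] at this
          linarith
        rw [← intervalIntegral.integral_add_adjacent_intervals hi1 hi2]
        have h3 : 3 * R / 8 ≤ ‖e (ξ τ) - e (ξ 0)‖ := by
          rw [hez, ← dist_eq_norm]
          have := dist_triangle (e (ξ τ)) z z₀
          linarith
        have h4 : 2 * B + 1 ≤ Λ * ‖e (ξ τ) - e (ξ 0)‖ := by
          have : Λ * (3 * R / 8) = 2 * B + 1 := by rw [hΛ]; field_simp
          rw [← this]
          gcongr
        have h5 := (abs_le.1 (hval z hz)).1
        have h6 := (le_abs_self _).trans (hB y (mem_univ _))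
        have h7 := (neg_le_abs _).trans (hB (e.symm z) (mem_univ _))
        have h8 : (CΛ + C_L + C + 1) * s ≤ 1 := by
          have : s ≤ 1 / (CΛ + C_L + C + 1) := hss.trans (min_le_right _ _)
          rw [le_div_iff₀ (by positivity)] at this
          linarith
        have h9 : CΛ * τ ≤ CΛ * s := mul_le_mul_of_nonneg_left hτ.2 hCΛ
        have h10 : C_L * (s - τ) ≤ C_L * s := mul_le_mul_of_nonneg_left (by linarith [hτ.1]) hC_L
        simp only [hf] at h5
        linarith
    · exact payoff_le_laxOleinikPos hH hφ.1 hs hd htar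
        (fun z hz w hw => hsymm z (Metric.closedBall_subset_ball hRR₃ hz) w
          (Metric.closedBall_subset_ball hRR₃ hw)) (by linarith) hv
  refine ⟨R / 8, by positivity, s₀, hs₀pos, C, hC, fun z hz => htar
    (Metric.closedBall_subset_closedBall (by linarith) (Metric.ball_subset_closedBall hz)),
    fun s hs hss => ?_⟩
  obtain ⟨-, hval, hder⟩ := hreg s hs (hss.trans (min_le_left _ _))
  refine ⟨fun z hz => ?_, fun z hz => ?_⟩
  · rw [hvalue s hs hss z hz]
    exact hval z hz
  · obtain ⟨P, hP, hPC, hup⟩ := hder z hz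
    refine ⟨P, hP.congr_of_eventuallyEq ?_, hPC, fun y hy => ?_⟩
    · filter_upwards [Metric.isOpen_ball.mem_nhds hz] with y hy
      exact hvalue s hs hss y hy
    · rw [hvalue s hs hss z hz, hvalue s hs hss y hy]
      exact hup y hy

end LaxOleinik

/-! ### Limits of approximate supergradients -/

section ReachableGradients

/-- The covectors bounded by `C` that support `f` from above at `z₀`, up to a quadratic term. -/
def quadSuperdifferential {E : Type*} [NormedAddCommGroup E] [NormedSpace ℝ E] (f : E → ℝ)
    (z₀ : E) (r C : ℝ) : Set (E →L[ℝ] ℝ) :=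
  {P | ‖P‖ ≤ C ∧ ∀ w ∈ Metric.ball z₀ r, f w ≤ f z₀ + P (w - z₀) + C * ‖w - z₀‖ ^ 2}

variable {E : Type*} [NormedAddCommGroup E] [NormedSpace ℝ E] [FiniteDimensional ℝ E]
  {f : E → ℝ} {z₀ : E} {r C : ℝ}

theorem isCompact_quadSuperdifferential : IsCompact (quadSuperdifferential f z₀ r C) := by
  have hcl : IsClosed (quadSuperdifferential f z₀ r C) := by
    have : quadSuperdifferential f z₀ r C = {P | ‖P‖ ≤ C} ∩ ⋂ w ∈ Metric.ball z₀ r,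
        {P : E →L[ℝ] ℝ | f w ≤ f z₀ + P (w - z₀) + C * ‖w - z₀‖ ^ 2} := by
      ext P
      simp [quadSuperdifferential]
    rw [this]
    refine (isClosed_le continuous_norm continuous_const).inter
      (isClosed_biInter fun w _ => isClosed_le continuous_const ?_)
    fun_prop
  refine (isCompact_closedBall (0 : E →L[ℝ] ℝ) C).of_isClosed_subset hcl fun P hP => ?_
  rw [mem_closedBall_zero_iff]
  exact hP.1

/-- Approximate superdifferentials at nearby points accumulate at superdifferentials. -/
theorem exists_quadSuperdifferential_near {F : Type*} [PseudoMetricSpace F]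
    {G : E × (E →L[ℝ] ℝ) → F} (hf : ContinuousOn f (Metric.ball z₀ r)) (hr : 0 < r)
    (hG : ContinuousOn G (Metric.ball z₀ r ×ˢ univ)) {ε : ℝ} (hε : 0 < ε) :
    ∃ δ > 0, ∀ (z : E) (P : E →L[ℝ] ℝ) (η : ℝ), dist z z₀ < δ → η < δ → ‖P‖ ≤ C →
      (∀ w ∈ Metric.ball z₀ r, f w ≤ f z + P (w - z) + C * ‖w - z‖ ^ 2 + η) →
      ∃ P' ∈ quadSuperdifferential f z₀ r C, dist (G (z, P)) (G (z₀, P')) < ε := by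
  -- Otherwise there are approximate supergradients with base points tending to z₀ and errors
  -- tending to 0 whose images stay ε-far; as ‖P‖ ≤ C, a subsequence converges, and its limit is a
  -- quadratic supergradient at z₀.
  by_contra! hcon
  have hpos : ∀ k : ℕ, (0 : ℝ) < 1 / ((k : ℝ) + 1) := fun k => by positivity
  choose z P η hz hη hP hup hfar using fun k : ℕ => hcon (1 / ((k : ℝ) + 1)) (hpos k)
  have hlim : Tendsto (fun k : ℕ => 1 / ((k : ℝ) + 1)) atTop (𝓝 0) :=
    tendsto_one_div_add_atTop_nhds_zero_nat
  obtain ⟨P₀, -, θ, hθ, hPθ⟩ := (isCompact_closedBall (0 : E →L[ℝ] ℝ) C).tendsto_subseq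
    (x := P) fun k => by rw [mem_closedBall_zero_iff]; exact hP k
  have hlimθ := hlim.comp hθ.tendsto_atTop
  have hzθ : Tendsto (z ∘ θ) atTop (𝓝 z₀) := by
    rw [tendsto_iff_dist_tendsto_zero]
    exact squeeze_zero (fun _ => dist_nonneg) (fun k => (hz (θ k)).le) hlimθ
  have hfz : Tendsto (fun k => f (z (θ k))) atTop (𝓝 (f z₀)) :=
    (hf.continuousAt (Metric.ball_mem_nhds _ hr)).tendsto.comp hzθ
  have hP₀ : P₀ ∈ quadSuperdifferential f z₀ r C := by
    refine ⟨le_of_tendsto hPθ.norm (Eventually.of_forall fun k => hP (θ k)), fun w hw => ?_⟩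
    have h1 : Tendsto (fun k => (P ∘ θ) k (w - z (θ k))) atTop (𝓝 (P₀ (w - z₀))) :=
      (isBoundedBilinearMap_apply.continuous.tendsto (P₀, w - z₀)).comp
        (hPθ.prodMk_nhds (tendsto_const_nhds.sub hzθ))
    have h2 : Tendsto (fun k => C * ‖w - z (θ k)‖ ^ 2) atTop (𝓝 (C * ‖w - z₀‖ ^ 2)) :=
      ((tendsto_const_nhds.sub hzθ).norm.pow 2).const_mul C
    have h3 := ((hfz.add h1).add h2).add hlimθ
    rw [add_zero] at h3
    refine ge_of_tendsto h3 (Eventually.of_forall fun k => ?_)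
    have := hup (θ k) w hw
    have := hη (θ k)
    simp only [Function.comp_apply]
    linarith
  have hGt : Tendsto (fun k => G (z (θ k), P (θ k))) atTop (𝓝 (G (z₀, P₀))) := by
    have : ContinuousAt G (z₀, P₀) := hG.continuousAt
      ((Metric.isOpen_ball.prod isOpen_univ).mem_nhds ⟨Metric.mem_ball_self hr, mem_univ _⟩)
    exact this.tendsto.comp (hzθ.prodMk_nhds hPθ)
  obtain ⟨k, hk⟩ := (hGt.eventually (Metric.ball_mem_nhds _ hε)).exists
  exact absurd (hfar (θ k) P₀ hP₀) (not_le.2 hk)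

end ReachableGradients

/-! ### The velocity field for short times -/

section VelocityField

variable {n : ℕ} {M : Type*} [MetricSpace M] [ChartedSpace (EuclideanSpace ℝ (Fin n)) M]
  [IsManifold (𝓡 n) ∞ M]

theorem quadSuperdifferential_subset_superdifferential {φ : M → ℝ} {c : M} {r C : ℝ} (hr : 0 < r)
    (hC : 0 ≤ C) {P : EuclideanSpace ℝ (Fin n) →L[ℝ] ℝ}
    (hP : P ∈ quadSuperdifferential (fun z => φ ((extChartAt (𝓡 n) c).symm z))
      (extChartAt (𝓡 n) c c) r C) :
    (P : CotangentSpace n c) ∈ superdifferential n φ c := by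
  intro ε hε
  have h1 : ∀ᶠ y in 𝓝 c, extChartAt (𝓡 n) c y ∈
      Metric.ball (extChartAt (𝓡 n) c c) (min r (ε / (C + 1))) :=
    (continuousAt_extChartAt (I := 𝓡 n) c) (Metric.ball_mem_nhds _ (by positivity))
  filter_upwards [h1, extChartAt_source_mem_nhds (I := 𝓡 n) c] with y hy hys
  have h2 := hP.2 _ (Metric.ball_subset_ball (min_le_left _ _) hy)
  simp only [(extChartAt (𝓡 n) c).left_inv hys, extChartAt_to_inv] at h2
  refine h2.trans (add_le_add le_rfl ?_)
  rw [pow_two, ← mul_assoc]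
  refine mul_le_mul_of_nonneg_right ?_ (norm_nonneg _)
  rw [mem_ball_iff_norm] at hy
  have h3 := hy.le.trans (min_le_right _ _)
  rw [le_div_iff₀ (by positivity)] at h3
  nlinarith [norm_nonneg (extChartAt (𝓡 n) c y - extChartAt (𝓡 n) c c)]

variable [RiemannianBundle (fun x : M => TangentSpace (𝓡 n) x)]
  [IsContMDiffRiemannianBundle (𝓡 n) ∞ (EuclideanSpace ℝ (Fin n))
    (fun x : M => TangentSpace (𝓡 n) x)]
variable {H : ∀ x : M, CotangentSpace n x → ℝ} {φ : M → ℝ}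

/-- At the centre of its chart both differentials in `IsTonelli.Hp_eq` are the identity, so the
local gradients found in the chart are exactly elements of H_p(c, ·). -/
theorem IsTonelli.Hp_self (hH : IsTonelli H) (c : M) (P : EuclideanSpace ℝ (Fin n) →L[ℝ] ℝ) :
    Hp H c (P : CotangentSpace n c) = localHp H c (extChartAt (𝓡 n) c c, P) := by
  have hinv : ∀ w : EuclideanSpace ℝ (Fin n), chartDinv (n := n) c c w = w := fun w => by
    have h1 := chartDinv_chartD (n := n) (c := c) (y := c) (by simp) w
    exact (congrArg (chartDinv (n := n) c c) (chartD_self (n := n) (c := c) w)).symm.trans h1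
  have hP : ContinuousLinearMap.comp (P : CotangentSpace n c) (chartDinv c c) = P :=
    ContinuousLinearMap.ext fun w => congrArg P (hinv w)
  refine (hH.Hp_eq (c := c) (y := c) (by simp) P).trans ((hinv _).trans ?_)
  exact congrArg (fun Q => localHp H c (extChartAt (𝓡 n) c c, Q)) hP

variable [CompactSpace M] [IsRiemannianManifold (𝓡 n) M]

/-- The velocity field `H_p(y, D T⁺_s φ(y))` near `c`, for short times: in the chart at `c` it is
bounded, and as `y → c` and `s → 0` it approaches `H_p(c, D⁺φ(c))`. -/
theorem exists_velocityField_near (hH : IsTonelli H) (hφ : IsSemiconcave n φ) (c : M) :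
    ∃ r > 0, ∃ s₀ > 0, ∃ C ≥ 0, ∃ D : Set (EuclideanSpace ℝ (Fin n) →L[ℝ] ℝ),
      IsCompact D ∧ (∀ P ∈ D, (P : CotangentSpace n c) ∈ superdifferential n φ c) ∧
      Metric.ball (extChartAt (𝓡 n) c c) r ⊆ (extChartAt (𝓡 n) c).target ∧
      (∀ s, 0 < s → s ≤ s₀ → ∀ y ∈ (extChartAt (𝓡 n) c).source,
        extChartAt (𝓡 n) c y ∈ Metric.ball (extChartAt (𝓡 n) c c) r →
        ‖chartD c y (Hp H y (mfderiv (𝓡 n) 𝓘(ℝ, ℝ) (laxOleinikPos H s φ) y))‖ ≤ C) ∧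
      ∀ ε > 0, ∃ δ > 0, ∀ s, 0 < s → s < δ → ∀ y ∈ (extChartAt (𝓡 n) c).source,
        dist (extChartAt (𝓡 n) c y) (extChartAt (𝓡 n) c c) < δ → ∃ P ∈ D,
        dist (chartD c y (Hp H y (mfderiv (𝓡 n) 𝓘(ℝ, ℝ) (laxOleinikPos H s φ) y)))
          (localHp H c (extChartAt (𝓡 n) c c, P)) < ε := by
  obtain ⟨r, hr, s₀, hs₀, C, hC, htar, hreg⟩ := exists_laxOleinikPos_regularity hH hφ c
  set z₀ := extChartAt (𝓡 n) c c with hz₀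
  set e := extChartAt (𝓡 n) c with he
  set f : EuclideanSpace ℝ (Fin n) → ℝ := fun z => φ (e.symm z) with hf
  have hcont : ContinuousOn (localHp H c) (Metric.ball z₀ r ×ˢ univ) :=
    (hH.continuousOn_localHp c).mono (prod_mono htar Subset.rfl)
  have hfc : ContinuousOn f (Metric.ball z₀ r) :=
    hφ.1.comp_continuousOn ((continuousOn_extChartAt_symm (I := 𝓡 n) c).mono htar)
  -- The error 2Cs comes from replacing T⁺_s φ by φ at both w and e y.
  have hvel : ∀ s, 0 < s → s ≤ s₀ → ∀ y ∈ e.source, e y ∈ Metric.ball z₀ r →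
      ∃ P : EuclideanSpace ℝ (Fin n) →L[ℝ] ℝ, ‖P‖ ≤ C ∧
      (∀ w ∈ Metric.ball z₀ r, f w ≤ f (e y) + P (w - e y) + C * ‖w - e y‖ ^ 2 + 2 * C * s) ∧
      chartD c y (Hp H y (mfderiv (𝓡 n) 𝓘(ℝ, ℝ) (laxOleinikPos H s φ) y))
        = localHp H c (e y, P) := by
    intro s hs hss y hy hyr
    obtain ⟨hval, hder⟩ := hreg s hs hss
    obtain ⟨P, hP, hPC, hup⟩ := hder (e y) hyr
    refine ⟨P, hPC, fun w hw => ?_, ?_⟩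
    · have h1 := (abs_le.1 (hval w hw)).1
      have h2 := (abs_le.1 (hval (e y) hyr)).2
      have h3 := hup w hw
      simp only [hf]
      linarith
    · have hm := (hasMFDerivAt_of_hasFDerivAt_chart hy hP).mfderiv
      rw [hm, hH.Hp_eq hy, chartD_chartDinv hy]
      congr 2
      ext w
      have := chartD_chartDinv hy w
      simp only [ContinuousLinearMap.comp_apply]
      exact congrArg P this
  obtain ⟨B, hB⟩ := (((isCompact_closedBall z₀ (r / 2)).prod
    (isCompact_closedBall (0 : EuclideanSpace ℝ (Fin n) →L[ℝ] ℝ) C))).exists_bound_of_continuousOn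
    (hcont.mono (prod_mono (Metric.closedBall_subset_ball (by linarith)) (subset_univ _)))
  refine ⟨r / 2, by positivity, s₀, hs₀, max B 0, le_max_right _ _,
    quadSuperdifferential f z₀ r C, isCompact_quadSuperdifferential,
    fun P hP => quadSuperdifferential_subset_superdifferential hr hC hP,
    (Metric.ball_subset_ball (by linarith)).trans htar, ?_, ?_⟩
  · intro s hs hss y hy hyr
    obtain ⟨P, hPC, -, hPe⟩ := hvel s hs hss y hy (Metric.ball_subset_ball (by linarith) hyr)
    rw [hPe]
    exact (hB (e y, P) ⟨Metric.ball_subset_closedBall hyr, by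
      rwa [mem_closedBall_zero_iff]⟩).trans (le_max_left _ _)
  · intro ε hε
    obtain ⟨δ, hδ, h⟩ := exists_quadSuperdifferential_near (C := C) hfc hr hcont hε
    -- The last term forces 2Cs < δ; the others keep y in the ball and s in the regularity range.
    refine ⟨min (min δ r) (min s₀ (δ / (2 * C + 1))), by positivity, fun s hs hsδ y hy hyδ => ?_⟩
    have hsδ' := hsδ.trans_le (min_le_right _ _)
    have hyδ' := hyδ.trans_le (min_le_left _ _)
    obtain ⟨P, hPC, hup, hPe⟩ := hvel s hs (hsδ'.le.trans (min_le_left _ _)) y hy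
      (hyδ'.trans_le (min_le_right _ _))
    rw [hPe]
    refine h (e y) P (2 * C * s) (hyδ'.trans_le (min_le_left _ _)) ?_ hPC hup
    have := hsδ'.trans_le (min_le_right _ _)
    rw [lt_div_iff₀ (by positivity)] at this
    linarith

end VelocityField

/-! ### Convex hulls and barycentres -/

section ConvexHull

/-- In finite dimension, the convex hull of a compact set is compact. -/
theorem isCompact_convexHull {E : Type*} [NormedAddCommGroup E] [NormedSpace ℝ E]
    [FiniteDimensional ℝ E] {K : Set E} (hK : IsCompact K) : IsCompact (convexHull ℝ K) := by
  rcases K.eq_empty_or_nonempty with rfl | ⟨x₀, hx₀⟩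
  · simp
  -- By Carathéodory, N points suffice, so the hull is a continuous image of the compact set simplex
  -- × Kᴺ; shorter combinations are padded with weight 0 at x₀.
  set N := Module.finrank ℝ E + 1 with hN
  have himage : convexHull ℝ K = (fun p : (Fin N → ℝ) × (Fin N → E) => ∑ i, p.1 i • p.2 i) ''
      (stdSimplex ℝ (Fin N) ×ˢ univ.pi fun _ => K) := by
    refine Subset.antisymm (fun x hx => ?_) ?_
    · obtain ⟨ι, _, z, w, hz, hind, hw, hw1, hx⟩ := eq_pos_convex_span_of_mem_convexHull hx
      have hcard : Fintype.card ι ≤ N := by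
        refine hind.card_le_finrank_succ.trans ?_
        rw [hN]
        gcongr
        exact Submodule.finrank_le _
      obtain ⟨j⟩ : Nonempty (ι ↪ Fin N) := by
        rw [Function.Embedding.nonempty_iff_card_le]
        simpa using hcard
      have hout : ∀ i ∉ range j, Function.extend j w 0 i = 0 := fun i hi => by
        rw [Function.extend_apply' _ _ _ hi]; rfl
      refine ⟨(Function.extend j w 0, Function.extend j z fun _ => x₀), ⟨⟨fun i => ?_, ?_⟩, ?_⟩, ?_⟩
      · by_cases hi : i ∈ range j
        · obtain ⟨k, rfl⟩ := hi
          simp only [j.injective.extend_apply]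
          exact (hw k).le
        · exact (hout i hi).ge
      · rw [← hw1]
        refine (Fintype.sum_of_injective j j.injective _ _ hout fun k => ?_).symm
        rw [j.injective.extend_apply]
      · intro i _
        by_cases hi : i ∈ range j
        · obtain ⟨k, rfl⟩ := hi
          simp only [j.injective.extend_apply]
          exact hz ⟨k, rfl⟩
        · simp only [Function.extend_apply' _ _ _ hi]
          exact hx₀
      · rw [← hx]
        refine (Fintype.sum_of_injective j j.injective _ _ (fun i hi => ?_) fun k => ?_).symm
        · simp only [hout i hi, zero_smul]
        · simp only [j.injective.extend_apply]
    · rintro _ ⟨p, ⟨hw, hz⟩, rfl⟩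
      exact (convex_convexHull ℝ K).sum_mem (fun i _ => hw.1 i) hw.2
        fun i _ => subset_convexHull ℝ K (hz i (mem_univ i))
  rw [himage]
  refine ((isCompact_stdSimplex ℝ (Fin N)).prod (isCompact_univ_pi fun _ => hK)).image ?_
  fun_prop

/-- A point of the convex hull of `G '' D` is the integral of `G` for a probability measure
supported in `D`. -/
theorem exists_measure_of_mem_convexHull {X F : Type*} [TopologicalSpace X] [T1Space X]
    [MeasurableSpace X] [BorelSpace X] [NormedAddCommGroup F] [NormedSpace ℝ F] [CompleteSpace F]
    {G : X → F} {D : Set X} {v : F} (hv : v ∈ convexHull ℝ (G '' D)) :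
    ∃ ν : Measure X, IsProbabilityMeasure ν ∧ ν.support ⊆ D ∧ ∫ p, G p ∂ν = v := by
  obtain ⟨ι, _, w, y, hw, hw1, hy, hsum⟩ := mem_convexHull_iff_exists_fintype.1 hv
  choose p hp hpy using hy
  refine ⟨∑ i, ENNReal.ofReal (w i) • Measure.dirac (p i), ⟨?_⟩, ?_, ?_⟩
  · simp only [Measure.coe_finsetSum, Finset.sum_apply, Measure.smul_apply, measure_univ,
      smul_eq_mul, mul_one]
    rw [← ENNReal.ofReal_sum_of_nonneg fun i _ => hw i, hw1, ENNReal.ofReal_one]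
  · have hfin : (range p).Finite := finite_range p
    refine (Measure.support_subset_of_isClosed hfin.isClosed ?_).trans (range_subset_iff.2 hp)
    rw [mem_ae_iff]
    simp only [Measure.coe_finsetSum, Finset.sum_apply, Measure.smul_apply, smul_eq_mul]
    refine Finset.sum_eq_zero fun i _ => ?_
    rw [Measure.dirac_apply' _ hfin.isClosed.measurableSet.compl]
    simp
  · rw [integral_finsetSum_measure fun i _ =>
      (integrable_dirac (by simp)).smul_measure ENNReal.ofReal_ne_top, ← hsum]
    refine Finset.sum_congr rfl fun i _ => ?_
    rw [integral_smul_measure, integral_dirac, ENNReal.toReal_ofReal (hw i), hpy]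

end ConvexHull

/-! ### Curves differentiable off a countable set -/

section MeanValue

variable {E : Type*} [NormedAddCommGroup E] [NormedSpace ℝ E] [FiniteDimensional ℝ E]
  {g g' : ℝ → E} {a b B : ℝ} {s : Set ℝ}

theorem ae_mem_Ioo_diff_of_countable (hs : s.Countable) :
    ∀ᵐ x ∂(volume.restrict (Icc a b)), x ∈ Ioo a b \ s := by
  rw [Measure.restrict_congr_set Ioo_ae_eq_Icc.symm, ae_restrict_iff' measurableSet_Ioo]
  filter_upwards [hs.ae_notMem volume] with x hx hxI
  exact ⟨hxI, hx⟩

/-- Measurability of g' needs no assumption: off a null set it is the derivative of g, and `deriv g`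
is always measurable. This makes the velocities along the solutions measurable without studying how
the momentum depends on time. -/
theorem memLp_top_of_hasDerivAt_off_countable (hs : s.Countable)
    (hd : ∀ x ∈ Ioo a b \ s, HasDerivAt g (g' x) x) (hB : ∀ x ∈ Ioo a b \ s, ‖g' x‖ ≤ B) :
    MemLp g' ∞ (volume.restrict (Icc a b)) := by
  have hae := ae_mem_Ioo_diff_of_countable (a := a) (b := b) hs
  have : CompleteSpace E := FiniteDimensional.complete ℝ E
  borelize E
  have hm : AEStronglyMeasurable g' (volume.restrict (Icc a b)) :=
    (stronglyMeasurable_deriv g).aestronglyMeasurable.congr (by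
      filter_upwards [hae] with x hx
      exact (hd x hx).deriv)
  exact memLp_top_of_bound hm B (hae.mono hB)

theorem intervalIntegrable_of_hasDerivAt_off_countable (hab : a ≤ b) (hs : s.Countable)
    (hd : ∀ x ∈ Ioo a b \ s, HasDerivAt g (g' x) x) (hB : ∀ x ∈ Ioo a b \ s, ‖g' x‖ ≤ B) :
    IntervalIntegrable g' volume a b := by
  rw [intervalIntegrable_iff_integrableOn_Icc_of_le hab]
  exact (memLp_top_of_hasDerivAt_off_countable hs hd hB).integrable le_top

/-- Mean value theorem: a difference quotient lies in every closed convex set that contains the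
derivatives off a countable set. -/
theorem inv_smul_sub_mem_of_hasDerivAt_off_countable (hab : a < b) (hs : s.Countable)
    (hc : ContinuousOn g (Icc a b)) (hd : ∀ x ∈ Ioo a b \ s, HasDerivAt g (g' x) x)
    (hB : ∀ x ∈ Ioo a b \ s, ‖g' x‖ ≤ B) {S : Set E} (hS : Convex ℝ S) (hScl : IsClosed S)
    (hmem : ∀ x ∈ Ioo a b \ s, g' x ∈ S) : (b - a)⁻¹ • (g b - g a) ∈ S := by
  have : CompleteSpace E := FiniteDimensional.complete ℝ E
  have hint := intervalIntegrable_of_hasDerivAt_off_countable hab.le hs hd hB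
  rw [← integral_eq_of_hasDerivAt_off_countable_of_le g g' hab.le hs hc hd hint,
    ← interval_average_eq, uIoc_of_le hab.le]
  refine hS.set_average_mem hScl ?_ ?_ ?_ hint.1
  · simp [hab]
  · simp
  · rw [Measure.restrict_congr_set Ioc_ae_eq_Icc]
    exact (ae_mem_Ioo_diff_of_countable hs).mono hmem

end MeanValue

/-! ### Weak-* convergence from convergence of primitives -/

section WeakStar

/-- Bounded functions whose integrals over half-lines tend to zero tend to zero weakly-*. -/
theorem tendsto_integral_mul_zero {μ : Measure ℝ} [IsFiniteMeasure μ] {h : ℕ → ℝ → ℝ} {C : ℝ}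
    (hm : ∀ k, AEStronglyMeasurable (h k) μ) (hC : ∀ k, ∀ᵐ t ∂μ, ‖h k t‖ ≤ C)
    (huniv : Tendsto (fun k => ∫ t, h k t ∂μ) atTop (𝓝 0))
    (hIic : ∀ b, Tendsto (fun k => ∫ t in Iic b, h k t ∂μ) atTop (𝓝 0)) {Ψ : ℝ → ℝ}
    (hΨ : Integrable Ψ μ) : Tendsto (fun k => ∫ t, Ψ t * h k t ∂μ) atTop (𝓝 0) := by
  have hint : ∀ k, Integrable (h k) μ := fun k => Integrable.of_bound (hm k) C (hC k)
  have hmul : ∀ k {Ψ : ℝ → ℝ}, Integrable Ψ μ → Integrable (fun t => Ψ t * h k t) μ :=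
    fun k Ψ hΨ => hΨ.mul_bdd (hm k) (hC k)
  -- Half-lines form a π-system generating the Borel sets. For countable disjoint unions the limit
  -- is exchanged with the sum by dominated convergence, the pieces being bounded by C μ(f i).
  have hset : ∀ A, MeasurableSet A → Tendsto (fun k => ∫ t in A, h k t ∂μ) atTop (𝓝 0) := by
    refine MeasurableSpace.induction_on_inter (borel_eq_generateFrom_Iic ℝ ▸
      BorelSpace.measurable_eq) isPiSystem_Iic (by simp) ?_ ?_ ?_
    · rintro _ ⟨b, rfl⟩
      exact hIic b
    · intro A hA hlim
      have := huniv.sub hlim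
      rw [sub_zero] at this
      refine this.congr fun k => ?_
      rw [← integral_add_compl hA (hint k)]
      ring
    · intro f hdisj hf hlim
      have hsum : ∀ k, ∫ t in ⋃ i, f i, h k t ∂μ = ∑' i, ∫ t in f i, h k t ∂μ := fun k =>
        integral_iUnion hf hdisj (hint k).integrableOn
      simp only [hsum]
      have hS : Summable fun i => C * μ.real (f i) := by
        refine Summable.mul_left _ ?_
        refine ENNReal.summable_toReal ?_
        rw [← measure_iUnion hdisj hf]
        exact measure_ne_top _ _
      have := tendsto_tsum_of_dominated_convergence (𝓕 := atTop)
        (f := fun k i => ∫ t in f i, h k t ∂μ) (g := fun _ => (0 : ℝ)) hS hlim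
        (Eventually.of_forall fun k i =>
          norm_setIntegral_le_of_norm_le_const_ae' (measure_lt_top _ _)
            ((hC k).mono fun t ht _ => ht))
      simpa using this
  have hC0 : 0 ≤ max C 0 := le_max_right _ _
  refine Integrable.induction (fun Ψ => Tendsto (fun k => ∫ t, Ψ t * h k t ∂μ) atTop (𝓝 0))
    ?_ ?_ ?_ ?_ hΨ
  · intro c A hA _
    have := (hset A hA).const_mul c
    rw [mul_zero] at this
    refine this.congr fun k => ?_
    rw [← integral_const_mul, ← integral_indicator hA]
    refine integral_congr_ae (Eventually.of_forall fun t => ?_)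
    by_cases ht : t ∈ A <;> simp [ht]
  · intro f g _ hf hg hlf hlg
    have := hlf.add hlg
    rw [add_zero] at this
    refine this.congr fun k => ?_
    rw [← integral_add (hmul k hf) (hmul k hg)]
    refine integral_congr_ae (Eventually.of_forall fun t => ?_)
    simp only [Pi.add_apply]
    ring
  · refine isClosed_of_closure_subset fun f hf => ?_
    rw [mem_ofPred_eq, Metric.tendsto_atTop]
    intro ε hε
    obtain ⟨g, hg, hfg⟩ := Metric.mem_closure_iff.1 hf (ε / (2 * (max C 0 + 1))) (by positivity)
    obtain ⟨N, hN⟩ := Metric.tendsto_atTop.1 hg (ε / 2) (by positivity)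
    refine ⟨N, fun k hk => ?_⟩
    have h1 := hN k hk
    rw [dist_zero_right] at h1 ⊢
    have h2 : ‖∫ t, (f t - g t) * h k t ∂μ‖ ≤ dist f g * max C 0 := by
      rw [L1.dist_eq_integral_dist, ← integral_mul_const]
      refine norm_integral_le_of_norm_le ?_ ?_
      · have := ((L1.integrable_coeFn f).sub (L1.integrable_coeFn g)).norm.mul_const (max C 0)
        refine this.congr (Eventually.of_forall fun t => ?_)
        simp [dist_eq_norm]
      · filter_upwards [hC k] with t ht
        rw [norm_mul, dist_eq_norm]
        gcongr
        exact ht.trans (le_max_left _ _)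
    have h3 : ∫ t, f t * h k t ∂μ = ∫ t, (f t - g t) * h k t ∂μ + ∫ t, g t * h k t ∂μ := by
      rw [← sub_eq_iff_eq_add, ← integral_sub (hmul k (L1.integrable_coeFn f))
        (hmul k (L1.integrable_coeFn g))]
      simp only [sub_mul]
    have h4 : dist f g * max C 0 < ε / 2 := by
      rw [lt_div_iff₀ (by positivity)] at hfg
      nlinarith [dist_nonneg (x := f) (y := g)]
    rw [h3]
    refine (norm_add_le _ _).trans_lt ?_
    linarith
  · intro f g hfg _ hlim
    refine hlim.congr fun k => integral_congr_ae ?_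
    filter_upwards [hfg] with t ht
    rw [ht]

/-- Uniformly bounded functions converge weakly-* if their primitives converge. -/
theorem weakStarLInfty_of_primitives {T C : ℝ} (hT : 0 ≤ T) {g : ℕ → ℝ → ℝ} {g₀ : ℝ → ℝ}
    (hg : ∀ k, MemLp (g k) ∞ (volume.restrict (Icc 0 T)))
    (hg₀ : MemLp g₀ ∞ (volume.restrict (Icc 0 T)))
    (hC : ∀ k, ∀ᵐ t ∂(volume.restrict (Icc 0 T)), ‖g k t‖ ≤ C)
    (hC₀ : ∀ᵐ t ∂(volume.restrict (Icc 0 T)), ‖g₀ t‖ ≤ C)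
    (hprim : ∀ b ∈ Icc 0 T, Tendsto (fun k => ∫ t in (0 : ℝ)..b, g k t) atTop
      (𝓝 (∫ t in (0 : ℝ)..b, g₀ t))) : WeakStarLInfty T g g₀ := by
  refine ⟨hg, hg₀, fun Ψ hΨ => ?_⟩
  have hi : ∀ k, Integrable (g k) (volume.restrict (Icc 0 T)) := fun k => (hg k).integrable le_top
  have hi₀ : Integrable g₀ (volume.restrict (Icc 0 T)) := hg₀.integrable le_top
  have hIcc : ∀ b ∈ Icc 0 T, Tendsto (fun k => ∫ t in Icc 0 b, (g k t - g₀ t)) atTop (𝓝 0) := by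
    intro b hb
    have h1 := (hprim b hb).sub_const (∫ t in (0 : ℝ)..b, g₀ t)
    rw [sub_self] at h1
    refine h1.congr fun k => ?_
    have hsub : Icc 0 b ⊆ Icc 0 T := Icc_subset_Icc_right hb.2
    rw [integral_sub (IntegrableOn.mono_set (hi k) hsub) (IntegrableOn.mono_set hi₀ hsub),
      intervalIntegral.integral_of_le hb.1, intervalIntegral.integral_of_le hb.1,
      integral_Icc_eq_integral_Ioc, integral_Icc_eq_integral_Ioc]
  have hz := tendsto_integral_mul_zero (μ := volume.restrict (Icc 0 T)) (C := C + C)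
    (h := fun k t => g k t - g₀ t) (fun k => ((hi k).sub hi₀).aestronglyMeasurable)
    (fun k => by
      filter_upwards [hC k, hC₀] with t h1 h2
      exact (norm_sub_le _ _).trans (add_le_add h1 h2))
    (hIcc T (right_mem_Icc.2 hT)) (fun b => by
      simp only [Measure.restrict_restrict measurableSet_Iic]
      rcases lt_or_ge b 0 with hb | hb
      · have : Iic b ∩ Icc 0 T = ∅ := by
          ext t
          simp only [mem_inter_iff, mem_Iic, mem_Icc, mem_empty_iff_false, iff_false]
          intro h
          linarith [h.1, h.2.1]
        simp [this]
      · have : Iic b ∩ Icc 0 T = Icc 0 (min b T) := by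
          ext t
          simp only [mem_inter_iff, mem_Iic, mem_Icc, le_min_iff]
          tauto
        simp only [this]
        exact hIcc _ ⟨le_min hb hT, min_le_right _ _⟩) hΨ
  have h1 := hz.add_const (∫ t in Icc 0 T, Ψ t * g₀ t)
  rw [zero_add] at h1
  refine h1.congr fun k => ?_
  rw [eq_comm, ← sub_eq_iff_eq_add, ← integral_sub
    (hΨ.mul_bdd (hi k).aestronglyMeasurable (hC k)) (hΨ.mul_bdd hi₀.aestronglyMeasurable hC₀)]
  simp only [mul_sub]

end WeakStar

/-! ### Time to the next partition point -/

section Partition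

/-- Puts the time argument of the Lax-Oleinik operator in the short-time range once the width is
small. The first index whose partition point exceeds t is not 0, because τ 0 = 0 ≤ t, so it has a
predecessor at or before t. The time is strictly positive even at partition points. -/
theorem HalfLinePartition.next_sub_mem (Δ : HalfLinePartition) {t : ℝ} (ht : 0 ≤ t) :
    Δ.next t - t ∈ Ioc 0 Δ.width := by
  classical
  have hex : ∃ i, t < Δ.τ i := (Δ.tendsto.eventually_gt_atTop t).exists
  obtain ⟨i, hi⟩ : ∃ i, Nat.find hex = i + 1 := by
    refine Nat.exists_eq_succ_of_ne_zero fun h => ?_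
    have := Nat.find_spec hex
    rw [h, Δ.zero] at this
    linarith
  have hspec : t < Δ.τ (i + 1) := hi ▸ Nat.find_spec hex
  have hle : Δ.τ i ≤ t := not_lt.1 (Nat.find_min hex (by omega))
  have hnext : Δ.next t = Δ.τ (i + 1) := by
    refine IsLeast.csInf_eq ⟨⟨⟨_, rfl⟩, hspec⟩, ?_⟩
    rintro _ ⟨⟨j, rfl⟩, hj⟩
    refine Δ.strictMono.monotone ?_
    rw [← hi]
    exact Nat.find_min' hex hj
  have hw : Δ.τ (i + 1) - Δ.τ i ≤ Δ.width := le_ciSup Δ.bddAbove i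
  rw [hnext]
  exact ⟨by linarith, by linarith⟩

end Partition

/-! ### Passage to the limit along the curves -/

section Limit

variable {n : ℕ} {M : Type*} [MetricSpace M] [ChartedSpace (EuclideanSpace ℝ (Fin n)) M]

/-- Lets a single chart at x(t) serve the limit curve and all late approximations at once, on a time
interval around t that does not depend on the index. -/
theorem eventually_mem_of_tendstoUniformlyOn {I : Set ℝ} {xs : ℕ → ℝ → M} {x : ℝ → M}
    (hx : TendstoUniformlyOn xs x atTop I) (hc : ContinuousOn x I) {t : ℝ} (ht : t ∈ I)
    {O : Set M} (hO : O ∈ 𝓝 (x t)) :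
    ∃ δ > 0, ∃ m₁, ∀ σ ∈ I, dist σ t < δ → x σ ∈ O ∧ ∀ m ≥ m₁, xs m σ ∈ O := by
  obtain ⟨ε, hε, hεO⟩ := Metric.mem_nhds_iff.1 hO
  obtain ⟨δ, hδ, hδx⟩ := Metric.continuousOn_iff.1 hc t ht (ε / 2) (by positivity)
  obtain ⟨m₁, hm₁⟩ := eventually_atTop.1 (Metric.tendstoUniformlyOn_iff.1 hx (ε / 2) (by positivity))
  refine ⟨δ, hδ, m₁, fun σ hσ hσt => ⟨hεO ?_, fun m hm => hεO ?_⟩⟩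
  · have := hδx σ hσ hσt
    rw [Metric.mem_ball]
    linarith
  · have h1 := hδx σ hσ hσt
    have h2 := hm₁ m hm σ hσ
    have h3 := dist_triangle_left (xs m σ) (x t) (x σ)
    rw [Metric.mem_ball]
    linarith

variable [IsManifold (𝓡 n) ∞ M]

/-- The differential of a real function, as a covector. -/
def differential (n : ℕ) {M : Type*} [MetricSpace M] [ChartedSpace (EuclideanSpace ℝ (Fin n)) M]
    (f : M → ℝ) (y : M) : CotangentSpace n y := mfderiv (𝓡 n) 𝓘(ℝ, ℝ) f y

theorem HasVelocityAt.hasDerivAt_comp {ξ : ℝ → M} {t : ℝ} {v : TangentSpace (𝓡 n) (ξ t)}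
    (h : HasVelocityAt ξ t v) {f : M → ℝ} (hf : MDifferentiableAt (𝓡 n) 𝓘(ℝ, ℝ) f (ξ t)) :
    HasDerivAt (fun s => f (ξ s)) (differential n f (ξ t) v) t := by
  have h1 := hf.hasMFDerivAt.comp t h
  have h2 : HasFDerivAt (fun s => f (ξ s)) ((differential n f (ξ t)).comp
      (ContinuousLinearMap.toSpanSingleton ℝ v) : ℝ →L[ℝ] ℝ) t :=
    hasMFDerivAt_iff_hasFDerivAt.1 h1
  refine h2.hasDerivAt.congr_deriv ?_
  have : (ContinuousLinearMap.toSpanSingleton ℝ v : ℝ →L[ℝ] TangentSpace (𝓡 n) (ξ t)) (1 : ℝ) = v :=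
    ContinuousLinearMap.toSpanSingleton_apply_one ℝ v
  exact congrArg (differential n f (ξ t)) this

variable {H : ∀ x : M, CotangentSpace n x → ℝ} {φ : M → ℝ} {T : ℝ} {x₀ : M}
  {Δ : ℕ → HalfLinePartition} {xs : ℕ → ℝ → M} {x : ℝ → M}

/-- Difference quotients of the limit curve in a chart lie in every closed convex set that contains
the velocities of the approximating curves. -/
theorem inv_smul_sub_extChartAt_mem (hxs : ∀ m, IsSolution H φ (Δ m) T x₀ (xs m))
    (hx : TendstoUniformlyOn xs x atTop (Icc 0 T)) {c : M} {a b : ℝ} (ha : 0 ≤ a) (hab : a < b)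
    (hb : b ≤ T) {m₁ : ℕ} {C : ℝ} {S : Set (EuclideanSpace ℝ (Fin n))} (hS : Convex ℝ S)
    (hScl : IsClosed S) (hxa : x a ∈ (extChartAt (𝓡 n) c).source)
    (hxb : x b ∈ (extChartAt (𝓡 n) c).source)
    (h : ∀ m ≥ m₁, ∀ σ ∈ Icc a b, xs m σ ∈ (extChartAt (𝓡 n) c).source ∧
      ‖chartD c (xs m σ) (Hp H (xs m σ) (momentum H φ (Δ m) σ (xs m σ)))‖ ≤ C ∧
      chartD c (xs m σ) (Hp H (xs m σ) (momentum H φ (Δ m) σ (xs m σ))) ∈ S) :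
    (b - a)⁻¹ • (extChartAt (𝓡 n) c (x b) - extChartAt (𝓡 n) c (x a)) ∈ S := by
  have hlim : ∀ σ ∈ Icc 0 T, x σ ∈ (extChartAt (𝓡 n) c).source →
      Tendsto (fun m => extChartAt (𝓡 n) c (xs m σ)) atTop (𝓝 (extChartAt (𝓡 n) c (x σ))) :=
    fun σ hσ hσs => ((continuousOn_extChartAt (I := 𝓡 n) c).continuousAt
      ((isOpen_extChartAt_source (I := 𝓡 n) c).mem_nhds hσs)).tendsto.comp (hx.tendsto_at hσ)
  have hl := ((hlim b ⟨ha.trans hab.le, hb⟩ hxb).sub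
    (hlim a ⟨ha, hab.le.trans hb⟩ hxa)).const_smul (b - a)⁻¹
  refine hScl.mem_of_tendsto hl (eventually_atTop.2 ⟨m₁, fun m hm => ?_⟩)
  have hsub : Icc a b ⊆ Icc 0 T := Icc_subset_Icc ha hb
  refine inv_smul_sub_mem_of_hasDerivAt_off_countable
    (g := fun σ => extChartAt (𝓡 n) c (xs m σ)) (B := C)
    (g' := fun σ => chartD c (xs m σ) (Hp H (xs m σ) (momentum H φ (Δ m) σ (xs m σ))))
    hab (countable_range (Δ m).τ) ?_ ?_
    (fun σ hσ => (h m hm σ (Ioo_subset_Icc_self hσ.1)).2.1) hS hScl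
    (fun σ hσ => (h m hm σ (Ioo_subset_Icc_self hσ.1)).2.2)
  · exact (continuousOn_extChartAt (I := 𝓡 n) c).comp ((hxs m).continuousOn.mono hsub)
      fun σ hσ => (h m hm σ hσ).1
  · intro σ hσ
    exact ((hxs m).ode σ ⟨ha.trans_lt hσ.1.1, hσ.1.2.trans_le hb⟩ hσ.2).hasDerivAt
      (h m hm σ (Ioo_subset_Icc_self hσ.1)).1

variable [RiemannianBundle (fun x : M => TangentSpace (𝓡 n) x)]
  [IsContMDiffRiemannianBundle (𝓡 n) ∞ (EuclideanSpace ℝ (Fin n))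
    (fun x : M => TangentSpace (𝓡 n) x)] [CompactSpace M] [IsRiemannianManifold (𝓡 n) M]

/-- A differential of T⁺_s φ at c itself has an element of D nearby. This supplies a measure at the
times where the limit curve has no velocity. -/
theorem superdifferential_nonempty (hH : IsTonelli H) (hφ : IsSemiconcave n φ) (c : M) :
    (superdifferential n φ c).Nonempty := by
  obtain ⟨-, -, -, -, -, -, D, -, hD, -, -, hnear⟩ := exists_velocityField_near hH hφ c
  obtain ⟨δ, hδ, h⟩ := hnear 1 one_pos
  obtain ⟨P, hP, -⟩ := h (δ / 2) (by positivity) (by linarith) c (by simp) (by simpa using hδ)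
  exact ⟨P, hD P hP⟩

/-- The limit curve is locally Lipschitz in charts. -/
theorem exists_lipschitzOnWith_extChartAt_limit (hH : IsTonelli H) (hφ : IsSemiconcave n φ)
    (hΔ : Tendsto (fun m => (Δ m).width) atTop (𝓝 0))
    (hxs : ∀ m, IsSolution H φ (Δ m) T x₀ (xs m))
    (hx : TendstoUniformlyOn xs x atTop (Icc 0 T)) (hc : ContinuousOn x (Icc 0 T)) {t : ℝ}
    (ht : t ∈ Icc 0 T) : ∃ K : ℝ≥0, ∃ δ > 0,
      LipschitzOnWith K (fun σ => extChartAt (𝓡 n) (x t) (x σ)) (Icc 0 T ∩ Metric.ball t δ) ∧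
      ∀ σ ∈ Icc 0 T ∩ Metric.ball t δ, x σ ∈ (extChartAt (𝓡 n) (x t)).source := by
  obtain ⟨r, hr, s₀, hs₀, C, hC, -, -, -, -, hbd, -⟩ := exists_velocityField_near hH hφ (x t)
  have hO : (extChartAt (𝓡 n) (x t)).source ∩ extChartAt (𝓡 n) (x t) ⁻¹'
      Metric.ball (extChartAt (𝓡 n) (x t) (x t)) r ∈ 𝓝 (x t) :=
    inter_mem (extChartAt_source_mem_nhds (I := 𝓡 n) (x t))
      ((continuousAt_extChartAt (I := 𝓡 n) (x t)) (Metric.ball_mem_nhds _ hr))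
  obtain ⟨δ, hδ, m₁, hm₁⟩ := eventually_mem_of_tendstoUniformlyOn hx hc ht hO
  obtain ⟨m₂, hm₂⟩ := eventually_atTop.1 (hΔ.eventually (Iic_mem_nhds hs₀))
  have key : ∀ a ∈ Icc 0 T ∩ Metric.ball t δ, ∀ b ∈ Icc 0 T ∩ Metric.ball t δ, a < b →
      dist (extChartAt (𝓡 n) (x t) (x a)) (extChartAt (𝓡 n) (x t) (x b)) ≤ C * dist a b := by
    intro a ha b hb hab
    have h := inv_smul_sub_extChartAt_mem hxs hx (c := x t) (m₁ := max m₁ m₂) (C := C)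
      (S := Metric.closedBall 0 C) ha.1.1 hab hb.1.2 (convex_closedBall _ _)
      Metric.isClosed_closedBall (hm₁ a ha.1 ha.2).1.1 (hm₁ b hb.1 hb.2).1.1 (by
        intro m hm σ hσ
        have hσI : σ ∈ Icc 0 T := ⟨ha.1.1.trans hσ.1, hσ.2.trans hb.1.2⟩
        have hσb : σ ∈ Metric.ball t δ := by
          have h1 := ha.2
          have h2 := hb.2
          rw [Real.ball_eq_Ioo] at h1 h2 ⊢
          exact ⟨h1.1.trans_le hσ.1, hσ.2.trans_lt h2.2⟩
        have hmem := (hm₁ σ hσI hσb).2 m ((le_max_left _ _).trans hm)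
        have hw := (Δ m).next_sub_mem hσI.1
        have hb := hbd _ hw.1 (hw.2.trans (hm₂ m ((le_max_right _ _).trans hm))) _ hmem.1 hmem.2
        refine ⟨hmem.1, hb, ?_⟩
        rw [mem_closedBall_zero_iff]
        exact hb)
    rw [mem_closedBall_zero_iff, norm_smul, norm_inv, Real.norm_of_nonneg (by linarith),
      inv_mul_le_iff₀ (by linarith)] at h
    rw [dist_comm, dist_eq_norm, dist_comm a b, Real.dist_eq, abs_of_pos (by linarith)]
    linarith
  refine ⟨C.toNNReal, δ, hδ, LipschitzOnWith.of_dist_le_mul fun a ha b hb => ?_,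
    fun σ hσ => (hm₁ σ hσ.1 hσ.2).1.1⟩
  rw [Real.coe_toNNReal C hC]
  rcases lt_trichotomy a b with hab | rfl | hab
  · exact key a ha b hb hab
  · simp
  · rw [dist_comm, dist_comm a b]
    exact key b hb a ha hab

theorem exists_lipschitzOnWith_limit (hH : IsTonelli H) (hφ : IsSemiconcave n φ)
    (hΔ : Tendsto (fun m => (Δ m).width) atTop (𝓝 0))
    (hxs : ∀ m, IsSolution H φ (Δ m) T x₀ (xs m))
    (hx : TendstoUniformlyOn xs x atTop (Icc 0 T)) (hc : ContinuousOn x (Icc 0 T)) :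
    ∃ K : ℝ≥0, LipschitzOnWith K x (Icc 0 T) := by
  refine LocallyLipschitzOn.exists_lipschitzOnWith_of_compact isCompact_Icc fun t ht => ?_
  obtain ⟨K, δ, hδ, hK, -⟩ := exists_lipschitzOnWith_extChartAt_limit hH hφ hΔ hxs hx hc ht
  exact exists_lipschitzOnWith_of_extChartAt (hc t ht)
    (inter_mem_nhdsWithin _ (Metric.ball_mem_nhds t hδ)) hK

/-- Rademacher's theorem in charts: the exceptional set is locally null, hence null. The open
interval is used because nothing is known of x outside [0, T]. -/
theorem ae_hasVelocityAt_limit (hH : IsTonelli H) (hφ : IsSemiconcave n φ)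
    (hΔ : Tendsto (fun m => (Δ m).width) atTop (𝓝 0))
    (hxs : ∀ m, IsSolution H φ (Δ m) T x₀ (xs m))
    (hx : TendstoUniformlyOn xs x atTop (Icc 0 T)) (hc : ContinuousOn x (Icc 0 T)) :
    ∀ᵐ t ∂(volume.restrict (Icc 0 T)), t ∈ Ioo 0 T ∧
      ∃ v : TangentSpace (𝓡 n) (x t), HasVelocityAt x t v := by
  rw [Measure.restrict_congr_set Ioo_ae_eq_Icc.symm, ae_restrict_iff' measurableSet_Ioo]
  set N : Set ℝ := {t | t ∈ Ioo 0 T ∧ ¬∃ v : TangentSpace (𝓡 n) (x t), HasVelocityAt x t v} with hN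
  suffices h0 : volume N = 0 by
    filter_upwards [measure_eq_zero_iff_ae_notMem.1 h0] with t ht htI
    exact ⟨htI, not_not.1 fun hcon => ht ⟨htI, hcon⟩⟩
  refine measure_null_of_locally_null N fun t ht => ?_
  obtain ⟨K, δ, hδ, hK, hsrc⟩ := exists_lipschitzOnWith_extChartAt_limit hH hφ hΔ hxs hx hc
    (Ioo_subset_Icc_self ht.1)
  refine ⟨N ∩ (Ioo 0 T ∩ Metric.ball t δ), inter_mem_nhdsWithin _
    (inter_mem (isOpen_Ioo.mem_nhds ht.1) (Metric.ball_mem_nhds t hδ)), ?_⟩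
  have hae := (hK.mono (inter_subset_inter_left (Metric.ball t δ)
    Ioo_subset_Icc_self)).ae_differentiableWithinAt_of_mem (μ := volume)
  refine measure_eq_zero_iff_ae_notMem.2 ?_
  filter_upwards [hae] with σ hσ hσN
  have hopen : Ioo 0 T ∩ Metric.ball t δ ∈ 𝓝 σ :=
    (isOpen_Ioo.inter Metric.isOpen_ball).mem_nhds hσN.2
  have hd := ((hσ hσN.2).differentiableAt hopen).hasDerivAt
  have hσc : ContinuousAt x σ :=
    hc.continuousAt (mem_of_superset hopen fun _ h => Ioo_subset_Icc_self h.1)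
  exact hσN.1.2 ⟨_, hasVelocityAt_of_hasDerivAt hσc
    (hsrc σ ⟨Ioo_subset_Icc_self hσN.2.1, hσN.2.2⟩) hd⟩

/-- The velocities of the limit curve lie in `co H_p(x, D⁺φ(x))`. -/
theorem mem_convexHull_of_hasVelocityAt_limit (hH : IsTonelli H) (hφ : IsSemiconcave n φ)
    (hΔ : Tendsto (fun m => (Δ m).width) atTop (𝓝 0))
    (hxs : ∀ m, IsSolution H φ (Δ m) T x₀ (xs m))
    (hx : TendstoUniformlyOn xs x atTop (Icc 0 T)) (hc : ContinuousOn x (Icc 0 T)) {t : ℝ}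
    (ht : t ∈ Ioo 0 T) {v : TangentSpace (𝓡 n) (x t)} (hv : HasVelocityAt x t v) :
    v ∈ convexHull ℝ (Hp H (x t) '' superdifferential n φ (x t)) := by
  obtain ⟨r, hr, s₀, hs₀, C, hC, D, hDc, hD, -, hbd, hnear⟩ :=
    exists_velocityField_near hH hφ (x t)
  set e := extChartAt (𝓡 n) (x t) with he
  set G : (EuclideanSpace ℝ (Fin n) →L[ℝ] ℝ) → EuclideanSpace ℝ (Fin n) :=
    fun P => localHp H (x t) (e (x t), P) with hG
  have hGc : Continuous G := by
    have h1 := hH.continuousOn_localHp (x t)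
    exact continuousOn_univ.1 (h1.comp (f := fun P => (e (x t), P)) (by fun_prop)
      fun P _ => ⟨mem_extChartAt_target (x t), mem_univ _⟩)
  have hderiv : HasDerivAt (fun σ => e (x σ)) v t :=
    (hv.hasDerivAt (c := x t) (by simp)).congr_deriv (chartD_self v)
  have hcpt : IsCompact (convexHull ℝ (G '' D)) := isCompact_convexHull (hDc.image hGc)
  have hvmem : ∀ v : EuclideanSpace ℝ (Fin n), HasDerivAt (fun σ => e (x σ)) v t →
      v ∈ convexHull ℝ (G '' D) := by
    intro v hderiv
    -- Thickenings of a convex set are convex, so for each ε the mean value argument places all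
    -- short right difference quotients in the closed ε-thickening, and the derivative with them;
    -- the hull, being compact, is the intersection of its thickenings.
    rw [← hcpt.isClosed.closure_eq, Metric.closure_eq_iInter_cthickening, mem_iInter₂]
    intro ε hε
    obtain ⟨δ, hδ, hδn⟩ := hnear ε hε
    have hO : e.source ∩ e ⁻¹' Metric.ball (e (x t)) (min r δ) ∈ 𝓝 (x t) :=
      inter_mem (extChartAt_source_mem_nhds (I := 𝓡 n) (x t))
        ((continuousAt_extChartAt (I := 𝓡 n) (x t)) (Metric.ball_mem_nhds _ (by positivity)))
    obtain ⟨δ₁, hδ₁, m₁, hm₁⟩ :=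
      eventually_mem_of_tendstoUniformlyOn hx hc (Ioo_subset_Icc_self ht) hO
    obtain ⟨m₂, hm₂⟩ := eventually_atTop.1 (hΔ.eventually (Iio_mem_nhds (lt_min hs₀ hδ)))
    have hslope : Tendsto (slope (fun σ => e (x σ)) t) (𝓝[>] t) (𝓝 v) :=
      (hasDerivAt_iff_tendsto_slope.1 hderiv).mono_left (nhdsWithin_mono _ fun b hb => hb.ne')
    refine Metric.isClosed_cthickening.mem_of_tendsto hslope ?_
    have hev : ∀ᶠ b in 𝓝[>] t, b ∈ Ioo t (min T (t + δ₁)) :=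
      Ioo_mem_nhdsGT (lt_min ht.2 (by linarith))
    filter_upwards [hev] with b hb
    have hbT : b < T := hb.2.trans_le (min_le_left _ _)
    have hbδ : b < t + δ₁ := hb.2.trans_le (min_le_right _ _)
    have hnr : ∀ σ ∈ Icc t b, σ ∈ Icc 0 T ∧ dist σ t < δ₁ := fun σ hσ =>
      ⟨⟨ht.1.le.trans hσ.1, hσ.2.trans hbT.le⟩, by
        rw [Real.dist_eq, abs_of_nonneg (by linarith [hσ.1])]; linarith [hσ.2]⟩
    refine inv_smul_sub_extChartAt_mem hxs hx (c := x t) (m₁ := max m₁ m₂) (C := C) ht.1.le hb.1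
      hbT.le ((convex_convexHull ℝ _).cthickening ε) Metric.isClosed_cthickening
      (by simp) (hm₁ b (hnr b ⟨hb.1.le, le_rfl⟩).1 (hnr b ⟨hb.1.le, le_rfl⟩).2).1.1 ?_
    intro m hm σ hσ
    have hmem := (hm₁ σ (hnr σ hσ).1 (hnr σ hσ).2).2 m ((le_max_left _ _).trans hm)
    have hw := (Δ m).next_sub_mem (hnr σ hσ).1.1
    have hwm : (Δ m).next σ - σ < min s₀ δ := hw.2.trans_lt (hm₂ m ((le_max_right _ _).trans hm))
    refine ⟨hmem.1, hbd _ hw.1 (hwm.le.trans (min_le_left _ _)) _ hmem.1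
      (Metric.ball_subset_ball (min_le_left _ _) hmem.2), ?_⟩
    obtain ⟨P, hP, hdist⟩ := hδn _ hw.1 (hwm.trans_le (min_le_right _ _)) _ hmem.1
      (Metric.ball_subset_ball (min_le_right _ _) hmem.2)
    exact Metric.mem_cthickening_of_dist_le _ (G P) _ _
      (subset_convexHull ℝ _ (mem_image_of_mem G hP)) hdist.le
  have himage : G '' D ⊆ Hp H (x t) '' superdifferential n φ (x t) := by
    rintro _ ⟨P, hP, rfl⟩
    exact ⟨P, hD P hP, hH.Hp_self (x t) P⟩
  exact convexHull_mono himage (hvmem v hderiv)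

/-- The differentials of `C¹` functions are bounded along the velocity field, for short times. -/
theorem exists_abs_differential_velocityField_le (hH : IsTonelli H) (hφ : IsSemiconcave n φ) :
    ∃ s₀ > 0, ∀ f : M → ℝ, ContMDiff (𝓡 n) 𝓘(ℝ, ℝ) 1 f → ∃ C ≥ 0, ∀ s, 0 < s → s ≤ s₀ →
      ∀ y : M, |differential n f y
        (Hp H y (mfderiv (𝓡 n) 𝓘(ℝ, ℝ) (laxOleinikPos H s φ) y))| ≤ C := by
  suffices h : ∃ s₀ > 0, ∀ f : M → ℝ, ContMDiff (𝓡 n) 𝓘(ℝ, ℝ) 1 f → ∃ C ≥ 0, ∀ s, 0 < s →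
      s ≤ s₀ → ∀ y ∈ (univ : Set M), |differential n f y
        (Hp H y (mfderiv (𝓡 n) 𝓘(ℝ, ℝ) (laxOleinikPos H s φ) y))| ≤ C by
    simpa using h
  -- The threshold s₀ is chosen before f: it depends only on the velocity field, so one tail of the
  -- sequence will serve all test functions.
  refine isCompact_univ.induction_on (p := fun S : Set M => ∃ s₀ > 0, ∀ f : M → ℝ,
    ContMDiff (𝓡 n) 𝓘(ℝ, ℝ) 1 f → ∃ C ≥ 0, ∀ s, 0 < s → s ≤ s₀ → ∀ y ∈ S,
      |differential n f y (Hp H y (mfderiv (𝓡 n) 𝓘(ℝ, ℝ) (laxOleinikPos H s φ) y))| ≤ C)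
    ⟨1, one_pos, fun f _ => ⟨0, le_rfl, by simp⟩⟩ ?_ ?_ ?_
  · rintro S S' hSS' ⟨s₀, hs₀, h⟩
    refine ⟨s₀, hs₀, fun f hf => ?_⟩
    obtain ⟨C, hC, h⟩ := h f hf
    exact ⟨C, hC, fun s hs hss y hy => h s hs hss y (hSS' hy)⟩
  · rintro S S' ⟨s₀, hs₀, h⟩ ⟨s₀', hs₀', h'⟩
    refine ⟨min s₀ s₀', lt_min hs₀ hs₀', fun f hf => ?_⟩
    obtain ⟨C, hC, h⟩ := h f hf
    obtain ⟨C', hC', h'⟩ := h' f hf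
    refine ⟨max C C', hC.trans (le_max_left _ _), ?_⟩
    rintro s hs hss y (hy | hy)
    · exact (h s hs (hss.trans (min_le_left _ _)) y hy).trans (le_max_left _ _)
    · exact (h' s hs (hss.trans (min_le_right _ _)) y hy).trans (le_max_right _ _)
  · intro c _
    obtain ⟨r, hr, s₀, hs₀, C, hC, -, -, -, htar, hbd, -⟩ := exists_velocityField_near hH hφ c
    have hball : ∀ᶠ y in 𝓝 c,
        extChartAt (𝓡 n) c y ∈ Metric.ball (extChartAt (𝓡 n) c c) (r / 2) :=
      (continuousAt_extChartAt (I := 𝓡 n) c) (Metric.ball_mem_nhds _ (by positivity))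
    refine ⟨_, mem_nhdsWithin_of_mem_nhds (hball.and
      (extChartAt_source_mem_nhds (I := 𝓡 n) c)), s₀, hs₀, fun f hf => ?_⟩
    have hfc : ContDiffOn ℝ 1 (fun z => f ((extChartAt (𝓡 n) c).symm z))
        (extChartAt (𝓡 n) c).target := by
      rw [← contMDiffOn_iff_contDiffOn]
      exact hf.comp_contMDiffOn (contMDiffOn_extChartAt_symm (I := 𝓡 n) (n := 1) c)
    have hto := isOpen_extChartAt_target (I := 𝓡 n) c
    obtain ⟨B, hB⟩ := (isCompact_closedBall (extChartAt (𝓡 n) c c) (r / 2)).exists_bound_of_continuousOn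
      ((hfc.continuousOn_fderiv_of_isOpen hto le_rfl).mono
        ((Metric.closedBall_subset_ball (by linarith)).trans htar))
    have hB0 : 0 ≤ B := (norm_nonneg _).trans
      (hB _ (Metric.mem_closedBall_self (by positivity)))
    refine ⟨B * C, by positivity, ?_⟩
    rintro s hs hss y ⟨hyr, hys⟩
    have hyr' := Metric.ball_subset_ball (by linarith : r / 2 ≤ r) hyr
    have hd : HasFDerivAt (fun z => f ((extChartAt (𝓡 n) c).symm z))
        (fderiv ℝ (fun z => f ((extChartAt (𝓡 n) c).symm z)) (extChartAt (𝓡 n) c y))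
        (extChartAt (𝓡 n) c y) :=
      ((hfc.contDiffAt (hto.mem_nhds (htar hyr'))).differentiableAt one_ne_zero).hasFDerivAt
    have hm : differential n f y = (fderiv ℝ (fun z => f ((extChartAt (𝓡 n) c).symm z))
        (extChartAt (𝓡 n) c y)).comp (chartD c y) :=
      (hasMFDerivAt_of_hasFDerivAt_chart hys hd).mfderiv
    rw [hm]
    refine (ContinuousLinearMap.le_opNorm (fderiv ℝ (fun z => f ((extChartAt (𝓡 n) c).symm z))
      (extChartAt (𝓡 n) c y)) _).trans ?_
    exact mul_le_mul (hB _ (Metric.ball_subset_closedBall hyr)) (hbd s hs hss y hys hyr')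
      (norm_nonneg _) hB0

/-- The velocities of the approximating curves converge weakly-* to that of the limit curve. -/
theorem exists_weakStarAlong_limit (hH : IsTonelli H) (hφ : IsSemiconcave n φ) (hT : 0 ≤ T)
    (hΔ : Tendsto (fun m => (Δ m).width) atTop (𝓝 0))
    (hxs : ∀ m, IsSolution H φ (Δ m) T x₀ (xs m))
    (hx : TendstoUniformlyOn xs x atTop (Icc 0 T)) {V : ∀ t, TangentSpace (𝓡 n) (x t)}
    (hV : ∀ᵐ t ∂(volume.restrict (Icc 0 T)), HasVelocityAt x t (V t)) :
    ∃ m : ℕ → ℕ, StrictMono m ∧ WeakStarAlong T (fun k => xs (m k))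
      (fun k t => Hp H (xs (m k) t) (momentum H φ (Δ (m k)) t (xs (m k) t))) x V := by
  obtain ⟨s₀, hs₀, hbd⟩ := exists_abs_differential_velocityField_le hH hφ
  obtain ⟨m₀, hm₀⟩ := eventually_atTop.1 (hΔ.eventually (Iic_mem_nhds hs₀))
  -- Only indices with width above s₀ are discarded: for them the velocity field is not known to be
  -- bounded.
  refine ⟨fun k => k + m₀, strictMono_id.add_const m₀, fun f hf => ?_⟩
  obtain ⟨C, hC, hfC⟩ := hbd f hf
  have hfd : ∀ y, MDifferentiableAt (𝓡 n) 𝓘(ℝ, ℝ) f y := hf.mdifferentiable one_ne_zero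
  set g : ℕ → ℝ → ℝ := fun k t => differential n f (xs (k + m₀) t)
    (Hp H (xs (k + m₀) t) (momentum H φ (Δ (k + m₀)) t (xs (k + m₀) t))) with hg
  have hgC : ∀ k, ∀ t ≥ 0, ‖g k t‖ ≤ C := fun k t ht => by
    have hw := (Δ (k + m₀)).next_sub_mem ht
    exact hfC _ hw.1 (hw.2.trans (hm₀ _ (Nat.le_add_left _ _))) _
  have hgd : ∀ k, ∀ t ∈ Ioo 0 T \ range (Δ (k + m₀)).τ,
      HasDerivAt (fun s => f (xs (k + m₀) s)) (g k t) t := fun k t ht =>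
    ((hxs (k + m₀)).ode t ht.1 ht.2).hasDerivAt_comp (hfd _)
  have hcount : ∀ k, (range (Δ (k + m₀)).τ).Countable := fun k => countable_range _
  have hprim : ∀ k, ∀ a b, 0 ≤ a → a ≤ b → b ≤ T →
      ∫ t in a..b, g k t = f (xs (k + m₀) b) - f (xs (k + m₀) a) := by
    intro k a b ha hab hb
    have hd : ∀ t ∈ Ioo a b \ range (Δ (k + m₀)).τ,
        HasDerivAt (fun s => f (xs (k + m₀) s)) (g k t) t := fun t ht =>
      hgd k t ⟨⟨ha.trans_lt ht.1.1, ht.1.2.trans_le hb⟩, ht.2⟩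
    refine integral_eq_of_hasDerivAt_off_countable_of_le (fun s => f (xs (k + m₀) s)) (g k) hab
      (hcount k) ?_ hd (intervalIntegrable_of_hasDerivAt_off_countable hab (hcount k) hd
        fun t ht => hgC k t (ha.trans ht.1.1.le))
    exact hf.continuous.comp_continuousOn ((hxs (k + m₀)).continuousOn.mono (Icc_subset_Icc ha hb))
  have hlim : ∀ t ∈ Icc 0 T, Tendsto (fun k => f (xs (k + m₀) t)) atTop (𝓝 (f (x t))) :=
    fun t ht => hf.continuous.continuousAt.tendsto.comp
      ((hx.tendsto_at ht).comp (tendsto_add_atTop_nat m₀))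
  have hlip : LipschitzOnWith C.toNNReal (fun t => f (x t)) (Icc 0 T) := by
    refine LipschitzOnWith.of_le_add_mul _ fun a ha b hb => ?_
    have hk : ∀ k, f (xs (k + m₀) a) ≤ f (xs (k + m₀) b) + C.toNNReal * dist a b := by
      intro k
      rw [Real.coe_toNNReal C hC, Real.dist_eq]
      have key : ∀ a b, 0 ≤ a → a ≤ b → b ≤ T →
          |f (xs (k + m₀) b) - f (xs (k + m₀) a)| ≤ C * |b - a| := by
        intro a b ha hab hb
        rw [← hprim k a b ha hab hb, ← Real.norm_eq_abs]
        refine intervalIntegral.norm_integral_le_of_norm_le_const fun t ht => ?_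
        rw [uIoc_of_le hab] at ht
        exact hgC k t (ha.trans ht.1.le)
      rcases le_total a b with hab | hab
      · have := (abs_le.1 (key a b ha.1 hab hb.2)).1
        rw [abs_sub_comm] at this
        linarith
      · have := (abs_le.1 (key b a hb.1 hab ha.2)).2
        linarith
    exact le_of_tendsto_of_tendsto' (hlim a ha) ((hlim b hb).add_const _) hk
  have hVd : ∀ᵐ t ∂(volume.restrict (Icc 0 T)), t ∈ Ioo 0 T ∧
      HasDerivAt (fun s => f (x s)) (differential n f (x t) (V t)) t := by
    filter_upwards [hV, ae_mem_Ioo_diff_of_countable (a := 0) (b := T) countable_empty]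
      with t ht htI
    exact ⟨htI.1, ht.hasDerivAt_comp (hfd _)⟩
  have hVC : ∀ᵐ t ∂(volume.restrict (Icc 0 T)), ‖differential n f (x t) (V t)‖ ≤ C := by
    filter_upwards [hVd] with t ht
    rw [← ht.2.deriv]
    have := norm_deriv_le_of_lipschitzOn (Icc_mem_nhds ht.1.1 ht.1.2) hlip
    rwa [Real.coe_toNNReal C hC] at this
  have hVm : AEStronglyMeasurable (fun t => differential n f (x t) (V t))
      (volume.restrict (Icc 0 T)) :=
    (stronglyMeasurable_deriv fun s => f (x s)).aestronglyMeasurable.congr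
      (hVd.mono fun t ht => ht.2.deriv)
  refine weakStarLInfty_of_primitives (g := g) (g₀ := fun t => differential n f (x t) (V t))
    (C := C) hT
    (fun k => memLp_top_of_hasDerivAt_off_countable (hcount k) (hgd k)
      fun t ht => hgC k t ht.1.1.le) (memLp_top_of_bound hVm C hVC) (fun k => ?_) hVC fun b hb => ?_
  · filter_upwards [ae_restrict_mem measurableSet_Icc] with t ht
    exact hgC k t ht.1
  · have h0 : (0 : ℝ) ∈ Icc 0 T := left_mem_Icc.2 hT
    have hac : AbsolutelyContinuousOnInterval (fun t => f (x t)) 0 b := by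
      refine (hlip.mono ?_).absolutelyContinuousOnInterval
      rw [uIcc_of_le hb.1]
      exact Icc_subset_Icc_right hb.2
    have hint : ∫ t in (0 : ℝ)..b, differential n f (x t) (V t) = f (x b) - f (x 0) := by
      rw [← hac.integral_deriv_eq_sub]
      refine intervalIntegral.integral_congr_ae_restrict ?_
      rw [uIoc_of_le hb.1]
      have hsub : Ioc 0 b ⊆ Icc 0 T := fun t ht => ⟨ht.1.le, ht.2.trans hb.2⟩
      exact ae_mono (Measure.restrict_mono_set volume hsub) (hVd.mono fun t ht => ht.2.deriv.symm)
    rw [hint]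
    refine ((hlim b hb).sub (hlim 0 h0)).congr fun k => ?_
    rw [hprim k 0 b le_rfl hb.1 hb.2]

end Limit

end

end GHGF

theorem mainTheorem3 {n : ℕ} {M : Type*} [MetricSpace M] [CompactSpace M] [ConnectedSpace M]
    [ChartedSpace (EuclideanSpace ℝ (Fin n)) M] [IsManifold (𝓡 n) ∞ M]
    [RiemannianBundle (fun x : M => TangentSpace (𝓡 n) x)]
    [IsContMDiffRiemannianBundle (𝓡 n) ∞ (EuclideanSpace ℝ (Fin n))
      (fun x : M => TangentSpace (𝓡 n) x)]
    [IsRiemannianManifold (𝓡 n) M]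
    (H : ∀ x : M, GHGF.CotangentSpace n x → ℝ) (hH : GHGF.IsTonelli H)
    (φ : M → ℝ) (hφ : GHGF.IsSemiconcave n φ)
    (T : ℝ) (hT : 0 < T) (x₀ : M)
    (Δ : ℕ → GHGF.HalfLinePartition) (hΔ : Tendsto (fun m => (Δ m).width) atTop (𝓝 0))
    (xs : ℕ → ℝ → M) (hxs : ∀ m, GHGF.IsSolution H φ (Δ m) T x₀ (xs m))
    (x : ℝ → M) (hx : TendstoUniformlyOn xs x atTop (Icc 0 T)) :
    ∃ ν : ∀ t : ℝ, Measure (GHGF.CotangentSpace n (x t)),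
      (∀ t ∈ Icc 0 T, IsProbabilityMeasure (ν t) ∧
        (ν t).support ⊆ GHGF.superdifferential n φ (x t)) ∧
      (∃ m : ℕ → ℕ, StrictMono m ∧
        GHGF.WeakStarAlong T (fun k => xs (m k))
          (fun k t => GHGF.Hp H (xs (m k) t)
            (GHGF.momentum H φ (Δ (m k)) t (xs (m k) t)))
          x (fun t => ∫ p, GHGF.Hp H (x t) p ∂(ν t))) ∧
      (∀ᵐ t ∂(volume.restrict (Icc 0 T)),
        GHGF.HasVelocityAt x t (∫ p, GHGF.Hp H (x t) p ∂(ν t))) ∧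
      GHGF.IsGeneralizedCharacteristic H φ T x₀ x := by
  have hc : ContinuousOn x (Icc 0 T) :=
    hx.continuousOn (Eventually.of_forall fun m => (hxs m).continuousOn).frequently
  have hvel := GHGF.ae_hasVelocityAt_limit hH hφ hΔ hxs hx hc
  have hco : ∀ t ∈ Ioo 0 T, ∀ v : TangentSpace (𝓡 n) (x t), GHGF.HasVelocityAt x t v →
      v ∈ convexHull ℝ (GHGF.Hp H (x t) '' GHGF.superdifferential n φ (x t)) :=
    fun t ht v hv => GHGF.mem_convexHull_of_hasVelocityAt_limit hH hφ hΔ hxs hx hc ht hv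
  -- Here ν_t is chosen after the velocity, as a measure whose mean of H_p is that velocity. The
  -- remaining times, which include the endpoints and form a null set, get any probability measure
  -- supported in D⁺φ(x(t)).
  have hν : ∀ t, ∃ ν : Measure (GHGF.CotangentSpace n (x t)), IsProbabilityMeasure ν ∧
      ν.support ⊆ GHGF.superdifferential n φ (x t) ∧
      ∀ v : TangentSpace (𝓡 n) (x t), t ∈ Ioo 0 T → GHGF.HasVelocityAt x t v →
        ∫ p, GHGF.Hp H (x t) p ∂ν = v := by
    intro t
    have : FiniteDimensional ℝ (TangentSpace (𝓡 n) (x t)) :=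
      inferInstanceAs (FiniteDimensional ℝ (EuclideanSpace ℝ (Fin n)))
    have : CompleteSpace (TangentSpace (𝓡 n) (x t)) := FiniteDimensional.complete ℝ _
    by_cases h : t ∈ Ioo 0 T ∧ ∃ v : TangentSpace (𝓡 n) (x t), GHGF.HasVelocityAt x t v
    · obtain ⟨ht, v, hv⟩ := h
      obtain ⟨ν, hprob, hsupp, hint⟩ := GHGF.exists_measure_of_mem_convexHull (hco t ht v hv)
      refine ⟨ν, hprob, hsupp, fun w _ hw => ?_⟩
      rw [hint, ← hv.velocity_eq, ← hw.velocity_eq]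
    · obtain ⟨p, hp⟩ := GHGF.superdifferential_nonempty hH hφ (x t)
      obtain ⟨ν, hprob, hsupp, -⟩ := GHGF.exists_measure_of_mem_convexHull
        (subset_convexHull ℝ _ (mem_image_of_mem (GHGF.Hp H (x t)) hp))
      exact ⟨ν, hprob, hsupp, fun v ht hv => absurd ⟨ht, v, hv⟩ h⟩
  choose ν hprob hsupp hint using hν
  have hode : ∀ᵐ t ∂(volume.restrict (Icc 0 T)),
      GHGF.HasVelocityAt x t (∫ p, GHGF.Hp H (x t) p ∂(ν t)) := by
    filter_upwards [hvel] with t ⟨ht, v, hv⟩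
    rwa [hint t v ht hv]
  refine ⟨ν, fun t _ => ⟨hprob t, hsupp t⟩,
    GHGF.exists_weakStarAlong_limit hH hφ hT.le hΔ hxs hx hode, hode,
    GHGF.exists_lipschitzOnWith_limit hH hφ hΔ hxs hx hc, ?_, ?_⟩
  · have h0 := hx.tendsto_at (left_mem_Icc.2 hT.le)
    simp only [(hxs _).initial] at h0
    exact tendsto_nhds_unique h0 tendsto_const_nhds
  · filter_upwards [hvel] with t ⟨ht, v, hv⟩
    exact ⟨v, hv, hco t ht v hv⟩
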